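/- Let $\rho_1,\rho_2,\rho_3,\kappa,b,m,\delta,\beta,\tau$ be positive constants, and let $g:(0,\infty)\to[0,\infty)$ be differentiable with $-k_1 g\le g'\le -k_2 g$ for some constants $k_1,k_2>0$, and with $a:=b-\int_0^\infty g(s)\,ds>0$. Consider on $\mathbb R$ the Timoshenko–Cattaneo system with past history for $U=(v,u,z,y,\theta,q,\eta)$, where $v,u,z,y,\theta,q$ are functions of $(t,x)$ and $\eta$ is a function of $(t,s,x)$, $s>0$: $$\begin{cases} v_t-u_x+y=0,\\ \rho_1u_t-\kappa v_x=0,\\ z_t-y_x=0,\\ \rho_2y_t-az_x-m\int_0^\infty g(s)\eta_{xx}(s)\,ds-\kappa v+\delta\theta_x=0,\\ \rho_3\theta_t+q_x+\delta y_x=0,\\ \tau q_t+\beta q+\theta_x=0,\\ \eta_t+\eta_s-y=0,\qquad \eta(\cdot,0,\cdot)=0.\end{cases}$$ Functions are complex-valued (in particular, possibly real-valued). For a space $X$ of functions of $x$, $L^2_g(\mathbb R^+;X)$ denotes the $X$-valued functions on $(0,\infty)$ that are square integrable with respect to $g(s)\,ds$. A solution is a weak solution $U\in C\big([0,\infty);[L^2(\mathbb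 R)]^6\times L^2_g(\mathbb R^+;H^1(\mathbb R))\big)$, and $U_0=U(0)$. Put $$\|\partial_x^jU\|_2^2=\sum_{f\in\{v,u,z,y,\theta,q\}}\|\partial_x^jf\|_{L^2}^2+\int_0^\infty g(s)\|\partial_x^{j+1}\eta(s)\|_{L^2}^2\,ds,$$ $$\|U\|_1=\sum_{f\in\{v,u,z,y,\theta,q\}}\|f\|_{L^1}+\Big(\int_0^\infty g(s)\|\partial_x\eta(s)\|_{L^1}^2\,ds\Big)^{1/2},$$ and $$\chi_{0,\tau}=\Big(\tau-\frac{\rho_1}{\rho_3\kappa}\Big)\Big(\rho_2-\frac{b\rho_1}{\kappa}\Big)-\frac{\tau\rho_1\delta^2}{\rho_3\kappa}.$$ Let $s$ be a nonnegative integer. Then there is a constant $C>0$, depending only on the constants of the system, on $g$ and on $s$, such that every solution $U$ with $$U_0\in\big([H^s(\mathbb R)]^6\times L^2_g(\mathbb R^+;H^{1+s}(\mathbb R))\big)\cap\big([L^1(\mathbb R)]^6\times L^2_g(\mathbb R^+;W^{1,1}(\mathbb R))\big)$$ satisfies, for all integers $k,l\ge0$ with $k+l\le s$ and all $t\ge0$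 (the derivatives on the left-hand sides existing as square integrable functions): (i) if $\chi_{0,\tau}=0$, then $$\|\partial_x^kU(t)\|_2\le C(1+t)^{-\frac18-\frac k4}\|U_0\|_1+C(1+t)^{-\frac l2}\|\partial_x^{k+l}U_0\|_2;$$ (ii) if $\chi_{0,\tau}\ne0$, then $$\|\partial_x^kU(t)\|_2\le C(1+t)^{-\frac18-\frac k4}\|U_0\|_1+C(1+t)^{-\frac l4}\|\partial_x^{k+l}U_0\|_2.$$ -/

import Mathlib

open MeasureTheory Set Filter Topology TemperedDistribution
open scoped ENNReal SchwartzMap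

noncomputable section

namespace TimoshenkoCattaneo

/-- The positive physical constants of the system. The coefficient of the shear term, called `k` in
`ρ₁ u_t - k v_x = 0`, is written `κ`, since `k` also denotes an order of differentiation. -/
structure Params where
  (ρ₁ ρ₂ ρ₃ κ b m δ β τ : ℝ)
  ρ₁_pos : 0 < ρ₁
  ρ₂_pos : 0 < ρ₂
  ρ₃_pos : 0 < ρ₃
  κ_pos : 0 < κ
  b_pos : 0 < b
  m_pos : 0 < m
  δ_pos : 0 < δ
  β_pos : 0 < β
  τ_pos : 0 < τ

/-- The stability number `χ_{0,τ}`. -/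
def Params.χ (P : Params) : ℝ :=
  (P.τ - P.ρ₁ / (P.ρ₃ * P.κ)) * (P.ρ₂ - P.b * P.ρ₁ / P.κ)
    - P.τ * P.ρ₁ * P.δ ^ 2 / (P.ρ₃ * P.κ)

/-- The coefficient `a = b - b₀`, where `b₀ = ∫₀^∞ g(s) ds`. -/
def Params.a (P : Params) (g : ℝ → ℝ) : ℝ := P.b - ∫ s in Ioi (0 : ℝ), g s

/-- The hypotheses on the memory kernel `g` on `(0, ∞)`: it is nonnegative and differentiable,
`-k₁ g ≤ g' ≤ -k₂ g` for some positive constants `k₁, k₂`, and `b - ∫₀^∞ g > 0`.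
(The differential inequality makes `g` bounded and exponentially decaying, hence integrable.) -/
structure IsKernel (P : Params) (g : ℝ → ℝ) : Prop where
  nonneg : ∀ s, 0 < s → 0 ≤ g s
  differentiable : ∀ s, 0 < s → DifferentiableAt ℝ g s
  deriv_bounds : ∃ k₁ > 0, ∃ k₂ > 0, ∀ s, 0 < s →
    -k₁ * g s ≤ deriv g s ∧ deriv g s ≤ -k₂ * g s
  a_pos : 0 < P.a g

/-- The space `L²(ℝ)` of (complex valued) square integrable functions of `x`. -/
abbrev L2 : Type := Lp ℂ 2 (volume : Measure ℝ)

/-- The tempered distribution defined by an `L²` function. -/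
abbrev distr (f : L2) : 𝓢'(ℝ, ℂ) := (f : 𝓢'(ℝ, ℂ))

/-- The distributional derivative `∂ₓ` of a tempered distribution on `ℝ`. -/
abbrev dx (T : 𝓢'(ℝ, ℂ)) : 𝓢'(ℝ, ℂ) := derivCLM ℂ T

/-- `h = ∂ₓ^j f` in the sense of distributions. -/
def IsWeakDeriv (j : ℕ) (f h : L2) : Prop := dx^[j] (distr f) = distr h

/-- `‖∂ₓ^j f‖₂ ∈ [0, ∞]`, which is `∞` if the distributional derivative `∂ₓ^j f` is not in `L²`.
(There is at most one `h` as in the definition.) -/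
def derivNorm (j : ℕ) (f : L2) : ℝ≥0∞ :=
  ⨅ (h : L2) (_ : IsWeakDeriv j f h), ‖h‖ₑ

/-- The weighted measure `g(s) ds` on `(0, ∞)`. -/
def histMeasure (g : ℝ → ℝ) : Measure ℝ :=
  (volume.restrict (Ioi 0)).withDensity fun s => ENNReal.ofReal (g s)

/-- `ζ = ∂ₓ^j η` for elements of `L²_g(ℝ⁺; L²(ℝ))`. -/
def IsHistDeriv (g : ℝ → ℝ) (j : ℕ) (η ζ : ℝ → L2) : Prop :=
  MemLp ζ 2 (histMeasure g) ∧ ∀ᵐ s ∂histMeasure g, IsWeakDeriv j (η s) (ζ s)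

/-- `‖∂ₓ^j η‖ = (∫₀^∞ g(s) ‖∂ₓ^j η(s)‖₂² ds)^{1/2} ∈ [0, ∞]`, which is `∞` if the derivative
`∂ₓ^j η` is not in `L²_g(ℝ⁺; L²(ℝ))`. -/
def histDerivNorm (g : ℝ → ℝ) (j : ℕ) (η : ℝ → L2) : ℝ≥0∞ :=
  ⨅ (ζ : ℝ → L2) (_ : IsHistDeriv g j η ζ), eLpNorm ζ 2 (histMeasure g)

/-- `η ∈ L²_g(ℝ⁺; H^r(ℝ))`. -/
def MemHistH (g : ℝ → ℝ) (r : ℕ) (η : ℝ → L2) : Prop :=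
  MemLp η 2 (histMeasure g) ∧ ∀ j ≤ r, histDerivNorm g j η < ⊤

/-- The norm `(∫₀^∞ g(s) ‖ζ(s)‖₁² ds)^{1/2} ∈ [0, ∞]` of `L²_g(ℝ⁺; L¹(ℝ))`. -/
def histL1 (g : ℝ → ℝ) (ζ : ℝ → L2) : ℝ≥0∞ :=
  (∫⁻ s, (eLpNorm (ζ s) 1 volume) ^ 2 ∂histMeasure g) ^ (1 / 2 : ℝ)

/-- The history norm based on `L¹(ℝ)`: `(∫₀^∞ g(s) ‖∂ₓ η(s)‖₁² ds)^{1/2} ∈ [0, ∞]`. -/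
def histDerivL1 (g : ℝ → ℝ) (η : ℝ → L2) : ℝ≥0∞ :=
  ⨅ (ζ : ℝ → L2) (_ : IsHistDeriv g 1 η ζ), histL1 g ζ

/-- The values `(v, u, z, y, θ, q, η)` of the unknowns at a fixed time; `η s` is the function
`x ↦ η(s, x)`, of which only the values for `s > 0` matter. -/
structure State where
  (v u z y θ q : L2)
  η : ℝ → L2

/-- `U ∈ ℍ^s(ℝ) = [H^s(ℝ)]⁶ × L²_g(ℝ⁺; H^{1+s}(ℝ))`. -/
def State.MemH (g : ℝ → ℝ) (s : ℕ) (U : State) : Prop :=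
  MemSobolev (s : ℝ) 2 (distr U.v) ∧ MemSobolev (s : ℝ) 2 (distr U.u) ∧
  MemSobolev (s : ℝ) 2 (distr U.z) ∧ MemSobolev (s : ℝ) 2 (distr U.y) ∧
  MemSobolev (s : ℝ) 2 (distr U.θ) ∧ MemSobolev (s : ℝ) 2 (distr U.q) ∧
  MemHistH g (1 + s) U.η

/-- `‖U‖₁ ∈ [0, ∞]`: the `L¹` norms of the six functions of `x`, and the history norm of `η`. -/
def State.norm1 (g : ℝ → ℝ) (U : State) : ℝ≥0∞ :=
  eLpNorm U.v 1 volume + eLpNorm U.u 1 volume + eLpNorm U.z 1 volume + eLpNorm U.y 1 volume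
    + eLpNorm U.θ 1 volume + eLpNorm U.q 1 volume + histDerivL1 g U.η

/-- `U ∈ 𝕃¹(ℝ) = [L¹(ℝ)]⁶ × L²_g(ℝ⁺; W^{1,1}(ℝ))`. -/
def State.MemL1 (g : ℝ → ℝ) (U : State) : Prop :=
  MemLp U.v 1 volume ∧ MemLp U.u 1 volume ∧ MemLp U.z 1 volume ∧ MemLp U.y 1 volume ∧
  MemLp U.θ 1 volume ∧ MemLp U.q 1 volume ∧ histL1 g U.η < ⊤ ∧ histDerivL1 g U.η < ⊤

/-- `‖∂ₓ^j U‖₂ ∈ [0, ∞]`, where the history component is measured by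
`‖∂ₓ^j η‖² = ∫₀^∞ g(s) ‖∂ₓ^{j+1} η(s)‖₂² ds`. It is `∞` if one of the derivatives involved does not
exist as a square integrable function. -/
def State.derivNorm2 (g : ℝ → ℝ) (j : ℕ) (U : State) : ℝ≥0∞ :=
  (derivNorm j U.v ^ 2 + derivNorm j U.u ^ 2 + derivNorm j U.z ^ 2 + derivNorm j U.y ^ 2
    + derivNorm j U.θ ^ 2 + derivNorm j U.q ^ 2 + histDerivNorm g (j + 1) U.η ^ 2) ^ (1 / 2 : ℝ)

/-- The time derivative of `F` at `t ≥ 0` is `F'`, one-sided at `t = 0`. -/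
def HasTimeDeriv (F : ℝ → ℂ) (F' : ℂ) (t : ℝ) : Prop := HasDerivWithinAt F F' (Ici 0) t

/-- `U` is a weak solution, continuous in time with values in `[L²(ℝ)]⁶ × L²_g(ℝ⁺; H¹(ℝ))`, of

* `v_t - u_x + y = 0`,
* `ρ₁ u_t - κ v_x = 0`,
* `z_t - y_x = 0`,
* `ρ₂ y_t - a z_x - m ∫₀^∞ g(s) η_xx(s) ds - κ v + δ θ_x = 0`,
* `ρ₃ θ_t + q_x + δ y_x = 0`,
* `τ q_t + β q + θ_x = 0`,
* `η_t + η_s - y = 0`, `η(·, 0, ·) = 0`.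

The first six equations are tested with Schwartz functions `φ` of `x`; the last one is tested with
products `w(s) φ(x)`, where `w` is smooth with compact support in `ℝ` and need not vanish at `s = 0`,
which expresses the boundary condition `η(·, 0, ·) = 0`. -/
structure IsSolution (P : Params) (g : ℝ → ℝ) (U : ℝ → State) : Prop where
  continuous_v : ContinuousOn (fun t => (U t).v) (Ici 0)
  continuous_u : ContinuousOn (fun t => (U t).u) (Ici 0)
  continuous_z : ContinuousOn (fun t => (U t).z) (Ici 0)
  continuous_y : ContinuousOn (fun t => (U t).y) (Ici 0)
  continuous_θ : ContinuousOn (fun t => (U t).θ) (Ici 0)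
  continuous_q : ContinuousOn (fun t => (U t).q) (Ici 0)
  mem_η : ∀ t, 0 ≤ t → MemHistH g 1 (U t).η
  continuous_η : ∀ t, 0 ≤ t → ∀ j ≤ 1,
    Tendsto (fun r => histDerivNorm g j ((U r).η - (U t).η)) (𝓝[Ici 0] t) (𝓝 0)
  eq_v : ∀ (φ : 𝓢(ℝ, ℂ)) (t : ℝ), 0 ≤ t →
    HasTimeDeriv (fun r => distr (U r).v φ) (dx (distr (U t).u) φ - distr (U t).y φ) t
  eq_u : ∀ (φ : 𝓢(ℝ, ℂ)) (t : ℝ), 0 ≤ t →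
    HasTimeDeriv (fun r => P.ρ₁ * distr (U r).u φ) (P.κ * dx (distr (U t).v) φ) t
  eq_z : ∀ (φ : 𝓢(ℝ, ℂ)) (t : ℝ), 0 ≤ t →
    HasTimeDeriv (fun r => distr (U r).z φ) (dx (distr (U t).y) φ) t
  eq_y : ∀ (φ : 𝓢(ℝ, ℂ)) (t : ℝ), 0 ≤ t →
    HasTimeDeriv (fun r => P.ρ₂ * distr (U r).y φ)
      (P.a g * dx (distr (U t).z) φ
        + P.m * (∫ s in Ioi (0 : ℝ), ((g s : ℝ) : ℂ) * dx (dx (distr ((U t).η s))) φ)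
        + P.κ * distr (U t).v φ - P.δ * dx (distr (U t).θ) φ) t
  eq_θ : ∀ (φ : 𝓢(ℝ, ℂ)) (t : ℝ), 0 ≤ t →
    HasTimeDeriv (fun r => P.ρ₃ * distr (U r).θ φ)
      (-(dx (distr (U t).q) φ) - P.δ * dx (distr (U t).y) φ) t
  eq_q : ∀ (φ : 𝓢(ℝ, ℂ)) (t : ℝ), 0 ≤ t →
    HasTimeDeriv (fun r => P.τ * distr (U r).q φ)
      (-(P.β * distr (U t).q φ) - dx (distr (U t).θ) φ) t
  eq_η : ∀ (w : ℝ → ℝ), ContDiff ℝ (⊤ : ℕ∞) w → HasCompactSupport w →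
    ∀ (φ : 𝓢(ℝ, ℂ)) (t : ℝ), 0 ≤ t →
    HasTimeDeriv (fun r => ∫ s in Ioi (0 : ℝ), ((w s : ℝ) : ℂ) * distr ((U r).η s) φ)
      ((∫ s in Ioi (0 : ℝ), ((deriv w s : ℝ) : ℂ) * distr ((U t).η s) φ)
        + (∫ s in Ioi (0 : ℝ), ((w s : ℝ) : ℂ)) * distr (U t).y φ) t

end TimoshenkoCattaneo

end

/-!
The system has constant coefficients, so by Plancherel's theorem it suffices to follow the energy of
a solution frequency by frequency. Solutions are weak and their Fourier transform is only an element
of `L²`; therefore the role of a single frequency is played by a dyadic *shell*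
`R ≤ ‖2πiξ‖ < 2R`. After restriction to a shell, `∂ₓ` is a bounded, skew-adjoint and boundedly
invertible operator on `L²` (`shellDeriv`), and the weak equations become a genuine differential
equation in `L²` (`hasDerivAt_shellFourier`, `IsSolution.isShellFlow`).

*The history.* Solving `η_t + η_s = y` along characteristics gives `η(t, s) = Y(t) - Y(t - s)`, where
`Y` is a primitive of `y` that the initial history extends to negative times
(`IsTransportSolution.exists_eq_sub`). The substitution `r = t - s` moves the time derivative of
`∫ g(s) ‖∂ₓη(s)‖² ds` to the kernel, and `g' ≤ -k₂ g` shows that the history is dissipated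
(`exists_deriv_history_energy`). A kernel is either identically zero or positive everywhere; in the
first case the history carries no weight, in the second the weighted space embeds into the locally
integrable functions.

*Decay in a shell.* The physical energy dissipates only `q` and the history
(`energy_derivative`). Adding five cross terms to a large multiple of it yields a Lyapunov functional
that decays at the rate `R⁴ / (1 + R²)³` (`exists_shell_decay`): each cross term controls one of `θ`,
`y`, `z`, `v`, `u` by the previous ones, and the multipliers can be chosen from the last to the first
(`exists_multipliers`). All cross terms are built with `∂ₓ` divided by `(1 + R²)^{1/2}`, so that they
stay bounded by the energy, and `v` and `u` are controlled with one more such factor than `y` and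
`z`. This loss at high frequencies pays for the difference of the wave speeds, and no condition on
`χ` is needed.

*Summation.* For `R ≤ 1` the rate is at least a multiple of `R⁴`, and the Fourier transform is
bounded by the `L¹` norm, so that the shells contribute a dyadic sum comparable to
`∫ ξ^{2k} exp(-c ξ⁴ t) dξ ≲ (1 + t)^{-(2k + 1) / 4}` (`exists_tsum_zpow_mul_exp_le`). For `R ≥ 1` the
rate is at least a multiple of `R⁻²`, and `l` further derivatives of the data turn `exp(-c t / R²)`
into the square of `(1 + t)^{-l / 2}` (`exists_exp_neg_div_sq_le`). The resulting estimate
`exists_derivNorm2_le` is the one claimed for `χ = 0`; it holds for every `χ` and is stronger than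
the one claimed for `χ ≠ 0`.
-/

namespace TimoshenkoCattaneo

/-! ### Closing the estimates: choice of the multipliers -/

lemma exists_young {e : ℝ} (he : 0 < e) (K : ℝ) :
    ∃ M : ℝ, 0 ≤ M ∧ K ≤ M ∧ ∀ x y : ℝ, K * (x * y) ≤ e * x ^ 2 + M * y ^ 2 := by
  refine ⟨K ^ 2 / (4 * e) + |K|, by positivity, ?_, fun x y => ?_⟩
  · have : 0 ≤ K ^ 2 / (4 * e) := by positivity
    linarith [le_abs_self K]
  · have h : e * x ^ 2 + K ^ 2 / (4 * e) * y ^ 2 - K * (x * y)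
        = (2 * e * x - K * y) ^ 2 / (4 * e) := by
      field_simp
      ring
    have h1 : 0 ≤ (2 * e * x - K * y) ^ 2 / (4 * e) := by positivity
    have h2 : 0 ≤ |K| * y ^ 2 := by positivity
    linarith

/-- If `X` controls `x²` up to a small multiple of `W` and some multiple of `R`, and `Y` controls
`W` up to a multiple of `x² + R`, then a combination of them controls `x² + W` up to a multiple
of `R`. -/
lemma exists_multiplier {p c M : ℝ} (hp : 0 < p) (hc : 0 < c) (hM : 0 ≤ M) :
    ∃ n > 0, ∃ e > 0, ∀ M₁ ≥ 0, ∃ c' > 0, ∃ M' ≥ 0, ∀ x W R X Y : ℝ, 0 ≤ W → 0 ≤ R →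
      X ≤ -p * x ^ 2 + e * W + M₁ * R → Y ≤ -c * W + M * (x ^ 2 + R) →
      n * X + Y ≤ -c' * (x ^ 2 + W) + M' * R := by
  have hn : 0 < (M + 1) / p := by positivity
  refine ⟨(M + 1) / p, hn, c / 2 / ((M + 1) / p), by positivity, fun M₁ hM₁ =>
    ⟨min 1 (c / 2), by positivity, (M + 1) / p * M₁ + M, by positivity, ?_⟩⟩
  intro x W R X Y hW hR hX hY
  have h1 := mul_le_mul_of_nonneg_left hX hn.le
  have h2 : (M + 1) / p * (-p * x ^ 2 + c / 2 / ((M + 1) / p) * W + M₁ * R)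
      = -(M + 1) * x ^ 2 + c / 2 * W + (M + 1) / p * M₁ * R := by
    field_simp
  have h3 : min 1 (c / 2) * x ^ 2 ≤ 1 * x ^ 2 :=
    mul_le_mul_of_nonneg_right (min_le_left _ _) (sq_nonneg x)
  have h4 : min 1 (c / 2) * W ≤ c / 2 * W :=
    mul_le_mul_of_nonneg_right (min_le_right _ _) hW
  linarith

/-- Closes a chain of five estimates in which each of `A`, `B`, `C`, `V`, `U` is dissipated up to
products with the other quantities, while `Q` and `N` are controlled otherwise. The estimates are
combined from the last to the first: the multiplier of each is chosen large enough to absorb the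
errors that the later ones leave in its dissipated quantity. -/
lemma exists_multipliers {p K : ℝ} (hp : 0 < p) (hK : 0 ≤ K) :
    ∃ n₁ > 0, ∃ n₂ > 0, ∃ n₃ > 0, ∃ n₄ > 0, ∃ c > 0, ∃ M ≥ 0,
      ∀ Q N A B C V U X₁ X₂ X₃ X₄ X₅ : ℝ,
        X₁ ≤ -p * A ^ 2 + K * (Q ^ 2 + B * Q + A * Q) →
        X₂ ≤ -p * B ^ 2 + K * (B * Q + C * A + N * A + V * A + A ^ 2) →
        X₃ ≤ -p * C ^ 2 + K * (B ^ 2 + N * C + A * C + U * Q + V * A) →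
        X₄ ≤ -p * V ^ 2 + K * (B ^ 2 + N * V + A * V + U * B) →
        X₅ ≤ -p * U ^ 2 + K * (V ^ 2 + U * Q + V * A) →
        n₁ * X₁ + (n₂ * X₂ + (n₃ * X₃ + (n₄ * X₄ + X₅)))
          ≤ -c * (A ^ 2 + (B ^ 2 + (C ^ 2 + (V ^ 2 + U ^ 2)))) + M * (Q ^ 2 + N ^ 2) := by
  obtain ⟨L₅, hL₅, hKL₅, y₅⟩ := exists_young (e := p / 2) (by positivity) K
  obtain ⟨n₄, hn₄, e₄, he₄, s₄⟩ := exists_multiplier (p := p / 2) (c := p / 2) (M := 2 * L₅ + p / 2)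
    (by positivity) (by positivity) (by positivity)
  obtain ⟨L₄', hL₄', hKL₄', y₄'⟩ := exists_young (e := p / 4) (by positivity) K
  obtain ⟨L₄, hL₄, hKL₄, y₄⟩ := exists_young he₄ K
  obtain ⟨c₄, hc₄, M₄, hM₄, s₄⟩ := s₄ (K + L₄ + 2 * L₄') (by positivity)
  obtain ⟨n₃, hn₃, e₃, he₃, s₃⟩ := exists_multiplier (p := p / 2) (by positivity) hc₄ hM₄
  obtain ⟨L₃, hL₃, hKL₃, y₃⟩ := exists_young he₃ K
  obtain ⟨c₃, hc₃, M₃, hM₃, s₃⟩ := s₃ (K + L₄' + L₃) (by positivity)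
  obtain ⟨n₂, hn₂, e₂, he₂, s₂⟩ := exists_multiplier (p := p / 2) (by positivity) hc₃ hM₃
  obtain ⟨L₂, hL₂, hKL₂, y₂⟩ := exists_young he₂ K
  obtain ⟨c₂, hc₂, M₂, hM₂, s₂⟩ := s₂ (K + 3 * L₂ + L₅ + e₂) (by positivity)
  obtain ⟨n₁, hn₁, e₁, he₁, s₁⟩ := exists_multiplier (p := p / 2) (by positivity) hc₂ hM₂
  obtain ⟨L₁, hL₁, hKL₁, y₁⟩ := exists_young he₁ K
  obtain ⟨c₁, hc₁, M₁, hM₁, s₁⟩ := s₁ (K + L₁ + L₅) (by positivity)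
  refine ⟨n₁, hn₁, n₂, hn₂, n₃, hn₃, n₄, hn₄, c₁, hc₁, M₁, hM₁, ?_⟩
  intro Q N A B C V U X₁ X₂ X₃ X₄ X₅ h₁ h₂ h₃ h₄ h₅
  have nn : ∀ {L : ℝ}, 0 ≤ L → ∀ x : ℝ, 0 ≤ L * x ^ 2 := fun hL x => mul_nonneg hL (sq_nonneg x)
  have np := hp.le
  refine s₁ A (B ^ 2 + (C ^ 2 + (V ^ 2 + U ^ 2))) (Q ^ 2 + N ^ 2) X₁ _ (by positivity)
    (by positivity) ?_ (s₂ B (C ^ 2 + (V ^ 2 + U ^ 2)) (A ^ 2 + (Q ^ 2 + N ^ 2)) X₂ _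
    (by positivity) (by positivity) ?_ (s₃ C (V ^ 2 + U ^ 2) (B ^ 2 + (A ^ 2 + (Q ^ 2 + N ^ 2)))
    X₃ _ (by positivity) (by positivity) ?_ ((s₄ V (U ^ 2) (B ^ 2 + (A ^ 2 + (Q ^ 2 + N ^ 2))) X₄
    X₅ (by positivity) (by positivity) ?_ ?_).trans ?_)))
  · linarith [y₁ B Q, y₅ A Q, nn he₁.le C, nn he₁.le V, nn he₁.le U, nn hK N, nn hL₁ N, nn hL₅ N]
  · linarith [y₅ B Q, y₂ C A, y₂ N A, y₂ V A, nn he₂.le U, nn hK Q, nn hK N, nn hL₂ Q,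
      nn hL₂ N, nn hL₅ A, nn hL₅ N, nn he₂.le A, nn he₂.le Q]
  · linarith [y₄' C N, y₄' C A, y₃ U Q, y₃ V A, nn hK A, nn hK Q, nn hK N, nn hL₄' B, nn hL₄' Q,
      nn hL₃ B, nn hL₃ N]
  · linarith [y₄' V N, y₄' V A, y₄ U B, nn hK A, nn hK Q, nn hK N, nn hL₄ A, nn hL₄ Q, nn hL₄ N,
      nn hL₄' B, nn hL₄' Q,
      nn hL₄' N, nn hL₄' A]
  · linarith [y₅ U Q, y₅ V A, mul_le_mul_of_nonneg_right hKL₅ (sq_nonneg V), nn hL₅ Q, nn hL₅ A,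
      nn hL₅ B, nn hL₅ N, nn np A, nn np B, nn np Q, nn np N, nn hL₅ V]
  · have := nn hM₄ C
    linarith

end TimoshenkoCattaneo

namespace TimoshenkoCattaneo

/-! ### The Lyapunov functional of a frequency shell -/

section Lyapunov

open scoped RealInnerProductSpace

variable {H : Type*} [NormedAddCommGroup H] [InnerProductSpace ℝ H]

lemma coeff_inner_le {c K W : ℝ} {x y : H} (hc : |c| ≤ K) (h : ‖x‖ * ‖y‖ ≤ W) :
    c * ⟪x, y⟫ ≤ K * W := by
  have h1 : |c * ⟪x, y⟫| ≤ K * W := by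
    rw [abs_mul]
    exact mul_le_mul hc ((abs_real_inner_le_norm x y).trans h) (abs_nonneg _)
      ((abs_nonneg c).trans hc)
  exact (le_abs_self _).trans h1

/-- The time derivatives of the five auxiliary functionals along the system (scaled so that the
operator `S = l T` is bounded), estimated by products of the quantities that they dissipate. Each
cross term carries the powers of `σ` and `l` that make the estimate uniform for `σ, l ≤ 1`. -/
lemma dissipation_estimates {ρ₁ ρ₂ ρ₃ κ a m δ β τ : ℝ} (hρ₁ : 0 < ρ₁) (hρ₂ : 0 < ρ₂)
    (hρ₃ : 0 < ρ₃) (hκ : 0 < κ) (ha : 0 < a) (hm : 0 < m) (hδ : 0 < δ) (hβ : 0 < β)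
    (hτ : 0 < τ) :
    ∃ p > 0, ∃ K ≥ 0, ∀ (σ l : ℝ) (S : H →L[ℝ] H), 0 < σ → σ ≤ 1 → 0 < l → l ≤ 1 →
      (∀ x, σ * ‖x‖ ≤ ‖S x‖) → (∀ x, ‖S x‖ ≤ 2 * σ * ‖x‖) → ∀ v u z y θ q n : H,
      (τ * ‖S q‖ ^ 2 + τ * δ * ⟪S y, S q⟫ - ρ₃ * β * l * ⟪S θ, q⟫ - ρ₃ * ‖S θ‖ ^ 2
        ≤ -p * (σ * ‖θ‖) ^ 2 + K * (‖q‖ ^ 2 + (σ ^ 2 * ‖y‖) * ‖q‖ + (σ * ‖θ‖) * ‖q‖)) ∧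
      (σ ^ 2 * (-ρ₃ * ⟪a • S z + m • S n + (κ * l) • v - δ • S θ, S θ⟫ - ρ₂ * ⟪S y, S q⟫
          - ρ₂ * δ * ‖S y‖ ^ 2)
        ≤ -p * (σ ^ 2 * ‖y‖) ^ 2 + K * ((σ ^ 2 * ‖y‖) * ‖q‖ + (σ ^ 2 * ‖z‖) * (σ * ‖θ‖)
          + ‖n‖ * (σ * ‖θ‖) + (σ ^ 2 * l * ‖v‖) * (σ * ‖θ‖) + (σ * ‖θ‖) ^ 2)) ∧
      (σ ^ 2 * (-a * ‖S z‖ ^ 2 + ρ₂ * ‖S y‖ ^ 2 - m * ⟪S n, S z⟫ + δ * ⟪S θ, S z⟫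
          + ρ₁ / δ * l * ⟪u, S q⟫ - ρ₃ * κ / δ * l * ⟪S v, θ⟫)
        ≤ -p * (σ ^ 2 * ‖z‖) ^ 2 + K * ((σ ^ 2 * ‖y‖) ^ 2 + ‖n‖ * (σ ^ 2 * ‖z‖)
          + (σ * ‖θ‖) * (σ ^ 2 * ‖z‖) + (σ ^ 2 * l * ‖u‖) * ‖q‖
          + (σ ^ 2 * l * ‖v‖) * (σ * ‖θ‖))) ∧
      (σ ^ 4 * (-κ * l ^ 2 * ‖v‖ ^ 2 - m * l * ⟪S n, v⟫ + δ * l * ⟪S θ, v⟫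
          + ρ₂ * l ^ 2 * ‖y‖ ^ 2 + (ρ₂ - a * ρ₁ / κ) * l * ⟪S y, u⟫)
        ≤ -p * (σ ^ 2 * l * ‖v‖) ^ 2 + K * ((σ ^ 2 * ‖y‖) ^ 2 + ‖n‖ * (σ ^ 2 * l * ‖v‖)
          + (σ * ‖θ‖) * (σ ^ 2 * l * ‖v‖) + (σ ^ 2 * l * ‖u‖) * (σ ^ 2 * ‖y‖))) ∧
      (σ ^ 2 * l ^ 2 * (-ρ₁ * ‖S u‖ ^ 2 + κ * ‖S v‖ ^ 2 + ρ₁ / δ * l * ⟪u, S q⟫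
          - ρ₃ * κ / δ * l * ⟪S v, θ⟫)
        ≤ -p * (σ ^ 2 * l * ‖u‖) ^ 2 + K * ((σ ^ 2 * l * ‖v‖) ^ 2 + (σ ^ 2 * l * ‖u‖) * ‖q‖
          + (σ ^ 2 * l * ‖v‖) * (σ * ‖θ‖))) := by
  set K := 4 * (τ + τ * δ + ρ₃ * β + ρ₃ * a + ρ₃ * m + ρ₃ * κ + ρ₃ * δ + ρ₂ + m + δ + ρ₁ / δ
    + ρ₃ * κ / δ + |ρ₂ - a * ρ₁ / κ| + κ) with hK
  have n1 : 0 < τ * δ := by positivity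
  have n2 : 0 < ρ₃ * β := by positivity
  have n3 : 0 < ρ₃ * a := by positivity
  have n4 : 0 < ρ₃ * m := by positivity
  have n5 : 0 < ρ₃ * κ := by positivity
  have n6 : 0 < ρ₃ * δ := by positivity
  have n7 : 0 < ρ₁ / δ := by positivity
  have n8 : 0 < ρ₃ * κ / δ := by positivity
  have n9 : 0 ≤ |ρ₂ - a * ρ₁ / κ| := abs_nonneg _
  obtain ⟨p, hp, hp1, hp2, hp3, hp4, hp5⟩ :
      ∃ p > 0, p ≤ ρ₃ ∧ p ≤ ρ₂ * δ ∧ p ≤ a ∧ p ≤ κ ∧ p ≤ ρ₁ := by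
    refine ⟨min ρ₃ (min (ρ₂ * δ) (min a (min κ ρ₁))), by positivity, ?_, ?_, ?_, ?_, ?_⟩ <;>
      simp
  refine ⟨p, hp, K, by positivity, ?_⟩
  intro σ l S hσ hσ1 hl hl1 hlow hup v u z y θ q n
  have hσ2 : σ ^ 2 ≤ 1 := pow_le_one₀ hσ.le hσ1
  have hσ3 : σ ^ 3 ≤ 1 := pow_le_one₀ hσ.le hσ1
  have hσ4 : σ ^ 4 ≤ 1 := pow_le_one₀ hσ.le hσ1
  have key : ∀ (f c : ℝ) (x y : H) (W : ℝ), 0 ≤ f → 4 * |c| ≤ K → f * (‖x‖ * ‖y‖) ≤ 4 * W →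
      f * (c * ⟪x, y⟫) ≤ K * W := by
    intro f c x y W hf hc hW
    have h1 := mul_le_mul_of_nonneg_left
      (coeff_inner_le (c := c) (x := x) (y := y) le_rfl le_rfl) hf
    have h2 := mul_le_mul_of_nonneg_left hW (abs_nonneg c)
    have h3 : 0 ≤ W := by
      have : 0 ≤ f * (‖x‖ * ‖y‖) := by positivity
      linarith
    have h4 := mul_le_mul_of_nonneg_right hc h3
    linarith
  have neg : ∀ (c : ℝ) (x : H), p ≤ c → -c * ‖S x‖ ^ 2 ≤ -p * (σ ^ 2 * ‖x‖ ^ 2) := by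
    intro c x hc
    have h1 : (σ * ‖x‖) ^ 2 ≤ ‖S x‖ ^ 2 := pow_le_pow_left₀ (by positivity) (hlow x) 2
    have h2 : 0 ≤ ‖S x‖ ^ 2 := by positivity
    nlinarith
  have hS : ∀ x y : H, ‖S x‖ * ‖y‖ ≤ 4 * (σ * (‖x‖ * ‖y‖)) := fun x y => by
    have := mul_le_mul_of_nonneg_right (hup x) (norm_nonneg y)
    have h0 : 0 ≤ σ * (‖x‖ * ‖y‖) := by positivity
    linarith
  have hSS : ∀ x y : H, ‖S x‖ * ‖S y‖ ≤ 4 * (σ ^ 2 * (‖x‖ * ‖y‖)) := fun x y =>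
    (mul_le_mul (hup x) (hup y) (norm_nonneg _) (by positivity)).trans (le_of_eq (by ring))
  have red : ∀ e W X : ℝ, 0 ≤ W → e ≤ 1 → X = e * W → X ≤ W := by
    intro e W X hW he hX
    rw [hX]
    exact mul_le_of_le_one_left hW he
  have kSS : ∀ (f c e : ℝ) (x y : H) (W : ℝ), 0 ≤ f → 4 * |c| ≤ K → 0 ≤ W → e ≤ 1 →
      f * (σ ^ 2 * (‖x‖ * ‖y‖)) = e * W → f * (c * ⟪S x, S y⟫) ≤ K * W := by
    intro f c e x y W hf hc hW he hX
    refine key f c _ _ W hf hc ?_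
    have := mul_le_mul_of_nonneg_left (hSS x y) hf
    linarith [red e W _ hW he hX]
  have kS : ∀ (f c e : ℝ) (x y : H) (W : ℝ), 0 ≤ f → 4 * |c| ≤ K → 0 ≤ W → e ≤ 1 →
      f * (σ * (‖x‖ * ‖y‖)) = e * W → f * (c * ⟪S x, y⟫) ≤ K * W := by
    intro f c e x y W hf hc hW he hX
    refine key f c _ _ W hf hc ?_
    have := mul_le_mul_of_nonneg_left (hS x y) hf
    linarith [red e W _ hW he hX]
  have kq : ∀ (f c e : ℝ) (x : H) (W : ℝ), 0 ≤ f → 0 ≤ c → 4 * c ≤ K → 0 ≤ W → e ≤ 1 →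
      f * (σ ^ 2 * ‖x‖ ^ 2) = e * W → f * (c * ‖S x‖ ^ 2) ≤ K * W := by
    intro f c e x W hf hc hcK hW he hX
    have := kSS f c e x x W hf (by rwa [abs_of_nonneg hc]) hW he (by rw [← hX]; ring)
    rwa [real_inner_self_eq_norm_sq] at this
  have ab : ∀ c : ℝ, 0 ≤ c → 4 * c ≤ K → 4 * |c| ≤ K := fun c hc h => by rwa [abs_of_nonneg hc]
  have ab' : ∀ c : ℝ, 0 ≤ c → 4 * c ≤ K → 4 * |-c| ≤ K := fun c hc h => by
    rwa [abs_neg, abs_of_nonneg hc]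
  have hσl : σ * l ≤ 1 := mul_le_one₀ hσ1 hl.le hl1
  have hl2 : l ^ 2 ≤ 1 := pow_le_one₀ hl.le hl1
  have hl0 := hl.le
  have hσ0 := hσ.le
  refine ⟨?_, ?_, ?_, ?_, ?_⟩
  · have a1 := kq 1 τ (σ ^ 2) q (‖q‖ ^ 2) zero_le_one hτ.le (by linarith) (by positivity) hσ2
      (by ring)
    have a2 := kSS 1 (τ * δ) 1 y q (σ ^ 2 * ‖y‖ * ‖q‖) zero_le_one (ab _ n1.le (by linarith))
      (by positivity) le_rfl (by ring)
    have a3 := kS l (-(ρ₃ * β)) l θ q (σ * ‖θ‖ * ‖q‖) hl0 (ab' _ n2.le (by linarith))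
      (by positivity) hl1 (by ring)
    have a4 := neg ρ₃ θ hp1
    linarith
  · have a1 := kSS (σ ^ 2) (-(ρ₃ * a)) σ z θ (σ ^ 2 * ‖z‖ * (σ * ‖θ‖)) (by positivity)
      (ab' _ n3.le (by linarith)) (by positivity) hσ1 (by ring)
    have a2 := kSS (σ ^ 2) (-(ρ₃ * m)) (σ ^ 3) n θ (‖n‖ * (σ * ‖θ‖)) (by positivity)
      (ab' _ n4.le (by linarith)) (by positivity) hσ3 (by ring)
    have a3 := kS (σ ^ 2 * l) (-(ρ₃ * κ)) 1 θ v (σ ^ 2 * l * ‖v‖ * (σ * ‖θ‖)) (by positivity)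
      (ab' _ n5.le (by linarith)) (by positivity) le_rfl (by ring)
    have a4 := kq (σ ^ 2) (ρ₃ * δ) (σ ^ 2) θ ((σ * ‖θ‖) ^ 2) (by positivity) n6.le (by linarith)
      (by positivity) hσ2 (by ring)
    have a5 := kSS (σ ^ 2) (-ρ₂) (σ ^ 2) y q (σ ^ 2 * ‖y‖ * ‖q‖) (by positivity)
      (ab' _ hρ₂.le (by linarith)) (by positivity) hσ2 (by ring)
    have a6 := mul_le_mul_of_nonneg_left (neg (ρ₂ * δ) y hp2) (sq_nonneg σ)
    rw [real_inner_comm] at a3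
    simp only [inner_add_left, inner_sub_left, real_inner_smul_left, real_inner_self_eq_norm_sq]
    linarith
  · have a1 := kq (σ ^ 2) ρ₂ 1 y ((σ ^ 2 * ‖y‖) ^ 2) (by positivity) hρ₂.le (by linarith)
      (by positivity) le_rfl (by ring)
    have a2 := kSS (σ ^ 2) (-m) (σ ^ 2) n z (‖n‖ * (σ ^ 2 * ‖z‖)) (by positivity)
      (ab' _ hm.le (by linarith)) (by positivity) hσ2 (by ring)
    have a3 := kSS (σ ^ 2) δ σ θ z (σ * ‖θ‖ * (σ ^ 2 * ‖z‖)) (by positivity)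
      (ab _ hδ.le (by linarith)) (by positivity) hσ1 (by ring)
    have a4 := kS (σ ^ 2 * l) (ρ₁ / δ) σ q u (σ ^ 2 * l * ‖u‖ * ‖q‖) (by positivity)
      (ab _ n7.le (by linarith)) (by positivity) hσ1 (by ring)
    have a5 := kS (σ ^ 2 * l) (-(ρ₃ * κ / δ)) 1 v θ (σ ^ 2 * l * ‖v‖ * (σ * ‖θ‖)) (by positivity)
      (ab' _ n8.le (by linarith)) (by positivity) le_rfl (by ring)
    have a6 := mul_le_mul_of_nonneg_left (neg a z hp3) (sq_nonneg σ)
    rw [real_inner_comm] at a4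
    linarith
  · have a1 : ρ₂ * (σ ^ 4 * l ^ 2 * ‖y‖ ^ 2) ≤ K * (σ ^ 2 * ‖y‖) ^ 2 := by
      have h1 : ρ₂ * l ^ 2 ≤ K := by nlinarith
      have := mul_le_mul_of_nonneg_right h1 (sq_nonneg (σ ^ 2 * ‖y‖))
      linarith
    have a2 := kS (σ ^ 4 * l) (-m) (σ ^ 3) n v (‖n‖ * (σ ^ 2 * l * ‖v‖)) (by positivity)
      (ab' _ hm.le (by linarith)) (by positivity) hσ3 (by ring)
    have a3 := kS (σ ^ 4 * l) δ (σ ^ 2) θ v (σ * ‖θ‖ * (σ ^ 2 * l * ‖v‖)) (by positivity)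
      (ab _ hδ.le (by linarith)) (by positivity) hσ2 (by ring)
    have a4 := kS (σ ^ 4 * l) (ρ₂ - a * ρ₁ / κ) σ y u (σ ^ 2 * l * ‖u‖ * (σ ^ 2 * ‖y‖))
      (by positivity) (by linarith) (by positivity) hσ1 (by ring)
    have a5 := mul_le_mul_of_nonneg_right hp4 (sq_nonneg (σ ^ 2 * l * ‖v‖))
    linarith
  · have a1 := kq (σ ^ 2 * l ^ 2) κ 1 v ((σ ^ 2 * l * ‖v‖) ^ 2) (by positivity) hκ.le (by linarith)
      (by positivity) le_rfl (by ring)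
    have a2 := kS (σ ^ 2 * l ^ 2 * l) (ρ₁ / δ) (σ * l ^ 2) q u (σ ^ 2 * l * ‖u‖ * ‖q‖)
      (by positivity) (ab _ n7.le (by linarith)) (by positivity)
      (mul_le_one₀ hσ1 (by positivity) hl2) (by ring)
    have a3 := kS (σ ^ 2 * l ^ 2 * l) (-(ρ₃ * κ / δ)) (l ^ 2) v θ (σ ^ 2 * l * ‖v‖ * (σ * ‖θ‖))
      (by positivity) (ab' _ n8.le (by linarith)) (by positivity) hl2 (by ring)
    have a4 := mul_le_mul_of_nonneg_left (neg ρ₁ u hp5) (show 0 ≤ σ ^ 2 * l ^ 2 by positivity)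
    rw [real_inner_comm] at a2
    linarith

end Lyapunov

end TimoshenkoCattaneo

namespace TimoshenkoCattaneo

section Flow

open scoped RealInnerProductSpace

variable {H : Type*} [NormedAddCommGroup H] [InnerProductSpace ℝ H]

/-- The time derivatives of the five auxiliary functionals along the system multiplied by `l`, where
`S = l T` stands for `l ∂ₓ`. The functionals dissipate `θ`, `y`, `z`, `v` and `u`, in this order. -/
lemma functional_derivatives {ρ₁ ρ₂ ρ₃ κ a m δ β τ l : ℝ} (hκ : κ ≠ 0) (hδ : δ ≠ 0)
    {S : H →L[ℝ] H} (hS : ∀ x y, ⟪S x, y⟫ = -⟪x, S y⟫) {v u z y θ q n v' u' z' y' θ' q' : H}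
    (hv : l • v' = S u - l • y) (hu : (ρ₁ * l) • u' = κ • S v) (hz : l • z' = S y)
    (hy : (ρ₂ * l) • y' = a • S z + m • S n + (κ * l) • v - δ • S θ)
    (hθ : (ρ₃ * l) • θ' = -S q - δ • S y) (hq : (τ * l) • q' = -((β * l) • q) - S θ) :
    (l * (τ * ρ₃ * (⟪S θ', q⟫ + ⟪S θ, q'⟫)) =
      τ * ‖S q‖ ^ 2 + τ * δ * ⟪S y, S q⟫ - ρ₃ * β * l * ⟪S θ, q⟫ - ρ₃ * ‖S θ‖ ^ 2) ∧
    (l * (ρ₂ * ρ₃ * (⟪S y', θ⟫ + ⟪S y, θ'⟫)) =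
      -ρ₃ * ⟪a • S z + m • S n + (κ * l) • v - δ • S θ, S θ⟫ - ρ₂ * ⟪S y, S q⟫
          - ρ₂ * δ * ‖S y‖ ^ 2) ∧
    (l * (ρ₂ * (⟪S y', z⟫ + ⟪S y, z'⟫) - l * (ρ₁ * (⟪u', z⟫ + ⟪u, z'⟫))
        - l * (ρ₁ * ρ₃ / δ * (⟪u', θ⟫ + ⟪u, θ'⟫))) =
      -a * ‖S z‖ ^ 2 + ρ₂ * ‖S y‖ ^ 2 - m * ⟪S n, S z⟫ + δ * ⟪S θ, S z⟫
          + ρ₁ / δ * l * ⟪u, S q⟫ - ρ₃ * κ / δ * l * ⟪S v, θ⟫) ∧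
    (l ^ 2 * (-(ρ₂ * (⟪y', v⟫ + ⟪y, v'⟫)) - a * ρ₁ / κ * (⟪z', u⟫ + ⟪z, u'⟫)) =
      -κ * l ^ 2 * ‖v‖ ^ 2 - m * l * ⟪S n, v⟫ + δ * l * ⟪S θ, v⟫
          + ρ₂ * l ^ 2 * ‖y‖ ^ 2 + (ρ₂ - a * ρ₁ / κ) * l * ⟪S y, u⟫) ∧
    (l * (-(ρ₁ * (⟪S u', v⟫ + ⟪S u, v'⟫)) - l * (ρ₁ * ρ₃ / δ * (⟪u', θ⟫ + ⟪u, θ'⟫))) =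
      -ρ₁ * ‖S u‖ ^ 2 + κ * ‖S v‖ ^ 2 + ρ₁ / δ * l * ⟪u, S q⟫
          - ρ₃ * κ / δ * l * ⟪S v, θ⟫) := by
  have iv : ∀ w, l * ⟪w, v'⟫ = ⟪w, S u⟫ - l * ⟪w, y⟫ := fun w => by
    rw [← real_inner_smul_right, hv, inner_sub_right, real_inner_smul_right]
  have iu : ∀ w, ρ₁ * l * ⟪u', w⟫ = κ * ⟪S v, w⟫ := fun w => by
    rw [← real_inner_smul_left, hu, real_inner_smul_left]
  have iz : ∀ w, l * ⟪w, z'⟫ = ⟪w, S y⟫ := fun w => by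
    rw [← real_inner_smul_right, hz]
  have iy : ∀ w, ρ₂ * l * ⟪y', w⟫ = a * ⟪S z, w⟫ + m * ⟪S n, w⟫ + κ * l * ⟪v, w⟫
      - δ * ⟪S θ, w⟫ := fun w => by
    rw [← real_inner_smul_left, hy]
    simp only [inner_add_left, inner_sub_left, real_inner_smul_left]
  have iθ : ∀ w, ρ₃ * l * ⟪w, θ'⟫ = -⟪w, S q⟫ - δ * ⟪w, S y⟫ := fun w => by
    rw [← real_inner_smul_right, hθ, inner_sub_right, inner_neg_right, real_inner_smul_right]
  have iq : ∀ w, τ * l * ⟪w, q'⟫ = -(β * l * ⟪w, q⟫) - ⟪w, S θ⟫ := fun w => by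
    rw [← real_inner_smul_right, hq, inner_sub_right, inner_neg_right, real_inner_smul_right]
  have cθ := fun w => real_inner_comm θ' w
  have cu := fun w => real_inner_comm u' w
  simp only [← real_inner_self_eq_norm_sq]
  refine ⟨?_, ?_, ?_, ?_, ?_⟩
  · rw [hS θ' q, real_inner_comm]
    linear_combination ρ₃ * iq (S θ) - τ * iθ (S q) + τ * δ * real_inner_comm (S y) (S q)
  · rw [hS y' θ]
    simp only [inner_add_left, inner_sub_left, real_inner_smul_left]
    linear_combination -ρ₃ * iy (S θ) + ρ₂ * iθ (S y)
  · rw [hS y' z]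
    have e1 := hS v z
    field_simp
    linear_combination -δ * iy (S z) + δ * ρ₂ * iz (S y) - δ * l * iu z - δ * l * ρ₁ * iz u
      - l * ρ₃ * iu θ - l * ρ₁ * iθ u - δ * l * κ * e1
  · have e1 := hS z v
    have e2 := hS y u
    have e3 := real_inner_comm u z'
    have e4 := real_inner_comm u' z
    have e5 := real_inner_comm u (S y)
    have e6 := real_inner_comm z (S v)
    have e7 := iu z
    have e8 := iz u
    field_simp
    linear_combination -l * κ * iy v - l * κ * ρ₂ * iv y
      - l * a * ρ₁ * e8 - l * a * e7 - κ * l * a * e1 - κ * l * ρ₂ * e2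
      - l ^ 2 * a * ρ₁ * e3 - l ^ 2 * a * ρ₁ * e4 + l * a * ρ₁ * e5 - κ * l * a * e6
  · rw [hS u' v]
    have e1 := hS u y
    field_simp
    linear_combination δ * iu (S v) - δ * ρ₁ * iv (S u)
      - l * ρ₃ * iu θ - l * ρ₁ * iθ u + δ * l * ρ₁ * e1

/-- The equations of motion in a frequency shell: `T` stands for `∂ₓ`, which is bounded there, `n`
for `∫ g(s) ∂ₓη(s) ds` and `h` for `∫ g(s) ‖∂ₓη(s)‖² ds`. Of the equation for the history only the
differential inequality for `h` and a bound of `n` in terms of `h` are kept. -/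
structure IsShellFlow (P : Params) (a k₂ b₀ : ℝ) (T : H →L[ℝ] H) (v u z y θ q n : ℝ → H)
    (h : ℝ → ℝ) : Prop where
  cont_v : ContinuousOn v (Ici 0)
  cont_u : ContinuousOn u (Ici 0)
  cont_z : ContinuousOn z (Ici 0)
  cont_y : ContinuousOn y (Ici 0)
  cont_θ : ContinuousOn θ (Ici 0)
  cont_q : ContinuousOn q (Ici 0)
  cont_h : ContinuousOn h (Ici 0)
  deriv_v : ∀ t, 0 < t → HasDerivAt v (T (u t) - y t) t
  deriv_u : ∀ t, 0 < t → HasDerivAt u (P.ρ₁⁻¹ • P.κ • T (v t)) t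
  deriv_z : ∀ t, 0 < t → HasDerivAt z (T (y t)) t
  deriv_y : ∀ t, 0 < t → HasDerivAt y
    (P.ρ₂⁻¹ • (a • T (z t) + P.m • T (n t) + P.κ • v t - P.δ • T (θ t))) t
  deriv_θ : ∀ t, 0 < t → HasDerivAt θ (P.ρ₃⁻¹ • (-T (q t) - P.δ • T (y t))) t
  deriv_q : ∀ t, 0 < t → HasDerivAt q (P.τ⁻¹ • (-(P.β • q t) - T (θ t))) t
  h_nonneg : ∀ t, 0 ≤ t → 0 ≤ h t
  norm_n_sq_le : ∀ t, 0 ≤ t → ‖n t‖ ^ 2 ≤ b₀ * h t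
  deriv_h : ∀ t, 0 < t → ∃ h', HasDerivAt h h' t ∧ h' ≤ -k₂ * h t + 2 * ⟪n t, T (y t)⟫

/-- A form of Grönwall's inequality for a function that is differentiable at positive times only. -/
lemma le_mul_exp_of_deriv_le {L L' : ℝ → ℝ} {c : ℝ} (hL : ContinuousOn L (Ici 0))
    (hd : ∀ t, 0 < t → HasDerivAt L (L' t) t) (hle : ∀ t, 0 < t → L' t ≤ -c * L t) {t : ℝ}
    (ht : 0 ≤ t) : L t ≤ L 0 * Real.exp (-c * t) := by
  have h1 : AntitoneOn (fun t => L t * Real.exp (c * t)) (Ici 0) := by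
    refine antitoneOn_of_hasDerivWithinAt_nonpos
      (f' := fun t => L' t * Real.exp (c * t) + L t * (Real.exp (c * t) * c)) (convex_Ici 0)
      (hL.mul (by fun_prop)) (fun t ht => ?_) (fun t ht => ?_)
    · rw [interior_Ici] at ht
      have : HasDerivAt (fun t : ℝ => Real.exp (c * t)) (Real.exp (c * t) * c) t := by
        simpa using ((hasDerivAt_id t).const_mul c).exp
      exact ((hd t ht).mul this).hasDerivWithinAt
    · rw [interior_Ici] at ht
      have := mul_le_mul_of_nonneg_right (hle t ht) (Real.exp_pos (c * t)).le
      linarith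
  have h2 := h1 (mem_Ici.2 le_rfl) (mem_Ici.2 ht) ht
  simp only [mul_zero, Real.exp_zero, mul_one] at h2
  have h3 := mul_le_mul_of_nonneg_right h2 (Real.exp_pos (-c * t)).le
  rwa [mul_assoc, ← Real.exp_add, show c * t + -c * t = 0 by ring, Real.exp_zero, mul_one] at h3

end Flow

end TimoshenkoCattaneo

namespace TimoshenkoCattaneo

section Decay

open scoped RealInnerProductSpace

variable {H : Type*} [NormedAddCommGroup H] [InnerProductSpace ℝ H]

/-- The balance of the physical energy: only `q` and the history dissipate. -/
lemma energy_derivative {κ a m δ β : ℝ} {T : H →L[ℝ] H} (hT : ∀ x y, ⟪T x, y⟫ = -⟪x, T y⟫)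
    (v u z y θ q n : H) :
    κ * ⟪v, T u - y⟫ + ⟪u, κ • T v⟫ + a * ⟪z, T y⟫
      + ⟪y, a • T z + m • T n + κ • v - δ • T θ⟫ + ⟪θ, -T q - δ • T y⟫ + ⟪q, -(β • q) - T θ⟫
      + m * ⟪n, T y⟫ = -β * ‖q‖ ^ 2 := by
  simp only [inner_add_right, inner_sub_right, inner_neg_right, real_inner_smul_right,
    ← real_inner_self_eq_norm_sq]
  have e1 := hT v u
  have e2 := hT z y
  have e3 := hT n y
  have e4 := hT θ y
  have e5 := hT θ q
  have e6 := real_inner_comm u (T v)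
  have e7 := real_inner_comm y (T z)
  have e8 := real_inner_comm y (T n)
  have e9 := real_inner_comm y (T θ)
  have e10 := real_inner_comm q (T θ)
  have e11 := real_inner_comm v y
  linear_combination κ * e1 + a * e2 + m * e3 - δ * e4 - e5 - κ * e6 - a * e7 - m * e8 + δ * e9
    + e10 + κ * e11

/-- The functional which is added to a large multiple of the energy in order to control the
components that are not dissipated directly. The `nᵢ` are the multipliers of the first four
functionals; the fifth has multiplier `1`. -/
noncomputable def crossFunctional (P : Params) (a n₁ n₂ n₃ n₄ σ l : ℝ) (S : H →L[ℝ] H)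
    (v u z y θ q : H) : ℝ :=
  n₁ * (l * (P.τ * P.ρ₃ * ⟪S θ, q⟫)) + (n₂ * (σ ^ 2 * (l * (P.ρ₂ * P.ρ₃ * ⟪S y, θ⟫)))
    + (n₃ * (σ ^ 2 * (l * (P.ρ₂ * ⟪S y, z⟫ - l * (P.ρ₁ * ⟪u, z⟫)
        - l * (P.ρ₁ * P.ρ₃ / P.δ * ⟪u, θ⟫))))
    + (n₄ * (σ ^ 4 * (l ^ 2 * (-(P.ρ₂ * ⟪y, v⟫) - a * P.ρ₁ / P.κ * ⟪z, u⟫)))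
    + σ ^ 2 * l ^ 2 * (l * (-(P.ρ₁ * ⟪S u, v⟫) - l * (P.ρ₁ * P.ρ₃ / P.δ * ⟪u, θ⟫))))))

/-- The cross terms are dominated by the energy, uniformly in the frequency. -/
lemma exists_abs_crossFunctional_le (P : Params) (a n₁ n₂ n₃ n₄ : ℝ) :
    ∃ M ≥ 0, ∀ (σ l : ℝ) (S : H →L[ℝ] H), 0 < σ → σ ≤ 1 → 0 < l → l ≤ 1 →
      (∀ x, ‖S x‖ ≤ 2 * ‖x‖) → ∀ v u z y θ q : H,
      |crossFunctional P a n₁ n₂ n₃ n₄ σ l S v u z y θ q| ≤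
        M * (‖v‖ ^ 2 + ‖u‖ ^ 2 + ‖z‖ ^ 2 + ‖y‖ ^ 2 + ‖θ‖ ^ 2 + ‖q‖ ^ 2) := by
  refine ⟨|n₁ * (P.τ * P.ρ₃)| + |n₂ * (P.ρ₂ * P.ρ₃)| + |n₃ * P.ρ₂| + |n₃ * P.ρ₁|
    + |n₃ * (P.ρ₁ * P.ρ₃ / P.δ)| + |n₄ * P.ρ₂| + |n₄ * (a * P.ρ₁ / P.κ)| + |P.ρ₁|
    + |P.ρ₁ * P.ρ₃ / P.δ|, by positivity, ?_⟩
  intro σ l S hσ hσ1 hl hl1 hS v u z y θ q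
  set E := ‖v‖ ^ 2 + ‖u‖ ^ 2 + ‖z‖ ^ 2 + ‖y‖ ^ 2 + ‖θ‖ ^ 2 + ‖q‖ ^ 2 with hE
  have hE0 : 0 ≤ E := by positivity
  have b : ∀ x w : H, |⟪x, w⟫| ≤ ‖x‖ ^ 2 + ‖w‖ ^ 2 := fun x w => by
    have := abs_real_inner_le_norm x w
    nlinarith [sq_nonneg (‖x‖ - ‖w‖), sq_nonneg ‖x‖, sq_nonneg ‖w‖]
  have bS : ∀ x w : H, |⟪S x, w⟫| ≤ ‖x‖ ^ 2 + ‖w‖ ^ 2 := fun x w => by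
    have h1 := abs_real_inner_le_norm (S x) w
    have h2 := mul_le_mul_of_nonneg_right (hS x) (norm_nonneg w)
    nlinarith [sq_nonneg (‖x‖ - ‖w‖)]
  have t : ∀ f c i : ℝ, 0 ≤ f → f ≤ 1 → |i| ≤ E → |c * (f * i)| ≤ |c| * E := by
    intro f c i hf hf1 hi
    rw [abs_mul, abs_mul, abs_of_nonneg hf]
    exact mul_le_mul_of_nonneg_left ((mul_le_of_le_one_left (abs_nonneg i) hf1).trans hi)
      (abs_nonneg c)
  have sv := sq_nonneg ‖v‖
  have su := sq_nonneg ‖u‖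
  have sz := sq_nonneg ‖z‖
  have sy := sq_nonneg ‖y‖
  have sθ := sq_nonneg ‖θ‖
  have sq := sq_nonneg ‖q‖
  have p : ∀ i j : ℕ, 0 ≤ σ ^ i * l ^ j ∧ σ ^ i * l ^ j ≤ 1 := fun i j =>
    ⟨by positivity, mul_le_one₀ (pow_le_one₀ hσ.le hσ1) (by positivity) (pow_le_one₀ hl.le hl1)⟩
  have a1 := abs_le.1 (t (σ ^ 0 * l ^ 1) (n₁ * (P.τ * P.ρ₃)) _ (p _ _).1 (p _ _).2
    ((bS θ q).trans (by linarith)))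
  have a2 := abs_le.1 (t (σ ^ 2 * l ^ 1) (n₂ * (P.ρ₂ * P.ρ₃)) _ (p _ _).1 (p _ _).2
    ((bS y θ).trans (by linarith)))
  have a3 := abs_le.1 (t (σ ^ 2 * l ^ 1) (n₃ * P.ρ₂) _ (p _ _).1 (p _ _).2
    ((bS y z).trans (by linarith)))
  have a4 := abs_le.1 (t (σ ^ 2 * l ^ 2) (n₃ * P.ρ₁) _ (p _ _).1 (p _ _).2
    ((b u z).trans (by linarith)))
  have a5 := abs_le.1 (t (σ ^ 2 * l ^ 2) (n₃ * (P.ρ₁ * P.ρ₃ / P.δ)) _ (p _ _).1 (p _ _).2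
    ((b u θ).trans (by linarith)))
  have a6 := abs_le.1 (t (σ ^ 4 * l ^ 2) (n₄ * P.ρ₂) _ (p _ _).1 (p _ _).2
    ((b y v).trans (by linarith)))
  have a7 := abs_le.1 (t (σ ^ 4 * l ^ 2) (n₄ * (a * P.ρ₁ / P.κ)) _ (p _ _).1 (p _ _).2
    ((b z u).trans (by linarith)))
  have a8 := abs_le.1 (t (σ ^ 2 * l ^ 3) P.ρ₁ _ (p _ _).1 (p _ _).2
    ((bS u v).trans (by linarith)))
  have a9 := abs_le.1 (t (σ ^ 2 * l ^ 4) (P.ρ₁ * P.ρ₃ / P.δ) _ (p _ _).1 (p _ _).2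
    ((b u θ).trans (by linarith)))
  rw [crossFunctional, abs_le]
  constructor <;> linarith

lemma hasDerivAt_crossFunctional (P : Params) (a n₁ n₂ n₃ n₄ σ l : ℝ) (S : H →L[ℝ] H)
    {v u z y θ q : ℝ → H} {v' u' z' y' θ' q' : H} {t : ℝ} (dv : HasDerivAt v v' t)
    (du : HasDerivAt u u' t) (dz : HasDerivAt z z' t) (dy : HasDerivAt y y' t)
    (dθ : HasDerivAt θ θ' t) (dq : HasDerivAt q q' t) :
    HasDerivAt (fun t => crossFunctional P a n₁ n₂ n₃ n₄ σ l S (v t) (u t) (z t) (y t) (θ t) (q t))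
      (n₁ * (l * (P.τ * P.ρ₃ * (⟪S θ', q t⟫ + ⟪S (θ t), q'⟫)))
      + (n₂ * (σ ^ 2 * (l * (P.ρ₂ * P.ρ₃ * (⟪S y', θ t⟫ + ⟪S (y t), θ'⟫))))
      + (n₃ * (σ ^ 2 * (l * (P.ρ₂ * (⟪S y', z t⟫ + ⟪S (y t), z'⟫)
          - l * (P.ρ₁ * (⟪u', z t⟫ + ⟪u t, z'⟫))
          - l * (P.ρ₁ * P.ρ₃ / P.δ * (⟪u', θ t⟫ + ⟪u t, θ'⟫)))))
      + (n₄ * (σ ^ 4 * (l ^ 2 * (-(P.ρ₂ * (⟪y', v t⟫ + ⟪y t, v'⟫))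
          - a * P.ρ₁ / P.κ * (⟪z', u t⟫ + ⟪z t, u'⟫))))
      + σ ^ 2 * l ^ 2 * (l * (-(P.ρ₁ * (⟪S u', v t⟫ + ⟪S (u t), v'⟫))
          - l * (P.ρ₁ * P.ρ₃ / P.δ * (⟪u', θ t⟫ + ⟪u t, θ'⟫)))))))) t := by
  have dS : ∀ {f : ℝ → H} {f' : H}, HasDerivAt f f' t → HasDerivAt (fun t => S (f t)) (S f') t :=
    fun hf => S.hasFDerivAt.comp_hasDerivAt t hf
  have di : ∀ {f w : ℝ → H} {f' w' : H}, HasDerivAt f f' t → HasDerivAt w w' t →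
      HasDerivAt (fun t => ⟪f t, w t⟫) (⟪f', w t⟫ + ⟪f t, w'⟫) t := fun hf hw => by
    rw [add_comm]; exact hf.inner ℝ hw
  have i5 := ((di du dθ).const_mul (P.ρ₁ * P.ρ₃ / P.δ)).const_mul l
  have j1 := (((di (dS dθ) dq).const_mul (P.τ * P.ρ₃)).const_mul l).const_mul n₁
  have j2 := ((((di (dS dy) dθ).const_mul (P.ρ₂ * P.ρ₃)).const_mul l).const_mul
    (σ ^ 2)).const_mul n₂
  have j3 := (((((((di (dS dy) dz).const_mul P.ρ₂).fun_sub
    (((di du dz).const_mul P.ρ₁).const_mul l)).fun_sub i5).const_mul l).const_mul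
    (σ ^ 2)).const_mul n₃)
  have j4 := ((((((di dy dv).const_mul P.ρ₂).fun_neg.fun_sub
    ((di dz du).const_mul (a * P.ρ₁ / P.κ))).const_mul (l ^ 2)).const_mul (σ ^ 4)).const_mul n₄)
  have j5 := (((((di (dS du) dv).const_mul P.ρ₁).fun_neg.fun_sub i5).const_mul l).const_mul
    (σ ^ 2 * l ^ 2))
  exact j1.fun_add (j2.fun_add (j3.fun_add (j4.fun_add j5)))

set_option maxHeartbeats 1000000 in
/-- The pointwise energy in a frequency shell decays at the rate `r⁴ / (1 + r²)³`. -/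
theorem exists_shell_decay (P : Params) {a k₂ b₀ : ℝ} (ha : 0 < a) (hk₂ : 0 < k₂) (hb₀ : 0 ≤ b₀) :
    ∃ C > 0, ∃ c > 0, ∀ (r : ℝ) (T : H →L[ℝ] H), 0 < r → (∀ x y, ⟪T x, y⟫ = -⟪x, T y⟫) →
      (∀ x, r * ‖x‖ ≤ ‖T x‖) → (∀ x, ‖T x‖ ≤ 2 * r * ‖x‖) →
      ∀ (v u z y θ q n : ℝ → H) (h : ℝ → ℝ), IsShellFlow P a k₂ b₀ T v u z y θ q n h →
      ∀ t, 0 ≤ t →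
        ‖v t‖ ^ 2 + ‖u t‖ ^ 2 + ‖z t‖ ^ 2 + ‖y t‖ ^ 2 + ‖θ t‖ ^ 2 + ‖q t‖ ^ 2 + h t ≤
          C * Real.exp (-(c * (r ^ 4 / (1 + r ^ 2) ^ 3) * t)) *
          (‖v 0‖ ^ 2 + ‖u 0‖ ^ 2 + ‖z 0‖ ^ 2 + ‖y 0‖ ^ 2 + ‖θ 0‖ ^ 2 + ‖q 0‖ ^ 2 + h 0) := by
  obtain ⟨p, hp, K, hK, hdiss⟩ := dissipation_estimates (H := H) P.ρ₁_pos P.ρ₂_pos P.ρ₃_pos P.κ_pos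
    ha P.m_pos P.δ_pos P.β_pos P.τ_pos
  obtain ⟨n₁, hn₁, n₂, hn₂, n₃, hn₃, n₄, hn₄, c₀, hc₀, M, hM, hmult⟩ := exists_multipliers hp hK
  obtain ⟨M', hM', hcross⟩ := exists_abs_crossFunctional_le (H := H) P a n₁ n₂ n₃ n₄
  have := P.ρ₁_pos
  have := P.ρ₂_pos
  have := P.ρ₃_pos
  have := P.κ_pos
  have := P.m_pos
  have := P.β_pos
  have := P.τ_pos
  -- the energy is comparable to the sum of the squares
  obtain ⟨e, he, e1, e2, e3, e4, e5, e6, e7⟩ : ∃ e > 0, e ≤ P.κ ∧ e ≤ P.ρ₁ ∧ e ≤ a ∧ e ≤ P.ρ₂ ∧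
      e ≤ P.ρ₃ ∧ e ≤ P.τ ∧ e ≤ P.m := by
    refine ⟨min P.κ (min P.ρ₁ (min a (min P.ρ₂ (min P.ρ₃ (min P.τ P.m))))), by positivity,
      ?_, ?_, ?_, ?_, ?_, ?_, ?_⟩ <;> simp
  set e' := P.κ + P.ρ₁ + a + P.ρ₂ + P.ρ₃ + P.τ + P.m with he'
  -- `N` absorbs the errors in `q` and `n`, and dominates the cross terms
  obtain ⟨N, hN, N1, N2, N3⟩ : ∃ N > 0, M' + 1 ≤ N * e ∧ M + c₀ ≤ N * (2 * P.β) ∧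
      M * b₀ + c₀ ≤ N * (P.m * k₂) := by
    refine ⟨(M' + 1) / e + (M + c₀) / (2 * P.β) + (M * b₀ + c₀) / (P.m * k₂), by positivity,
      ?_, ?_, ?_⟩
    · have h1 : (M' + 1) / e * e = M' + 1 := by field_simp
      have h2 : 0 ≤ (M + c₀) / (2 * P.β) * e := by positivity
      have h3 : 0 ≤ (M * b₀ + c₀) / (P.m * k₂) * e := by positivity
      linarith
    · have h1 : (M + c₀) / (2 * P.β) * (2 * P.β) = M + c₀ := by field_simp
      have h2 : 0 ≤ (M' + 1) / e * (2 * P.β) := by positivity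
      have h3 : 0 ≤ (M * b₀ + c₀) / (P.m * k₂) * (2 * P.β) := by positivity
      linarith
    · have h1 : (M * b₀ + c₀) / (P.m * k₂) * (P.m * k₂) = M * b₀ + c₀ := by field_simp
      have h2 : 0 ≤ (M' + 1) / e * (P.m * k₂) := by positivity
      have h3 : 0 ≤ (M + c₀) / (2 * P.β) * (P.m * k₂) := by positivity
      linarith
  have hc2 : 0 < N * e' + M' := by positivity
  refine ⟨N * e' + M', hc2, c₀ / (N * e' + M'), by positivity, ?_⟩
  intro r T hr hT hlow hup v u z y θ q n h hf t ht
  -- with `l = (1 + r²)^{-1/2}` the operator `S = l T` has size `σ = l r ≤ 1`, and the decay rate is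
  -- `σ⁴ l²`, the smallest of the weights of the dissipated squares
  obtain ⟨l, hl, hl1, hlr⟩ : ∃ l > 0, l ≤ 1 ∧ l ^ 2 * (1 + r ^ 2) = 1 := by
    have h1 : 0 < 1 + r ^ 2 := by positivity
    have h2 : 1 ≤ √(1 + r ^ 2) := Real.one_le_sqrt.2 (by nlinarith)
    refine ⟨(√(1 + r ^ 2))⁻¹, by positivity, inv_le_one_of_one_le₀ h2, ?_⟩
    rw [inv_pow, Real.sq_sqrt h1.le, inv_mul_cancel₀ h1.ne']
  set σ := l * r with hσ
  have hσ0 : 0 < σ := by positivity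
  have hσ1 : σ ≤ 1 := by
    have : σ ^ 2 ≤ 1 := by nlinarith
    nlinarith
  set ϱ := r ^ 4 / (1 + r ^ 2) ^ 3 with hϱ
  have hϱσ : ϱ = σ ^ 4 * l ^ 2 := by
    rw [hϱ, div_eq_iff (by positivity)]
    have : (l ^ 2 * (1 + r ^ 2)) ^ 3 = 1 := by rw [hlr, one_pow]
    rw [hσ]
    linear_combination -r ^ 4 * this
  have hσl1 : l ^ 2 ≤ 1 := pow_le_one₀ hl.le hl1
  have hσσ : σ ^ 4 ≤ σ ^ 2 := pow_le_pow_of_le_one hσ0.le hσ1 (by norm_num)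
  have hσs : σ ^ 2 ≤ 1 := pow_le_one₀ hσ0.le hσ1
  have hϱ4 : ϱ ≤ σ ^ 4 := by rw [hϱσ]; exact mul_le_of_le_one_right (by positivity) hσl1
  have hϱ0 : 0 ≤ ϱ := by positivity
  set S : H →L[ℝ] H := l • T with hSdef
  have Sapp : ∀ x, S x = l • T x := fun x => rfl
  have hSs : ∀ x y, ⟪S x, y⟫ = -⟪x, S y⟫ := fun x y => by
    rw [Sapp, Sapp, real_inner_smul_left, real_inner_smul_right, hT]; ring
  have hSn : ∀ x, ‖S x‖ = l * ‖T x‖ := fun x => by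
    rw [Sapp, norm_smul, Real.norm_of_nonneg hl.le]
  have hSlow : ∀ x, σ * ‖x‖ ≤ ‖S x‖ := fun x => by
    rw [hSn, hσ, mul_assoc]; exact mul_le_mul_of_nonneg_left (hlow x) hl.le
  have hSup : ∀ x, ‖S x‖ ≤ 2 * σ * ‖x‖ := fun x => by
    rw [hSn, hσ]; have := mul_le_mul_of_nonneg_left (hup x) hl.le; linarith
  have hSup' : ∀ x, ‖S x‖ ≤ 2 * ‖x‖ := fun x => by
    have := hSup x
    have := mul_le_mul_of_nonneg_right hσ1 (norm_nonneg x)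
    linarith
  -- the Lyapunov functional
  set E : ℝ → ℝ := fun t => P.κ * ‖v t‖ ^ 2 + P.ρ₁ * ‖u t‖ ^ 2 + a * ‖z t‖ ^ 2 + P.ρ₂ * ‖y t‖ ^ 2
    + P.ρ₃ * ‖θ t‖ ^ 2 + P.τ * ‖q t‖ ^ 2 + P.m * h t with hE
  set F : ℝ → ℝ := fun t => crossFunctional P a n₁ n₂ n₃ n₄ σ l S (v t) (u t) (z t) (y t) (θ t)
    (q t) with hF
  set W : ℝ → ℝ := fun t => ‖v t‖ ^ 2 + ‖u t‖ ^ 2 + ‖z t‖ ^ 2 + ‖y t‖ ^ 2 + ‖θ t‖ ^ 2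
    + ‖q t‖ ^ 2 + h t with hW
  have sv := fun t => sq_nonneg ‖v t‖
  have su := fun t => sq_nonneg ‖u t‖
  have sz := fun t => sq_nonneg ‖z t‖
  have sy := fun t => sq_nonneg ‖y t‖
  have sθ := fun t => sq_nonneg ‖θ t‖
  have sq := fun t => sq_nonneg ‖q t‖
  have hFW : ∀ t, 0 ≤ t → |F t| ≤ M' * W t := fun t ht => by
    refine (hcross σ l S hσ0 hσ1 hl hl1 hSup' (v t) (u t) (z t) (y t) (θ t) (q t)).trans ?_
    exact mul_le_mul_of_nonneg_left (by simp only [hW]; linarith [hf.h_nonneg t ht]) hM'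
  have hEup : ∀ t, 0 ≤ t → E t ≤ e' * W t := fun t ht => by
    have hx : ∀ {b x : ℝ}, 0 ≤ x → b ≤ e' → b * x ≤ e' * x := fun hx hb =>
      mul_le_mul_of_nonneg_right hb hx
    simp only [hE, hW]
    linarith [hx (b := P.κ) (sv t) (by linarith), hx (b := P.ρ₁) (su t) (by linarith),
      hx (b := a) (sz t) (by linarith), hx (b := P.ρ₂) (sy t) (by linarith),
      hx (b := P.ρ₃) (sθ t) (by linarith), hx (b := P.τ) (sq t) (by linarith),
      hx (b := P.m) (hf.h_nonneg t ht) (by linarith)]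
  have hElow : ∀ t, 0 ≤ t → e * W t ≤ E t := fun t ht => by
    have hx : ∀ {b x : ℝ}, 0 ≤ x → e ≤ b → e * x ≤ b * x := fun hx hb =>
      mul_le_mul_of_nonneg_right hb hx
    simp only [hE, hW]
    linarith [hx (sv t) e1, hx (su t) e2, hx (sz t) e3, hx (sy t) e4, hx (sθ t) e5, hx (sq t) e6,
      hx (hf.h_nonneg t ht) e7]
  have hW0 : ∀ t, 0 ≤ t → 0 ≤ W t := fun t ht => by
    simp only [hW]
    linarith [sv t, su t, sz t, sy t, sθ t, sq t, hf.h_nonneg t ht]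
  have hLlow : ∀ t, 0 ≤ t → W t ≤ N * E t + F t := fun t ht => by
    have h1 := mul_le_mul_of_nonneg_left (hElow t ht) hN.le
    have h2 := mul_le_mul_of_nonneg_right N1 (hW0 t ht)
    have h3 := (abs_le.1 (hFW t ht)).1
    linarith
  have hLup : ∀ t, 0 ≤ t → N * E t + F t ≤ (N * e' + M') * W t := fun t ht => by
    have h1 := mul_le_mul_of_nonneg_left (hEup t ht) hN.le
    have h3 := (abs_le.1 (hFW t ht)).2
    linarith
  have hcont : ContinuousOn (fun t => N * E t + F t) (Ici 0) := by
    have := hf.cont_v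
    have := hf.cont_u
    have := hf.cont_z
    have := hf.cont_y
    have := hf.cont_θ
    have := hf.cont_q
    have := hf.cont_h
    simp only [hE, hF, crossFunctional]
    fun_prop
  have hder : ∀ t, 0 < t → ∃ L', HasDerivAt (fun t => N * E t + F t) L' t ∧
      L' ≤ -(c₀ * ϱ) * W t := by
    intro t ht
    obtain ⟨h', hh', hh'le⟩ := hf.deriv_h t ht
    have dv := hf.deriv_v t ht
    have du := hf.deriv_u t ht
    have dz := hf.deriv_z t ht
    have dy := hf.deriv_y t ht
    have dθ := hf.deriv_θ t ht
    have dq := hf.deriv_q t ht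
    set v' := T (u t) - y t with hv'
    set u' := P.ρ₁⁻¹ • P.κ • T (v t) with hu'
    set z' := T (y t) with hz'
    set y' := P.ρ₂⁻¹ • (a • T (z t) + P.m • T (n t) + P.κ • v t - P.δ • T (θ t)) with hy'
    set θ' := P.ρ₃⁻¹ • (-T (q t) - P.δ • T (y t)) with hθ'
    set q' := P.τ⁻¹ • (-(P.β • q t) - T (θ t)) with hq'
    have dE : HasDerivAt E (P.κ * (2 * ⟪v t, v'⟫) + P.ρ₁ * (2 * ⟪u t, u'⟫) + a * (2 * ⟪z t, z'⟫)
        + P.ρ₂ * (2 * ⟪y t, y'⟫) + P.ρ₃ * (2 * ⟪θ t, θ'⟫) + P.τ * (2 * ⟪q t, q'⟫) + P.m * h') t :=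
      ((((((dv.norm_sq.const_mul _).fun_add (du.norm_sq.const_mul _)).fun_add
        (dz.norm_sq.const_mul _)).fun_add (dy.norm_sq.const_mul _)).fun_add
        (dθ.norm_sq.const_mul _)).fun_add (dq.norm_sq.const_mul _)).fun_add (hh'.const_mul _)
    have dF := hasDerivAt_crossFunctional P a n₁ n₂ n₃ n₄ σ l S dv du dz dy dθ dq
    refine ⟨_, (dE.const_mul N).fun_add dF, ?_⟩
    have hen := energy_derivative (κ := P.κ) (a := a) (m := P.m) (δ := P.δ) (β := P.β) hT (v t)
      (u t) (z t) (y t) (θ t) (q t) (n t)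
    have r1 : P.ρ₁ * ⟪u t, u'⟫ = ⟪u t, P.κ • T (v t)⟫ := by
      rw [← real_inner_smul_right, hu', smul_inv_smul₀ P.ρ₁_pos.ne']
    have r2 : P.ρ₂ * ⟪y t, y'⟫
        = ⟪y t, a • T (z t) + P.m • T (n t) + P.κ • v t - P.δ • T (θ t)⟫ := by
      rw [← real_inner_smul_right, hy', smul_inv_smul₀ P.ρ₂_pos.ne']
    have r3 : P.ρ₃ * ⟪θ t, θ'⟫ = ⟪θ t, -T (q t) - P.δ • T (y t)⟫ := by
      rw [← real_inner_smul_right, hθ', smul_inv_smul₀ P.ρ₃_pos.ne']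
    have r4 : P.τ * ⟪q t, q'⟫ = ⟪q t, -(P.β • q t) - T (θ t)⟫ := by
      rw [← real_inner_smul_right, hq', smul_inv_smul₀ P.τ_pos.ne']
    have hEle : N * (P.κ * (2 * ⟪v t, v'⟫) + P.ρ₁ * (2 * ⟪u t, u'⟫) + a * (2 * ⟪z t, z'⟫)
        + P.ρ₂ * (2 * ⟪y t, y'⟫) + P.ρ₃ * (2 * ⟪θ t, θ'⟫) + P.τ * (2 * ⟪q t, q'⟫) + P.m * h')
        ≤ -(M + c₀) * ‖q t‖ ^ 2 - (M * b₀ + c₀) * h t := by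
      have h1 := mul_le_mul_of_nonneg_left hh'le P.m_pos.le
      have h2 := mul_le_mul_of_nonneg_right N2 (sq t)
      have h3 := mul_le_mul_of_nonneg_right N3 (hf.h_nonneg t ht.le)
      have h4 : P.κ * (2 * ⟪v t, v'⟫) + P.ρ₁ * (2 * ⟪u t, u'⟫) + a * (2 * ⟪z t, z'⟫)
        + P.ρ₂ * (2 * ⟪y t, y'⟫) + P.ρ₃ * (2 * ⟪θ t, θ'⟫) + P.τ * (2 * ⟪q t, q'⟫) + P.m * h'
        ≤ -(2 * P.β) * ‖q t‖ ^ 2 - P.m * k₂ * h t := by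
        linarith
      have h5 := mul_le_mul_of_nonneg_left h4 hN.le
      linarith
    obtain ⟨g1, g2, g3, g4, g5⟩ := functional_derivatives (ρ₁ := P.ρ₁) (ρ₂ := P.ρ₂) (ρ₃ := P.ρ₃)
      (κ := P.κ) (a := a) (m := P.m) (δ := P.δ) (β := P.β) (τ := P.τ) (l := l) P.κ_pos.ne'
      P.δ_pos.ne' hSs (v := v t) (u := u t) (z := z t) (y := y t) (θ := θ t) (q := q t) (n := n t)
      (v' := v') (u' := u') (z' := z') (y' := y') (θ' := θ') (q' := q')
      (by rw [hv', smul_sub, Sapp])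
      (by rw [mul_comm, mul_smul, hu', smul_inv_smul₀ P.ρ₁_pos.ne', Sapp, smul_comm])
      (by rw [hz', Sapp])
      (by rw [mul_comm, mul_smul, hy', smul_inv_smul₀ P.ρ₂_pos.ne']; simp only [Sapp]; module)
      (by rw [mul_comm, mul_smul, hθ', smul_inv_smul₀ P.ρ₃_pos.ne']; simp only [Sapp]; module)
      (by rw [mul_comm, mul_smul, hq', smul_inv_smul₀ P.τ_pos.ne']; simp only [Sapp]; module)
    obtain ⟨d1, d2, d3, d4, d5⟩ := hdiss σ l S hσ0 hσ1 hl hl1 hSlow hSup (v t) (u t) (z t) (y t)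
      (θ t) (q t) (n t)
    rw [← g1] at d1
    rw [← g2] at d2
    rw [← g3] at d3
    rw [← g4] at d4
    rw [← g5] at d5
    have hm := hmult _ _ _ _ _ _ _ _ _ _ _ _ d1 d2 d3 d4 d5
    have hn := mul_le_mul_of_nonneg_left (hf.norm_n_sq_le t ht.le) hM
    have hϱ1 : ϱ ≤ 1 := hϱ4.trans (pow_le_one₀ hσ0.le hσ1)
    have f1 : ϱ * ‖θ t‖ ^ 2 ≤ (σ * ‖θ t‖) ^ 2 := by
      have := mul_le_mul_of_nonneg_right (hϱ4.trans hσσ) (sθ t); linarith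
    have f2 : ϱ * ‖y t‖ ^ 2 ≤ (σ ^ 2 * ‖y t‖) ^ 2 := by
      have := mul_le_mul_of_nonneg_right hϱ4 (sy t); linarith
    have f3 : ϱ * ‖z t‖ ^ 2 ≤ (σ ^ 2 * ‖z t‖) ^ 2 := by
      have := mul_le_mul_of_nonneg_right hϱ4 (sz t); linarith
    have f4 : ϱ * ‖v t‖ ^ 2 = (σ ^ 2 * l * ‖v t‖) ^ 2 := by rw [hϱσ]; ring
    have f5 : ϱ * ‖u t‖ ^ 2 = (σ ^ 2 * l * ‖u t‖) ^ 2 := by rw [hϱσ]; ring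
    have f6 := mul_le_mul_of_nonneg_right hϱ1 (sq t)
    have f7 := mul_le_mul_of_nonneg_right hϱ1 (hf.h_nonneg t ht.le)
    have f8 : ϱ * W t ≤ (σ * ‖θ t‖) ^ 2 + ((σ ^ 2 * ‖y t‖) ^ 2 + ((σ ^ 2 * ‖z t‖) ^ 2
        + ((σ ^ 2 * l * ‖v t‖) ^ 2 + (σ ^ 2 * l * ‖u t‖) ^ 2))) + ‖q t‖ ^ 2 + h t := by
      simp only [hW]
      linarith
    have f9 := mul_le_mul_of_nonneg_left f8 hc₀.le
    refine (add_le_add hEle hm).trans ?_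
    linarith
  choose! L' hL' hL'le using hder
  have hfin := le_mul_exp_of_deriv_le (c := c₀ / (N * e' + M') * ϱ) hcont hL' (fun t ht => by
    refine (hL'le t ht).trans ?_
    have h1 := mul_le_mul_of_nonneg_left (hLup t ht.le)
      (show 0 ≤ c₀ / (N * e' + M') * ϱ by positivity)
    have h2 : c₀ / (N * e' + M') * ϱ * ((N * e' + M') * W t) = c₀ * ϱ * W t := by
      field_simp
    linarith) ht
  calc W t ≤ N * E t + F t := hLlow t ht
    _ ≤ (N * E 0 + F 0) * Real.exp (-(c₀ / (N * e' + M') * ϱ) * t) := hfin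
    _ ≤ ((N * e' + M') * W 0) * Real.exp (-(c₀ / (N * e' + M') * ϱ) * t) :=
      mul_le_mul_of_nonneg_right (hLup 0 le_rfl) (Real.exp_pos _).le
    _ = _ := by rw [neg_mul]; ring

end Decay

end TimoshenkoCattaneo

namespace TimoshenkoCattaneo

/-! ### The memory kernel -/

section Kernel

variable {P : Params} {g : ℝ → ℝ}

lemma IsKernel.antitoneOn_mul_exp (hg : IsKernel P g) {k : ℝ}
    (hk : ∀ s, 0 < s → deriv g s ≤ -k * g s) :
    AntitoneOn (fun s => g s * Real.exp (k * s)) (Ioi 0) := by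
  have hd : ∀ s, 0 < s → HasDerivAt (fun s => g s * Real.exp (k * s))
      (deriv g s * Real.exp (k * s) + g s * (Real.exp (k * s) * k)) s := fun s hs => by
    have : HasDerivAt (fun t : ℝ => Real.exp (k * t)) (Real.exp (k * s) * k) s := by
      simpa using ((hasDerivAt_id s).const_mul k).exp
    exact (hg.differentiable s hs).hasDerivAt.mul this
  refine antitoneOn_of_hasDerivWithinAt_nonpos (convex_Ioi 0)
    (fun s hs => (hd s hs).continuousAt.continuousWithinAt)
    (fun s hs => (hd s (by simpa using hs)).hasDerivWithinAt) (fun s hs => ?_)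
  have := mul_le_mul_of_nonneg_right (hk s (by simpa using hs)) (Real.exp_pos (k * s)).le
  linarith

lemma IsKernel.monotoneOn_mul_exp (hg : IsKernel P g) {k : ℝ}
    (hk : ∀ s, 0 < s → -k * g s ≤ deriv g s) :
    MonotoneOn (fun s => g s * Real.exp (k * s)) (Ioi 0) := by
  have hd : ∀ s, 0 < s → HasDerivAt (fun s => g s * Real.exp (k * s))
      (deriv g s * Real.exp (k * s) + g s * (Real.exp (k * s) * k)) s := fun s hs => by
    have : HasDerivAt (fun t : ℝ => Real.exp (k * t)) (Real.exp (k * s) * k) s := by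
      simpa using ((hasDerivAt_id s).const_mul k).exp
    exact (hg.differentiable s hs).hasDerivAt.mul this
  refine monotoneOn_of_hasDerivWithinAt_nonneg (convex_Ioi 0)
    (fun s hs => (hd s hs).continuousAt.continuousWithinAt)
    (fun s hs => (hd s (by simpa using hs)).hasDerivWithinAt) (fun s hs => ?_)
  have := mul_le_mul_of_nonneg_right (hk s (by simpa using hs)) (Real.exp_pos (k * s)).le
  linarith

lemma IsKernel.antitoneOn (hg : IsKernel P g) : AntitoneOn g (Ioi 0) := by
  obtain ⟨k₁, hk₁, k₂, hk₂, h⟩ := hg.deriv_bounds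
  have := hg.antitoneOn_mul_exp (k := 0) fun s hs => by
    have := (h s hs).2
    have := mul_nonneg hk₂.le (hg.nonneg s hs)
    linarith
  simpa using this

/-- A kernel decays exponentially; in particular it is bounded and integrable. -/
lemma IsKernel.exists_le_exp (hg : IsKernel P g) :
    ∃ G ≥ 0, ∃ k > 0, ∀ s, 0 < s → g s ≤ G * Real.exp (-k * s) := by
  obtain ⟨k₁, hk₁, k₂, hk₂, h⟩ := hg.deriv_bounds
  have ha := hg.antitoneOn_mul_exp fun s hs => (h s hs).2
  have hm := hg.monotoneOn_mul_exp fun s hs => (h s hs).1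
  have g1 := hg.nonneg 1 one_pos
  refine ⟨g 1 * Real.exp (k₁ + k₂), by positivity, k₂, hk₂, fun s hs => ?_⟩
  rw [neg_mul, Real.exp_neg, ← div_eq_mul_inv, le_div_iff₀ (Real.exp_pos _)]
  rcases le_total s 1 with hs1 | hs1
  · have h1 : g s * Real.exp (k₁ * s) ≤ g 1 * Real.exp (k₁ * 1) :=
      hm (mem_Ioi.2 hs) (mem_Ioi.2 one_pos) hs1
    have h2 : g s ≤ g s * Real.exp (k₁ * s) :=
      le_mul_of_one_le_right (hg.nonneg s hs) (Real.one_le_exp (by positivity))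
    rw [Real.exp_add, ← mul_assoc]
    refine mul_le_mul (by simpa using h2.trans h1) (Real.exp_le_exp.2 ?_) (Real.exp_pos _).le
      (by positivity)
    exact mul_le_of_le_one_right hk₂.le hs1
  · have h1 : g s * Real.exp (k₂ * s) ≤ g 1 * Real.exp (k₂ * 1) :=
      ha (mem_Ioi.2 one_pos) (mem_Ioi.2 hs) hs1
    refine h1.trans (mul_le_mul_of_nonneg_left (Real.exp_le_exp.2 (by linarith)) g1)

/-- If the kernel vanishes somewhere, then it vanishes at later times by monotonicity, and at
earlier times because it decays at most exponentially. -/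
lemma IsKernel.eq_zero_or_pos (hg : IsKernel P g) :
    (∀ s, 0 < s → g s = 0) ∨ (∀ s, 0 < s → 0 < g s) := by
  obtain ⟨k₁, hk₁, k₂, hk₂, h⟩ := hg.deriv_bounds
  by_contra! hcon
  obtain ⟨⟨s, hs, hs0⟩, t, ht, ht0⟩ := hcon
  have ht0' : g t = 0 := le_antisymm ht0 (hg.nonneg t ht)
  have hspos : 0 < g s := lt_of_le_of_ne (hg.nonneg s hs) (Ne.symm hs0)
  rcases le_total s t with hst | hst
  · have h1 : g s * Real.exp (k₁ * s) ≤ g t * Real.exp (k₁ * t) :=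
      hg.monotoneOn_mul_exp (fun s hs => (h s hs).1) (mem_Ioi.2 hs) (mem_Ioi.2 ht) hst
    rw [ht0', zero_mul] at h1
    exact absurd h1 (not_le.2 (by positivity))
  · have := hg.antitoneOn (mem_Ioi.2 ht) (mem_Ioi.2 hs) hst
    linarith

lemma IsKernel.continuousOn (hg : IsKernel P g) : ContinuousOn g (Ioi 0) :=
  fun s hs => (hg.differentiable s hs).continuousAt.continuousWithinAt

lemma IsKernel.integrableOn (hg : IsKernel P g) : IntegrableOn g (Ioi 0) := by
  obtain ⟨G, hG, k, hk, h⟩ := hg.exists_le_exp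
  have h1 : IntegrableOn (fun s => G * Real.exp (-k * s)) (Ioi 0) :=
    (integrableOn_exp_mul_Ioi (neg_lt_zero.2 hk) 0).const_mul G
  refine h1.mono' (hg.continuousOn.aestronglyMeasurable measurableSet_Ioi) ?_
  refine (ae_restrict_iff' measurableSet_Ioi).2 (ae_of_all _ fun s hs => ?_)
  rw [Real.norm_of_nonneg (hg.nonneg s hs)]
  exact h s hs

lemma IsKernel.exists_le (hg : IsKernel P g) : ∃ G ≥ 0, ∀ s, 0 < s → g s ≤ G := by
  obtain ⟨G, hG, k, hk, h⟩ := hg.exists_le_exp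
  refine ⟨G, hG, fun s hs => (h s hs).trans (mul_le_of_le_one_right hG ?_)⟩
  exact Real.exp_le_one_iff.2 (by nlinarith)

end Kernel

/-! ### The energy of the history -/

section HistoryEnergy

open scoped RealInnerProductSpace

variable {H : Type*} [NormedAddCommGroup H] [InnerProductSpace ℝ H]

/-- The kernel, extended by zero, may jump at `0`; the factor `‖W t - W r‖²` makes the product
differentiable there. -/
lemma hasDerivAt_kernel_mul_sq {P : Params} {g : ℝ → ℝ} (hg : IsKernel P g) {W w : ℝ → H}
    {t : ℝ} (hW : HasDerivAt W (w t) t) (r : ℝ) :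
    HasDerivAt (fun t => (Ioi 0).indicator g (t - r) * ‖W t - W r‖ ^ 2)
      ((Ioi 0).indicator (deriv g) (t - r) * ‖W t - W r‖ ^ 2
        + (Ioi 0).indicator g (t - r) * (2 * ⟪W t - W r, w t⟫)) t := by
  rcases lt_trichotomy r t with h | h | h
  · have h1 : HasDerivAt (fun t => (Ioi 0).indicator g (t - r))
        ((Ioi 0).indicator (deriv g) (t - r)) t := by
      rw [indicator_of_mem (mem_Ioi.2 (sub_pos.2 h))]
      have h2 : HasDerivAt (fun t => g (t - r)) (deriv g (t - r)) t :=
        (hg.differentiable _ (sub_pos.2 h)).hasDerivAt.comp_sub_const t r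
      refine h2.congr_of_eventuallyEq ?_
      filter_upwards [lt_mem_nhds h] with x hx
      rw [indicator_of_mem (mem_Ioi.2 (sub_pos.2 hx))]
    exact h1.mul (hW.sub_const (W r)).norm_sq
  · -- on the diagonal the integrand vanishes quadratically
    subst h
    obtain ⟨G, hG, hgG⟩ := hg.exists_le
    simp only [sub_self, norm_zero, mem_Ioi, lt_irrefl, not_false_eq_true, indicator_of_notMem,
      zero_mul, add_zero]
    have h1 : HasDerivAt (fun t => ‖W t - W r‖ ^ 2) 0 r := by
      simpa using (hW.sub_const (W r)).norm_sq
    rw [hasDerivAt_iff_isLittleO] at h1 ⊢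
    refine (Asymptotics.IsBigO.of_bound G (Eventually.of_forall fun x => ?_)).trans_isLittleO h1
    simp only [sub_self, norm_zero, mul_zero, ne_eq, OfNat.ofNat_ne_zero, not_false_eq_true,
      zero_pow, sub_zero, smul_zero, norm_mul]
    refine mul_le_mul_of_nonneg_right ?_ (norm_nonneg _)
    by_cases hx : 0 < x - r
    · rw [indicator_of_mem (mem_Ioi.2 hx), Real.norm_of_nonneg (hg.nonneg _ hx)]
      exact hgG _ hx
    · rw [indicator_of_notMem (by simpa using hx), norm_zero]
      exact hG
  · have h0 : ∀ (f : ℝ → ℝ), ∀ x < r, (Ioi 0).indicator f (x - r) = 0 := fun f x hx =>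
      indicator_of_notMem (by simpa using hx.le) _
    rw [h0 _ _ h, h0 _ _ h, zero_mul, zero_mul, add_zero]
    refine (hasDerivAt_const t (0 : ℝ)).congr_of_eventuallyEq ?_
    filter_upwards [gt_mem_nhds h] with x hx
    rw [h0 _ _ hx, zero_mul]

/-- The energy `∫ g(s) ‖W(t) - W(t - s)‖² ds` of a history is differentiable in time, even if `W` is
only square integrable at negative times, since the substitution `r = t - s` moves the
differentiation to the kernel. -/
lemma exists_deriv_history_energy [CompleteSpace H] {P : Params} {g : ℝ → ℝ} (hg : IsKernel P g)
    {k₂ : ℝ}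
    (hk₂ : ∀ s, 0 < s → deriv g s ≤ -k₂ * g s) {W w : ℝ → H} (hWc : ContinuousOn W (Ici 0))
    (hwc : ContinuousOn w (Ici 0)) (hW : ∀ t, 0 < t → HasDerivAt W (w t) t)
    (h1 : ∀ t, 0 < t → IntegrableOn (fun s => g s • (W t - W (t - s))) (Ioi 0))
    (h2 : ∀ t, 0 < t → IntegrableOn (fun s => g s * ‖W t - W (t - s)‖ ^ 2) (Ioi 0))
    {t : ℝ} (ht : 0 < t) :
    ∃ h', HasDerivAt (fun t => ∫ s in Ioi 0, g s * ‖W t - W (t - s)‖ ^ 2) h' t ∧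
      h' ≤ -k₂ * (∫ s in Ioi 0, g s * ‖W t - W (t - s)‖ ^ 2)
        + 2 * ⟪∫ s in Ioi 0, g s • (W t - W (t - s)), w t⟫ := by
  obtain ⟨k₁, hk₁, k', hk'0, hk⟩ := hg.deriv_bounds
  obtain ⟨G, hG, hgG⟩ := hg.exists_le
  set gi := (Ioi (0 : ℝ)).indicator g with hgi
  have gi0 : ∀ s, 0 ≤ gi s := fun s => indicator_nonneg (fun s hs => hg.nonneg s hs) s
  have giG : ∀ s, gi s ≤ G := fun s => by
    rw [hgi]
    exact indicator_apply_le' (fun h => hgG s h) fun _ => hG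
  have gid : ∀ s, |(Ioi (0 : ℝ)).indicator (deriv g) s| ≤ k₁ * gi s := fun s => by
    by_cases hs : 0 < s
    · have h0 := mul_nonneg hk₁.le (hg.nonneg s hs)
      have h3 := (hk s hs).2
      have h4 := mul_nonneg hk'0.le (hg.nonneg s hs)
      rw [hgi, indicator_of_mem (mem_Ioi.2 hs), indicator_of_mem (mem_Ioi.2 hs), abs_le]
      exact ⟨by linarith [(hk s hs).1], by linarith⟩
    · rw [hgi, indicator_of_notMem (by simpa using hs), indicator_of_notMem (by simpa using hs)]
      simp
  -- the substitution `r = t - s`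
  have ind2 : ∀ x, (Ioi (0 : ℝ)).indicator (fun s => g s * ‖W x - W (x - s)‖ ^ 2)
      = fun s => gi s * ‖W x - W (x - s)‖ ^ 2 := fun x => by
    funext s
    by_cases hs : 0 < s <;> simp [hgi, indicator, hs]
  have ind1 : ∀ x, (Ioi (0 : ℝ)).indicator (fun s => g s • (W x - W (x - s)))
      = fun s => gi s • (W x - W (x - s)) := fun x => by
    funext s
    by_cases hs : 0 < s <;> simp [hgi, indicator, hs]
  have int2 : ∀ x, 0 < x → Integrable fun r => gi (x - r) * ‖W x - W r‖ ^ 2 := fun x hx => by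
    have := (integrable_indicator_iff measurableSet_Ioi).2 (h2 x hx)
    rw [ind2] at this
    simpa using this.comp_sub_left x
  have int1 : ∀ x, 0 < x → Integrable fun r => gi (x - r) • (W x - W r) := fun x hx => by
    have := (integrable_indicator_iff measurableSet_Ioi).2 (h1 x hx)
    rw [ind1] at this
    simpa using this.comp_sub_left x
  have eq2 : ∀ x, ∫ s in Ioi 0, g s * ‖W x - W (x - s)‖ ^ 2
      = ∫ r, gi (x - r) * ‖W x - W r‖ ^ 2 := fun x => by
    rw [← integral_indicator measurableSet_Ioi, ind2,
      ← integral_sub_left_eq_self (fun s => gi s * ‖W x - W (x - s)‖ ^ 2) volume x]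
    simp
  have eq1 : ∀ x, ∫ s in Ioi 0, g s • (W x - W (x - s))
      = ∫ r, gi (x - r) • (W x - W r) := fun x => by
    rw [← integral_indicator measurableSet_Ioi, ind1,
      ← integral_sub_left_eq_self (fun s => gi s • (W x - W (x - s))) volume x]
    simp
  have intg : ∀ x, Integrable fun r => gi (x - r) := fun x =>
    ((integrable_indicator_iff measurableSet_Ioi).2 hg.integrableOn).comp_sub_left x
  set a := t / 2 with ha
  have ha0 : 0 < a := by positivity
  have hball : ∀ x ∈ Metric.ball t a, a < x ∧ x < t + a := fun x hx => by
    rw [Metric.mem_ball, Real.dist_eq, abs_lt] at hx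
    constructor <;> linarith [hx.1, hx.2]
  have hsub : Icc a (t + a) ⊆ Ici 0 := fun x hx => ha0.le.trans hx.1
  obtain ⟨B₁, hB₁⟩ := isCompact_Icc.exists_bound_of_continuousOn (hWc.mono hsub)
  obtain ⟨B₂, hB₂⟩ := isCompact_Icc.exists_bound_of_continuousOn (hwc.mono hsub)
  set B := max B₁ B₂ with hB
  have hBW : ∀ x ∈ Icc a (t + a), ‖W x‖ ≤ B := fun x hx => (hB₁ x hx).trans (le_max_left _ _)
  have hBw : ∀ x ∈ Icc a (t + a), ‖w x‖ ≤ B := fun x hx => (hB₂ x hx).trans (le_max_right _ _)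
  have hamem : a ∈ Icc a (t + a) := ⟨le_rfl, by linarith⟩
  have hB0 : 0 ≤ B := (norm_nonneg _).trans (hBW a hamem)
  -- the integrand at time `x` is dominated by the one at time `a < x` for `r < a`, and on `[a, x)`
  -- by the bounds of `W` and `w`
  set F' : ℝ → ℝ → ℝ := fun x r => (Ioi 0).indicator (deriv g) (x - r) * ‖W x - W r‖ ^ 2
    + gi (x - r) * (2 * ⟪W x - W r, w x⟫) with hF'
  set bound : ℝ → ℝ := fun r => gi (a - r) * ((k₁ + 1) * (8 * B ^ 2) + B ^ 2)
    + 2 * (k₁ + 1) * (gi (a - r) * ‖W a - W r‖ ^ 2)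
    + (Icc a (t + a)).indicator (fun _ => G * ((k₁ + 1) * (4 * B ^ 2) + B ^ 2)) r with hbound
  have hbint : Integrable bound := by
    refine (((intg a).mul_const _).add ((int2 a ha0).const_mul _)).add ?_
    rw [integrable_indicator_iff measurableSet_Icc]
    exact integrableOn_const (by simp) enorm_ne_top
  have hbd : ∀ r, ∀ x ∈ Metric.ball t a, ‖F' x r‖ ≤ bound r := by
    intro r x hx
    obtain ⟨hx1, hx2⟩ := hball x hx
    have hxm : x ∈ Icc a (t + a) := ⟨hx1.le, hx2.le⟩
    have h3 : ‖F' x r‖ ≤ gi (x - r) * ((k₁ + 1) * ‖W x - W r‖ ^ 2 + B ^ 2) := by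
      have e1 := mul_le_mul_of_nonneg_right (gid (x - r)) (sq_nonneg ‖W x - W r‖)
      have e2 : |⟪W x - W r, w x⟫| ≤ ‖W x - W r‖ * B :=
        (abs_real_inner_le_norm _ _).trans
          (mul_le_mul_of_nonneg_left (hBw x hxm) (norm_nonneg _))
      have e3 : 2 * |⟪W x - W r, w x⟫| ≤ ‖W x - W r‖ ^ 2 + B ^ 2 := by
        nlinarith [sq_nonneg (‖W x - W r‖ - B)]
      have e4 := mul_le_mul_of_nonneg_left e3 (gi0 (x - r))
      rw [hF', Real.norm_eq_abs]
      refine (abs_add_le _ _).trans ?_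
      rw [abs_mul, abs_mul, abs_mul, abs_of_nonneg (sq_nonneg ‖W x - W r‖), abs_two,
        abs_of_nonneg (gi0 _)]
      linarith
    have hi0 : 0 ≤ (Icc a (t + a)).indicator (fun _ => G * ((k₁ + 1) * (4 * B ^ 2) + B ^ 2)) r :=
      indicator_nonneg (fun _ _ => by positivity) r
    have hb0 : 0 ≤ gi (a - r) * ((k₁ + 1) * (8 * B ^ 2) + B ^ 2)
        + 2 * (k₁ + 1) * (gi (a - r) * ‖W a - W r‖ ^ 2) := by
      have := gi0 (a - r)
      positivity
    refine h3.trans ?_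
    rcases lt_or_ge r a with hr | hr
    · have e1 : gi (x - r) ≤ gi (a - r) := by
        rw [hgi, indicator_of_mem (mem_Ioi.2 (by linarith)),
          indicator_of_mem (mem_Ioi.2 (by linarith))]
        exact hg.antitoneOn (mem_Ioi.2 (by linarith)) (mem_Ioi.2 (by linarith)) (by linarith)
      have e2 : ‖W x - W r‖ ≤ 2 * B + ‖W a - W r‖ := by
        have e3 : W x - W r = (W x - W a) + (W a - W r) := by abel
        have e4 := norm_add_le (W x - W a) (W a - W r)
        have e5 := norm_sub_le (W x) (W a)
        rw [e3]
        linarith [hBW x hxm, hBW a hamem]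
      have e3 : ‖W x - W r‖ ^ 2 ≤ 8 * B ^ 2 + 2 * ‖W a - W r‖ ^ 2 := by
        have := pow_le_pow_left₀ (norm_nonneg _) e2 2
        nlinarith [sq_nonneg (2 * B - ‖W a - W r‖)]
      have e4 : (k₁ + 1) * ‖W x - W r‖ ^ 2 + B ^ 2
          ≤ (k₁ + 1) * (8 * B ^ 2 + 2 * ‖W a - W r‖ ^ 2) + B ^ 2 := by
        have := mul_le_mul_of_nonneg_left e3 (show 0 ≤ k₁ + 1 by linarith)
        linarith
      have e5 := mul_le_mul e1 e4 (by positivity) (gi0 _)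
      simp only [hbound]
      linarith
    · rcases lt_or_ge r x with hrx | hrx
      · have hrm : r ∈ Icc a (t + a) := ⟨hr, by linarith⟩
        have e2 : ‖W x - W r‖ ≤ 2 * B := by
          have e5 := norm_sub_le (W x) (W r)
          linarith [hBW x hxm, hBW r hrm]
        have e3 : ‖W x - W r‖ ^ 2 ≤ 4 * B ^ 2 := by
          have := pow_le_pow_left₀ (norm_nonneg _) e2 2
          linarith
        have e4 : (k₁ + 1) * ‖W x - W r‖ ^ 2 + B ^ 2 ≤ (k₁ + 1) * (4 * B ^ 2) + B ^ 2 := by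
          have := mul_le_mul_of_nonneg_left e3 (show 0 ≤ k₁ + 1 by linarith)
          linarith
        have e5 := mul_le_mul (giG (x - r)) e4 (by positivity) hG
        simp only [hbound]
        rw [indicator_of_mem hrm]
        linarith
      · have e1 : gi (x - r) = 0 := indicator_of_notMem (by simpa using hrx) _
        rw [e1, zero_mul]
        simp only [hbound]
        linarith
  have hderiv : ∀ r, ∀ x ∈ Metric.ball t a,
      HasDerivAt (fun x => gi (x - r) * ‖W x - W r‖ ^ 2) (F' x r) x := fun r x hx =>
    hasDerivAt_kernel_mul_sq hg (hW x (ha0.trans (hball x hx).1)) r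
  have htm : t ∈ Metric.ball t a := Metric.mem_ball_self ha0
  have hF'meas : AEStronglyMeasurable (F' t) volume := by
    -- a limit of difference quotients
    have hseq : Tendsto (fun n : ℕ => t + 1 / ((n : ℝ) + 1)) atTop (𝓝[≠] t) := by
      refine tendsto_nhdsWithin_iff.2 ⟨?_, Eventually.of_forall fun n => ?_⟩
      · simpa using tendsto_one_div_add_atTop_nhds_zero_nat.const_add t
      · have : (0 : ℝ) < 1 / ((n : ℝ) + 1) := by positivity
        simp only [mem_compl_iff, mem_singleton_iff]
        linarith
    refine aestronglyMeasurable_of_tendsto_ae atTop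
      (f := fun (n : ℕ) r => slope (fun x => gi (x - r) * ‖W x - W r‖ ^ 2) t
        (t + 1 / ((n : ℝ) + 1))) (fun n => ?_) (ae_of_all _ fun r => ?_)
    · simp only [slope_def_module]
      exact (((int2 (t + 1 / ((n : ℝ) + 1)) (by positivity)).sub
        (int2 t ht)).aestronglyMeasurable.const_smul
          ((t + 1 / ((n : ℝ) + 1) - t)⁻¹))
    · exact (hasDerivAt_iff_tendsto_slope.1 (hderiv r t htm)).comp hseq
  have main := hasDerivAt_integral_of_dominated_loc_of_deriv_le (μ := volume) (F' := F')
    (F := fun x r => gi (x - r) * ‖W x - W r‖ ^ 2) (Metric.ball_mem_nhds t ha0)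
    (by filter_upwards [lt_mem_nhds ht] with x hx using (int2 x hx).aestronglyMeasurable)
    (int2 t ht) hF'meas (ae_of_all _ hbd) hbint (ae_of_all _ hderiv)
  refine ⟨∫ r, F' t r, ?_, ?_⟩
  · simp only [eq2]
    exact main.2
  · rw [eq1, eq2]
    have e1 : ⟪∫ r, gi (t - r) • (W t - W r), w t⟫
        = ∫ r, ⟪w t, gi (t - r) • (W t - W r)⟫ := by
      rw [real_inner_comm, integral_inner (int1 t ht)]
    rw [e1, ← integral_const_mul, ← integral_const_mul, ← integral_add ((int2 t ht).const_mul _)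
      (((int1 t ht).const_inner (w t)).const_mul _)]
    refine integral_mono main.1 (((int2 t ht).const_mul _).add
      (((int1 t ht).const_inner (w t)).const_mul _)) fun r => ?_
    simp only [hF', real_inner_smul_right]
    rw [real_inner_comm (w t)]
    have e2 : (Ioi 0).indicator (deriv g) (t - r) ≤ -k₂ * gi (t - r) := by
      by_cases hs : 0 < t - r
      · rw [hgi, indicator_of_mem (mem_Ioi.2 hs), indicator_of_mem (mem_Ioi.2 hs)]
        exact hk₂ _ hs
      · rw [hgi, indicator_of_notMem (by simpa using hs), indicator_of_notMem (by simpa using hs)]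
        simp
    have e3 := mul_le_mul_of_nonneg_right e2 (sq_nonneg ‖W t - W r‖)
    linarith

end HistoryEnergy

end TimoshenkoCattaneo

namespace TimoshenkoCattaneo

/-! ### Derivatives on the Fourier side -/

section FourierSide

open scoped FourierTransform

/-- The symbol `2πiξ` of `∂ₓ`. -/
noncomputable def symb (x : ℝ) : ℂ := 2 * Real.pi * Complex.I * x

lemma symb_hasTemperateGrowth (j : ℕ) : (fun x => symb x ^ j).HasTemperateGrowth := by
  unfold symb
  fun_prop

lemma continuous_symb : Continuous symb := by
  unfold symb
  fun_prop

lemma norm_symb (x : ℝ) : ‖symb x‖ = 2 * Real.pi * |x| := by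
  simp [symb, abs_of_pos Real.pi_pos]

lemma dx_eq_lineDerivOp (S : 𝓢'(ℝ, ℂ)) : dx S = LineDeriv.lineDerivOp (1 : ℝ) S := by
  ext φ
  simp only [derivCLM_apply_apply, TemperedDistribution.lineDerivOp_apply_apply]
  congr 2

/-- The duality `⟨∂ₓ S, 𝓕 ψ⟩ = ⟨S, 𝓕 (symb ψ)⟩`. -/
lemma fourier_dx (S : 𝓢'(ℝ, ℂ)) (ψ : 𝓢(ℝ, ℂ)) :
    dx S (𝓕 ψ) = S (𝓕 (SchwartzMap.smulLeftCLM ℂ symb ψ)) := by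
  have h0 : symb.HasTemperateGrowth := by simpa using symb_hasTemperateGrowth 1
  have h1 : (fun x : ℝ => inner ℝ x (1 : ℝ)).HasTemperateGrowth := by fun_prop
  have h := DFunLike.congr_fun (TemperedDistribution.fourier_lineDerivOp_eq S (1 : ℝ)) ψ
  rw [← dx_eq_lineDerivOp] at h
  rw [← TemperedDistribution.fourier_apply, h, ← TemperedDistribution.fourier_apply]
  simp only [smul_apply, TemperedDistribution.smulLeftCLM_apply_apply,
    ← map_smul]
  congr 1
  ext x
  have h2 : (fun x : ℝ => ((inner ℝ x (1 : ℝ) : ℝ) : ℂ)).HasTemperateGrowth := by fun_prop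
  rw [map_smul, smul_apply, SchwartzMap.smulLeftCLM_apply_apply h0,
    SchwartzMap.smulLeftCLM_apply_apply h2]
  simp only [symb, smul_eq_mul, RCLike.inner_apply]
  simp
  ring

lemma iterate_dx_fourier (j : ℕ) (S : 𝓢'(ℝ, ℂ)) (ψ : 𝓢(ℝ, ℂ)) :
    (dx^[j] S) (𝓕 ψ) = S (𝓕 (SchwartzMap.smulLeftCLM ℂ (fun x => symb x ^ j) ψ)) := by
  induction j generalizing ψ with
  | zero => simp
  | succ j ih =>
    have h0 : symb.HasTemperateGrowth := by simpa using symb_hasTemperateGrowth 1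
    rw [Function.iterate_succ_apply', fourier_dx, ih,
      SchwartzMap.smulLeftCLM_smulLeftCLM_apply (symb_hasTemperateGrowth j) h0]
    simp only [Pi.mul_def, pow_succ]

lemma distr_fourier (f : L2) (ψ : 𝓢(ℝ, ℂ)) :
    distr f (𝓕 ψ) = ∫ x, ψ x * (𝓕 f : L2) x := by
  rw [← TemperedDistribution.fourier_apply, Lp.fourier_toTemperedDistribution_eq]
  simp

/-- The distributional derivative of order `j` tested with a Fourier transform. -/
lemma iterate_dx_distr_fourier (j : ℕ) (f : L2) (ψ : 𝓢(ℝ, ℂ)) :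
    (dx^[j] (distr f)) (𝓕 ψ) = ∫ x, ψ x * (symb x ^ j * (𝓕 f : L2) x) := by
  rw [iterate_dx_fourier, distr_fourier]
  refine integral_congr_ae (ae_of_all _ fun x => ?_)
  simp only [SchwartzMap.smulLeftCLM_apply_apply (symb_hasTemperateGrowth j), smul_eq_mul]
  ring

lemma locallyIntegrable_mul_coeFn {b : ℝ → ℂ} (hb : Continuous b) (f : L2) :
    LocallyIntegrable (fun x => b x * f x) := by
  have := (Lp.memLp f).locallyIntegrable one_le_two
  exact this.continuous_smul hb

/-- Weak derivatives of `L²` functions in terms of the Fourier transform. -/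
lemma isWeakDeriv_iff {j : ℕ} {f h : L2} :
    IsWeakDeriv j f h ↔ (𝓕 h : L2) =ᵐ[volume] fun x => symb x ^ j * (𝓕 f : L2) x := by
  constructor
  · intro hw
    refine ae_eq_of_integral_contDiff_smul_eq ((Lp.memLp _).locallyIntegrable one_le_two)
      (locallyIntegrable_mul_coeFn (continuous_symb.pow j) _) fun w hw1 hw2 => ?_
    have h₁ : HasCompactSupport (Complex.ofRealCLM ∘ w) := hw2.comp_left rfl
    have h₂ : ContDiff ℝ (⊤ : ℕ∞) (Complex.ofRealCLM ∘ w) := by fun_prop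
    have h3 := congrArg (fun S : 𝓢'(ℝ, ℂ) => S (𝓕 (h₁.toSchwartzMap h₂))) hw
    simp only [iterate_dx_distr_fourier] at h3
    rw [distr_fourier] at h3
    simpa [Complex.real_smul] using h3.symm
  · intro hw
    rw [IsWeakDeriv]
    ext φ
    obtain ⟨ψ, rfl⟩ : ∃ ψ, φ = 𝓕 ψ := ⟨𝓕⁻ φ, by simp⟩
    rw [iterate_dx_distr_fourier, distr_fourier]
    refine integral_congr_ae ?_
    filter_upwards [hw] with x hx
    rw [hx]

lemma enorm_sq_eq_lintegral (f : L2) : ‖f‖ₑ ^ 2 = ∫⁻ x, ‖f x‖ₑ ^ 2 := by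
  rw [Lp.enorm_def, eLpNorm_eq_lintegral_rpow_enorm_toReal (by simp) (by simp)]
  simp only [ENNReal.toReal_ofNat, one_div]
  rw [← ENNReal.rpow_natCast, ← ENNReal.rpow_mul]
  norm_num

lemma enorm_fourier (f : L2) : ‖(𝓕 f : L2)‖ₑ = ‖f‖ₑ := by
  rw [← ofReal_norm, ← ofReal_norm, Lp.norm_fourier_eq]

/-- `‖∂ₓ^j f‖₂²` computed on the Fourier side. -/
noncomputable def freqNormSq (j : ℕ) (f : L2) : ℝ≥0∞ :=
  ∫⁻ x, ‖symb x ^ j‖ₑ ^ 2 * ‖(𝓕 f : L2) x‖ₑ ^ 2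

lemma IsWeakDeriv.enorm_sq {j : ℕ} {f h : L2} (hw : IsWeakDeriv j f h) :
    ‖h‖ₑ ^ 2 = freqNormSq j f := by
  rw [← enorm_fourier, enorm_sq_eq_lintegral, freqNormSq]
  refine lintegral_congr_ae ?_
  filter_upwards [isWeakDeriv_iff.1 hw] with x hx
  rw [hx, enorm_mul, mul_pow]

lemma exists_isWeakDeriv {j : ℕ} {f : L2} (hf : freqNormSq j f ≠ ⊤) : ∃ h, IsWeakDeriv j f h := by
  have h1 : MemLp (fun x => symb x ^ j * (𝓕 f : L2) x) 2 volume := by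
    refine ⟨((continuous_symb.pow j).aestronglyMeasurable).mul (Lp.aestronglyMeasurable _), ?_⟩
    rw [eLpNorm_lt_top_iff_lintegral_rpow_enorm_lt_top (by simp) (by simp)]
    simpa [enorm_mul, mul_pow, freqNormSq] using lt_top_iff_ne_top.2 hf
  refine ⟨𝓕⁻ (h1.toLp _), isWeakDeriv_iff.2 ?_⟩
  rw [FourierTransform.fourier_fourierInv_eq]
  exact h1.coeFn_toLp

/-- The infimum in `derivNorm` is attained: weak derivatives are unique, and exist if the integral
on the Fourier side is finite. -/
lemma derivNorm_sq (j : ℕ) (f : L2) : derivNorm j f ^ 2 = freqNormSq j f := by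
  by_cases hf : freqNormSq j f = ⊤
  · rw [hf, derivNorm, ENNReal.pow_eq_top_iff]
    refine ⟨?_, two_ne_zero⟩
    refine iInf₂_eq_top.2 fun h hw => ?_
    have := hw.enorm_sq
    rw [hf] at this
    simp at this
  · obtain ⟨h, hw⟩ := exists_isWeakDeriv hf
    have h1 : derivNorm j f = ‖h‖ₑ := by
      refine le_antisymm (iInf₂_le h hw) (le_iInf₂ fun h' hw' => le_of_eq ?_)
      have : ‖h‖ₑ ^ 2 = ‖h'‖ₑ ^ 2 := by rw [hw.enorm_sq, hw'.enorm_sq]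
      exact (ENNReal.pow_right_strictMono two_ne_zero).injective this
    rw [h1, hw.enorm_sq]

end FourierSide

end TimoshenkoCattaneo

namespace TimoshenkoCattaneo

section Multiplier

open scoped FourierTransform

/-- Multiplication by a bounded function, as an operator on `L²`. -/
noncomputable def multiplier (b : ℝ → ℂ) (hb : MemLp b ∞ volume) : L2 →L[ℂ] L2 :=
  (ContinuousLinearMap.mul ℂ ℂ).holderL volume ∞ 2 2 (hb.toLp b)

lemma coeFn_multiplier {b : ℝ → ℂ} (hb : MemLp b ∞ volume) (f : L2) :
    multiplier b hb f =ᵐ[volume] fun x => b x * f x := by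
  have h := (ContinuousLinearMap.mul ℂ ℂ).coeFn_holder (r := 2) (hb.toLp b) f
  filter_upwards [h, hb.coeFn_toLp] with x h1 h2
  change ((ContinuousLinearMap.mul ℂ ℂ).holder 2 (hb.toLp b) f : L2) x = _
  rw [h1, h2]
  simp

lemma memLp_top_of_measurable_of_bound {b : ℝ → ℂ} (hb : Measurable b) (K : ℝ)
    (hK : ∀ x, ‖b x‖ ≤ K) :
    MemLp b ∞ volume :=
  memLp_top_of_bound hb.aestronglyMeasurable K (ae_of_all _ hK)

/-- The Fourier transform of an integrable function is bounded by its `L¹` norm. -/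
lemma enorm_fourier_le_eLpNorm_one (f : L2) :
    ∀ᵐ x, ‖(𝓕 f : L2) x‖ₑ ≤ eLpNorm f 1 volume := by
  by_cases hf : eLpNorm f 1 volume = ⊤
  · simp [hf]
  have hint : Integrable (f : ℝ → ℂ) :=
    memLp_one_iff_integrable.1 ⟨Lp.aestronglyMeasurable f, lt_top_iff_ne_top.2 hf⟩
  have hcont : Continuous (𝓕 (f : ℝ → ℂ)) :=
    VectorFourier.fourierIntegral_continuous Real.continuous_fourierChar continuous_inner hint
  have hae : (𝓕 f : L2) =ᵐ[volume] 𝓕 (f : ℝ → ℂ) := by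
    refine ae_eq_of_integral_contDiff_smul_eq ((Lp.memLp _).locallyIntegrable one_le_two)
      hcont.locallyIntegrable fun w hw1 hw2 => ?_
    have h₁ : HasCompactSupport (Complex.ofRealCLM ∘ w) := hw2.comp_left rfl
    have h₂ : ContDiff ℝ (⊤ : ℕ∞) (Complex.ofRealCLM ∘ w) := by fun_prop
    have h3 := distr_fourier f (h₁.toSchwartzMap h₂)
    have h4 := VectorFourier.integral_bilin_fourierIntegral_eq_flip (ContinuousLinearMap.mul ℂ ℂ)
      (L := innerₗ ℝ) (μ := volume) (ν := volume) Real.continuous_fourierChar continuous_inner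
      (h₁.toSchwartzMap h₂).integrable hint
    have h5 : distr f (𝓕 (h₁.toSchwartzMap h₂)) =
        ∫ x, (𝓕 (h₁.toSchwartzMap h₂)) x * f x := by simp
    rw [h5] at h3
    have h6 : ∫ x, (𝓕 (h₁.toSchwartzMap h₂)) x * f x
        = ∫ x, (h₁.toSchwartzMap h₂) x * 𝓕 (f : ℝ → ℂ) x := by
      simpa using! h4
    rw [h6] at h3
    simpa [Complex.real_smul] using h3.symm
  filter_upwards [hae] with x hx
  rw [hx, eLpNorm_one_eq_lintegral_enorm, ← ofReal_norm,
    ← ofReal_integral_norm_eq_lintegral_enorm hint]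
  exact ENNReal.ofReal_le_ofReal (VectorFourier.norm_fourierIntegral_le_integral_norm _ _ _ _ _)

/-- The symbol `symb ^ j` cut off at frequency `n`. -/
lemma memLp_top_cutoff (j n : ℕ) :
    MemLp ((Metric.closedBall (0 : ℝ) n).indicator fun x => symb x ^ j) ∞ volume := by
  obtain ⟨K, hK⟩ := (isCompact_closedBall (0 : ℝ) n).exists_bound_of_continuousOn
    (continuous_symb.pow j).continuousOn
  refine memLp_top_of_measurable_of_bound ((continuous_symb.pow j).measurable.indicator
    measurableSet_closedBall) (max K 0) fun x => ?_
  by_cases hx : x ∈ Metric.closedBall (0 : ℝ) n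
  · rw [indicator_of_mem hx]
    exact (hK x hx).trans (le_max_left _ _)
  · rw [indicator_of_notMem hx, norm_zero]
    exact le_max_right _ _

/-- A weak derivative is a limit of frequency cutoffs, which depend continuously on the function. -/
lemma tendsto_multiplier_cutoff {j : ℕ} {f h : L2} (hw : IsWeakDeriv j f h) :
    Tendsto (fun n : ℕ => (𝓕⁻ (multiplier _ (memLp_top_cutoff j n) (𝓕 f : L2)) : L2)) atTop
      (𝓝 h) := by
  have key : Tendsto (fun n : ℕ => multiplier _ (memLp_top_cutoff j n) (𝓕 f : L2)) atTop
      (𝓝 (𝓕 h : L2)) := by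
    rw [tendsto_iff_edist_tendsto_0]
    have h1 : ∀ n : ℕ, edist (multiplier _ (memLp_top_cutoff j n) (𝓕 f : L2)) (𝓕 h : L2) ^ 2
        = ∫⁻ x, ‖(Metric.closedBall (0 : ℝ) n)ᶜ.indicator (𝓕 h : L2) x‖ₑ ^ 2 := fun n => by
      rw [edist_eq_enorm_sub, enorm_sq_eq_lintegral]
      refine lintegral_congr_ae ?_
      filter_upwards [coeFn_multiplier (memLp_top_cutoff j n) (𝓕 f : L2), isWeakDeriv_iff.1 hw,
        Lp.coeFn_sub (multiplier _ (memLp_top_cutoff j n) (𝓕 f : L2)) (𝓕 h : L2)] with x e1 e2 e3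
      rw [e3, Pi.sub_apply, e1]
      by_cases hx : x ∈ Metric.closedBall (0 : ℝ) n
      · rw [indicator_of_mem hx, indicator_of_notMem (by simpa using hx), e2, sub_self]
      · rw [indicator_of_notMem hx, indicator_of_mem (by simpa using hx), zero_mul, zero_sub,
          enorm_neg]
    have h2 : Tendsto (fun n : ℕ => ∫⁻ x, ‖(Metric.closedBall (0 : ℝ) n)ᶜ.indicator
        (𝓕 h : L2) x‖ₑ ^ 2) atTop (𝓝 (∫⁻ x : ℝ, (0 : ℝ≥0∞))) := by
      refine tendsto_lintegral_of_dominated_convergence' (fun x => ‖(𝓕 h : L2) x‖ₑ ^ 2)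
        (fun n => ?_) (fun n => ae_of_all _ fun x => ?_) ?_ (ae_of_all _ fun x => ?_)
      · exact (((Lp.aestronglyMeasurable _).indicator
          measurableSet_closedBall.compl).enorm.pow_const 2)
      · exact pow_le_pow_left' (enorm_indicator_le_enorm_self _ _) 2
      · rw [← enorm_sq_eq_lintegral]
        exact ENNReal.pow_ne_top enorm_ne_top
      · obtain ⟨N, hN⟩ := exists_nat_ge |x|
        refine tendsto_const_nhds.congr' ?_
        filter_upwards [eventually_ge_atTop N] with n hn
        rw [indicator_of_notMem, enorm_zero, zero_pow two_ne_zero]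
        have : (N : ℝ) ≤ n := by exact_mod_cast hn
        simp only [mem_compl_iff, Metric.mem_closedBall, dist_zero_right, Real.norm_eq_abs, not_not]
        exact hN.trans this
    simp only [lintegral_zero] at h2
    have h3 : Tendsto (fun n : ℕ => (edist (multiplier _ (memLp_top_cutoff j n) (𝓕 f : L2))
        (𝓕 h : L2) ^ 2) ^ (1 / 2 : ℝ)) atTop (𝓝 (0 ^ (1 / 2 : ℝ))) := by
      simp only [h1]
      exact (ENNReal.continuous_rpow_const.tendsto _).comp h2
    have h4 : ∀ x : ℝ≥0∞, (x ^ 2) ^ (1 / 2 : ℝ) = x := fun x => by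
      rw [← ENNReal.rpow_natCast, ← ENNReal.rpow_mul]
      norm_num
    simpa only [h4, ENNReal.zero_rpow_of_pos (show (0 : ℝ) < 1 / 2 by norm_num)] using h3
  have h5 := ((FourierTransform.continuous_fourierInv (E := L2)).tendsto (𝓕 h : L2)).comp key
  simpa [Function.comp_def] using h5

lemma eLpNorm_two_sq {α E : Type*} [MeasurableSpace α] [NormedAddCommGroup E] {μ : Measure α}
    (f : α → E) : eLpNorm f 2 μ ^ 2 = ∫⁻ a, ‖f a‖ₑ ^ 2 ∂μ := by
  rw [eLpNorm_eq_lintegral_rpow_enorm_toReal (by simp) (by simp)]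
  simp only [ENNReal.toReal_ofNat, one_div]
  rw [← ENNReal.rpow_natCast, ← ENNReal.rpow_mul]
  norm_num

lemma IsHistDeriv.eLpNorm_sq {g : ℝ → ℝ} {j : ℕ} {η ζ : ℝ → L2} (h : IsHistDeriv g j η ζ) :
    eLpNorm ζ 2 (histMeasure g) ^ 2 = ∫⁻ s, freqNormSq j (η s) ∂histMeasure g := by
  rw [eLpNorm_two_sq]
  refine lintegral_congr_ae ?_
  filter_upwards [h.2] with s hs using hs.enorm_sq

lemma le_histDerivNorm_sq (g : ℝ → ℝ) (j : ℕ) (η : ℝ → L2) :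
    ∫⁻ s, freqNormSq j (η s) ∂histMeasure g ≤ histDerivNorm g j η ^ 2 := by
  by_cases htop : histDerivNorm g j η = ⊤
  · simp [htop]
  rw [histDerivNorm, ← ne_eq, ← lt_top_iff_ne_top] at htop
  obtain ⟨ζ₀, h₀⟩ := iInf_lt_iff.1 htop
  obtain ⟨hζ₀, -⟩ := iInf_lt_iff.1 h₀
  have h1 : histDerivNorm g j η = eLpNorm ζ₀ 2 (histMeasure g) := by
    refine le_antisymm (iInf₂_le ζ₀ hζ₀) (le_iInf₂ fun ζ hζ => le_of_eq ?_)
    have : eLpNorm ζ₀ 2 (histMeasure g) ^ 2 = eLpNorm ζ 2 (histMeasure g) ^ 2 := by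
      rw [hζ₀.eLpNorm_sq, hζ.eLpNorm_sq]
    exact (ENNReal.pow_right_strictMono two_ne_zero).injective this
  rw [h1, hζ₀.eLpNorm_sq]

/-- Pointwise weak derivatives of the history form a measurable function, being the limit of
frequency cutoffs of the history. -/
lemma histDerivNorm_sq_le {g : ℝ → ℝ} {j : ℕ} {η : ℝ → L2}
    (hη : AEStronglyMeasurable η (histMeasure g))
    (hfin : ∀ᵐ s ∂histMeasure g, freqNormSq j (η s) ≠ ⊤) :
    histDerivNorm g j η ^ 2 ≤ ∫⁻ s, freqNormSq j (η s) ∂histMeasure g := by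
  by_cases htop : ∫⁻ s, freqNormSq j (η s) ∂histMeasure g = ⊤
  · simp [htop]
  classical
  set ζ : ℝ → L2 := fun s => if h : ∃ h, IsWeakDeriv j (η s) h then h.choose else 0 with hζ
  have hw : ∀ᵐ s ∂histMeasure g, IsWeakDeriv j (η s) (ζ s) := by
    filter_upwards [hfin] with s hs
    have h := exists_isWeakDeriv hs
    simp only [hζ, dif_pos h]
    exact h.choose_spec
  have hmeas : AEStronglyMeasurable ζ (histMeasure g) := by
    refine aestronglyMeasurable_of_tendsto_ae atTop (f := fun (n : ℕ) s =>
      (𝓕⁻ (multiplier _ (memLp_top_cutoff j n) (𝓕 (η s) : L2)) : L2)) (fun n => ?_) ?_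
    · have hc : Continuous fun f : L2 =>
          (𝓕⁻ (multiplier _ (memLp_top_cutoff j n) (𝓕 f : L2)) : L2) := by fun_prop
      exact hc.comp_aestronglyMeasurable hη
    · filter_upwards [hw] with s hs using tendsto_multiplier_cutoff hs
  have heq : eLpNorm ζ 2 (histMeasure g) ^ 2 = ∫⁻ s, freqNormSq j (η s) ∂histMeasure g := by
    rw [eLpNorm_two_sq]
    refine lintegral_congr_ae ?_
    filter_upwards [hw] with s hs using hs.enorm_sq
  have hder : IsHistDeriv g j η ζ := by
    refine ⟨⟨hmeas, lt_top_iff_ne_top.2 fun h => htop ?_⟩, hw⟩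
    rw [← heq, h]
    simp
  rw [← heq]
  gcongr
  exact iInf₂_le ζ hder

end Multiplier

end TimoshenkoCattaneo

namespace TimoshenkoCattaneo

/-! ### From the weak equations to differential equations in `L²` -/

section Strong

open scoped FourierTransform

/-- The pairing of `L²` functions with a Schwartz function. -/
noncomputable def pairing (ψ : 𝓢(ℝ, ℂ)) : L2 →L[ℂ] ℂ :=
  (PointwiseConvergenceCLM.evalCLM (RingHom.id ℂ) ℂ ψ).comp
    (Lp.toTemperedDistributionCLM ℂ volume 2)

lemma pairing_apply (ψ : 𝓢(ℝ, ℂ)) (f : L2) : pairing ψ f = distr f ψ := rfl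

lemma pairing_eq_integral (ψ : 𝓢(ℝ, ℂ)) (f : L2) : pairing ψ f = ∫ x, ψ x * f x := by
  rw [pairing_apply]
  simp

lemma eq_of_pairing_eq {f h : L2} (hfh : ∀ ψ, pairing ψ f = pairing ψ h) : f = h := by
  have h1 : Lp.toTemperedDistributionCLM ℂ volume 2 f
      = Lp.toTemperedDistributionCLM ℂ volume 2 h := by
    ext ψ
    exact hfh ψ
  exact LinearMap.ker_eq_bot.1
    (Lp.ker_toTemperedDistributionCLM_eq_bot (F := ℂ) (μ := (volume : Measure ℝ)) (p := 2)) h1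

/-- The primitive of a function that is continued by a constant to negative times. -/
lemma exists_primitive {E : Type*} [NormedAddCommGroup E] [NormedSpace ℝ E] [CompleteSpace E]
    {y : ℝ → E} (hy : ContinuousOn y (Ici 0)) :
    ∃ Y : ℝ → E, Y 0 = 0 ∧ ∀ t, HasDerivAt Y (y (max t 0)) t := by
  have hmax : Continuous fun t => y (max t 0) :=
    hy.comp_continuous (by fun_prop) fun t => le_max_right t 0
  exact ⟨fun t => ∫ r in (0 : ℝ)..t, y (max r 0), by simp, fun t =>
    intervalIntegral.integral_hasDerivAt_right (hmax.intervalIntegrable _ _)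
      (hmax.stronglyMeasurableAtFilter _ _) hmax.continuousAt⟩

/-- A continuous function with a continuous weak derivative is continuously differentiable. -/
lemma hasDerivWithinAt_of_weak {X Z : ℝ → L2} (hX : ContinuousOn X (Ici 0))
    (hZ : ContinuousOn Z (Ici 0))
    (h : ∀ (ψ : 𝓢(ℝ, ℂ)) (t : ℝ), 0 ≤ t →
      HasTimeDeriv (fun r => pairing ψ (X r)) (pairing ψ (Z t)) t) {t : ℝ} (ht : 0 ≤ t) :
    HasDerivWithinAt X (Z t) (Ici 0) t := by
  obtain ⟨I, hI0, hId⟩ := exists_primitive hZ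
  have key : ∀ t, 0 ≤ t → X t = X 0 + I t := by
    intro t ht
    refine eq_of_pairing_eq fun ψ => ?_
    have hc : ContinuousOn (fun r => pairing ψ (X r) - pairing ψ (I r)) (Icc 0 t) := by
      refine ContinuousOn.sub ?_ ?_
      · exact (pairing ψ).continuous.comp_continuousOn (hX.mono Icc_subset_Ici_self)
      · exact ((pairing ψ).continuous.comp
          (continuous_iff_continuousAt.2 fun r => (hId r).continuousAt)).continuousOn
    have hd : ∀ r ∈ Ico 0 t, HasDerivWithinAt (fun r => pairing ψ (X r) - pairing ψ (I r)) 0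
        (Ici r) r := by
      intro r hr
      have h1 : HasDerivWithinAt (fun r => pairing ψ (X r)) (pairing ψ (Z r)) (Ici r) r :=
        HasDerivWithinAt.mono (h ψ r hr.1) (Ici_subset_Ici.2 hr.1)
      have h2 : HasDerivAt (fun r => pairing ψ (I r)) (pairing ψ (Z r)) r := by
        have := ((pairing ψ).restrictScalars ℝ).hasFDerivAt.comp_hasDerivAt r (hId r)
        rw [max_eq_left hr.1] at this
        exact this
      simpa using h1.fun_sub h2.hasDerivWithinAt
    have h3 := constant_of_has_deriv_right_zero hc hd t ⟨ht, le_rfl⟩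
    rw [hI0, map_zero, sub_zero] at h3
    rw [map_add, ← h3]
    ring
  have h5 : HasDerivWithinAt (fun t => X 0 + I t) (Z t) (Ici 0) t := by
    have := (hId t).const_add (X 0)
    rw [max_eq_left ht] at this
    exact this.hasDerivWithinAt
  exact h5.congr (fun r hr => key r hr) (key t ht)

lemma hasDerivAt_of_weak {X Z : ℝ → L2} (hX : ContinuousOn X (Ici 0))
    (hZ : ContinuousOn Z (Ici 0))
    (h : ∀ (ψ : 𝓢(ℝ, ℂ)) (t : ℝ), 0 ≤ t →
      HasTimeDeriv (fun r => pairing ψ (X r)) (pairing ψ (Z t)) t) {t : ℝ} (ht : 0 < t) :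
    HasDerivAt X (Z t) t :=
  (hasDerivWithinAt_of_weak hX hZ h ht.le).hasDerivAt (Ici_mem_nhds ht)

/-- A weight which makes the multiplication by `symb ^ 2` bounded. -/
noncomputable def damp (x : ℝ) : ℂ := (((1 + ‖x‖ ^ 2) ^ (-1 : ℝ) : ℝ) : ℂ)

lemma damp_hasTemperateGrowth : damp.HasTemperateGrowth := by
  have := Function.hasTemperateGrowth_one_add_norm_sq_rpow ℝ (-1)
  unfold damp
  fun_prop

lemma damp_eq (x : ℝ) : damp x = (((1 + x ^ 2)⁻¹ : ℝ) : ℂ) := by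
  rw [damp, Real.rpow_neg_one, Real.norm_eq_abs, sq_abs]

lemma damp_ne_zero (x : ℝ) : damp x ≠ 0 := by
  rw [damp_eq]
  have : 0 < 1 + x ^ 2 := by positivity
  exact_mod_cast (inv_pos.2 this).ne'

lemma continuous_damp : Continuous damp := damp_hasTemperateGrowth.1.continuous

lemma memLp_top_symb_pow_mul_damp {j : ℕ} (hj : j ≤ 2) :
    MemLp (fun x => symb x ^ j * damp x) ∞ volume := by
  refine memLp_top_of_measurable_of_bound (((continuous_symb.pow j).mul continuous_damp).measurable)
    ((1 + 2 * Real.pi) ^ 2) fun x => ?_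
  have hpi := Real.pi_pos
  have h1 : 0 < 1 + x ^ 2 := by positivity
  rw [norm_mul, norm_pow, norm_symb, damp_eq, Complex.norm_real,
    Real.norm_of_nonneg (by positivity), ← div_eq_mul_inv, div_le_iff₀ h1]
  have h2 : (2 * Real.pi * |x|) ^ j ≤ (1 + 2 * Real.pi * |x|) ^ 2 := by
    calc (2 * Real.pi * |x|) ^ j ≤ (1 + 2 * Real.pi * |x|) ^ j := by gcongr; linarith
      _ ≤ (1 + 2 * Real.pi * |x|) ^ 2 := pow_le_pow_right₀ (by
          have : 0 ≤ 2 * Real.pi * |x| := by positivity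
          linarith) hj
  refine h2.trans ?_
  have h3 := sq_abs x
  nlinarith [sq_nonneg (|x| - 1), abs_nonneg x, sq_nonneg (2 * Real.pi - |x|),
    sq_nonneg (2 * Real.pi * |x| - 1)]

/-- Testing with Schwartz functions of the form `𝓕 (damp · ψ)` amounts to testing the weighted
Fourier transform. -/
lemma iterate_dx_distr_damp {j : ℕ} (hj : j ≤ 2) (f : L2) (ψ : 𝓢(ℝ, ℂ)) :
    (dx^[j] (distr f)) (𝓕 (SchwartzMap.smulLeftCLM ℂ damp ψ))
      = pairing ψ (multiplier _ (memLp_top_symb_pow_mul_damp hj) (𝓕 f : L2)) := by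
  rw [iterate_dx_distr_fourier, pairing_eq_integral]
  refine integral_congr_ae ?_
  filter_upwards [coeFn_multiplier (memLp_top_symb_pow_mul_damp hj) (𝓕 f : L2)] with x hx
  rw [hx, SchwartzMap.smulLeftCLM_apply_apply damp_hasTemperateGrowth, smul_eq_mul]
  ring

end Strong

end TimoshenkoCattaneo

namespace TimoshenkoCattaneo

/-! ### Restriction to a frequency shell -/

section Shell

open scoped FourierTransform RealInnerProductSpace

/-- The frequencies at which the symbol of `∂ₓ` has modulus in `[R, 2R)`. -/
def shell (R : ℝ) : Set ℝ := {x | R ≤ ‖symb x‖ ∧ ‖symb x‖ < 2 * R}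

lemma measurableSet_shell (R : ℝ) : MeasurableSet (shell R) :=
  (measurableSet_le measurable_const continuous_symb.norm.measurable).inter
    (measurableSet_lt continuous_symb.norm.measurable measurable_const)

lemma memLp_top_indicator_shell (R : ℝ) {b : ℝ → ℂ} (hb : Continuous b) (K : ℝ)
    (hK : ∀ x ∈ shell R, ‖b x‖ ≤ K) : MemLp ((shell R).indicator b) ∞ volume := by
  refine memLp_top_of_measurable_of_bound (hb.measurable.indicator (measurableSet_shell R))
    (max K 0) fun x => ?_
  by_cases hx : x ∈ shell R
  · rw [indicator_of_mem hx]
    exact (hK x hx).trans (le_max_left _ _)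
  · rw [indicator_of_notMem hx, norm_zero]
    exact le_max_right _ _

lemma memLp_top_indicator_one (R : ℝ) : MemLp ((shell R).indicator fun _ => (1 : ℂ)) ∞ volume :=
  memLp_top_indicator_shell R continuous_const 1 (by simp)

/-- The Fourier transform restricted to a shell. -/
noncomputable def shellFourier (R : ℝ) : L2 →L[ℂ] L2 :=
  (multiplier _ (memLp_top_indicator_one R)).comp (FourierTransform.fourierCLM ℂ L2)

lemma coeFn_shellFourier (R : ℝ) (f : L2) :
    shellFourier R f =ᵐ[volume] (shell R).indicator (𝓕 f : L2) := by
  filter_upwards [coeFn_multiplier (memLp_top_indicator_one R) (𝓕 f : L2)] with x hx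
  change (multiplier _ (memLp_top_indicator_one R) (𝓕 f : L2)) x = _
  rw [hx]
  by_cases h : x ∈ shell R <;> simp [h]

/-- The symbol of `∂ₓ` on a shell, extended by `iR` outside. The extension makes the operator
bounded and boundedly invertible on the whole space. -/
noncomputable def shellSymb (R : ℝ) (x : ℝ) : ℂ :=
  Complex.I * ((R + (shell R).indicator (fun x => 2 * Real.pi * x - R) x : ℝ) : ℂ)

lemma shellSymb_of_mem {R x : ℝ} (hx : x ∈ shell R) : shellSymb R x = symb x := by
  rw [shellSymb, indicator_of_mem hx, symb]
  push_cast
  ring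

lemma norm_shellSymb {R : ℝ} (hR : 0 < R) (x : ℝ) :
    R ≤ ‖shellSymb R x‖ ∧ ‖shellSymb R x‖ ≤ 2 * R := by
  by_cases hx : x ∈ shell R
  · rw [shellSymb_of_mem hx]
    exact ⟨hx.1, hx.2.le⟩
  · rw [shellSymb, indicator_of_notMem hx, add_zero]
    simp only [norm_mul, Complex.norm_I, Complex.norm_real, Real.norm_of_nonneg hR.le, one_mul]
    exact ⟨le_rfl, by linarith⟩

lemma memLp_top_shellSymb {R : ℝ} (hR : 0 < R) : MemLp (shellSymb R) ∞ volume := by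
  refine memLp_top_of_measurable_of_bound ?_ (2 * R) fun x => (norm_shellSymb hR x).2
  unfold shellSymb
  exact (Complex.measurable_ofReal.comp (((by fun_prop : Measurable fun x : ℝ =>
    2 * Real.pi * x - R).indicator (measurableSet_shell R)).const_add R)).const_mul _

/-- The derivative `∂ₓ` on a shell, seen on the Fourier side. -/
noncomputable def shellDeriv {R : ℝ} (hR : 0 < R) : L2 →L[ℂ] L2 :=
  multiplier _ (memLp_top_shellSymb hR)

lemma inner_shellDeriv {R : ℝ} (hR : 0 < R) (f h : L2) :
    ⟪shellDeriv hR f, h⟫ = -⟪f, shellDeriv hR h⟫ := by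
  rw [L2.inner_def, L2.inner_def, ← integral_neg]
  refine integral_congr_ae ?_
  filter_upwards [coeFn_multiplier (memLp_top_shellSymb hR) f,
    coeFn_multiplier (memLp_top_shellSymb hR) h] with x h1 h2
  rw [shellDeriv, h1, h2, shellSymb]
  simp only [Complex.inner, map_mul, Complex.conj_I, Complex.conj_ofReal, Complex.mul_re,
    Complex.mul_im, Complex.I_re, Complex.I_im, Complex.ofReal_re, Complex.ofReal_im,
    Complex.conj_re, Complex.conj_im, Complex.neg_re, Complex.neg_im]
  ring

lemma norm_shellDeriv {R : ℝ} (hR : 0 < R) (f : L2) :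
    R * ‖f‖ ≤ ‖shellDeriv hR f‖ ∧ ‖shellDeriv hR f‖ ≤ 2 * R * ‖f‖ := by
  have h := coeFn_multiplier (memLp_top_shellSymb hR) f
  constructor
  · have h1 : ‖f‖ ≤ R⁻¹ * ‖shellDeriv hR f‖ := by
      refine Lp.norm_le_mul_norm_of_ae_le_mul ?_
      filter_upwards [h] with x hx
      rw [shellDeriv, hx, norm_mul, inv_mul_eq_div, le_div_iff₀ hR, mul_comm]
      exact mul_le_mul_of_nonneg_right (norm_shellSymb hR x).1 (norm_nonneg _)
    rwa [inv_mul_eq_div, le_div_iff₀ hR, mul_comm] at h1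
  · refine Lp.norm_le_mul_norm_of_ae_le_mul ?_
    filter_upwards [h] with x hx
    rw [shellDeriv, hx, norm_mul]
    exact mul_le_mul_of_nonneg_right (norm_shellSymb hR x).2 (norm_nonneg _)

lemma memLp_top_undamp (R : ℝ) : MemLp ((shell R).indicator fun x => (damp x)⁻¹) ∞ volume := by
  refine memLp_top_indicator_shell R (continuous_damp.inv₀ damp_ne_zero) (1 + (2 * R) ^ 2)
    fun x hx => ?_
  have h1 := hx.2
  rw [norm_symb] at h1
  have h2 : |x| ≤ 2 * R := by
    have := Real.pi_gt_three
    nlinarith [abs_nonneg x]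
  have h3 : (0 : ℝ) ≤ (1 + x ^ 2)⁻¹ := by positivity
  rw [damp_eq, norm_inv, Complex.norm_real, Real.norm_of_nonneg h3, inv_inv, ← sq_abs]
  have := pow_le_pow_left₀ (abs_nonneg x) h2 2
  linarith

/-- On a shell the damping can be undone by a bounded multiplier. -/
lemma undamp_multiplier {R : ℝ} (hR : 0 < R) {j : ℕ} (hj : j ≤ 2) (f : L2) :
    multiplier _ (memLp_top_undamp R) (multiplier _ (memLp_top_symb_pow_mul_damp hj) (𝓕 f : L2))
      = (shellDeriv hR)^[j] (shellFourier R f) := by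
  have h2 : ∀ j, ((shellDeriv hR)^[j] (shellFourier R f) : L2)
      =ᵐ[volume] fun x => symb x ^ j * (shell R).indicator (𝓕 f : L2) x := by
    intro j
    induction j with
    | zero =>
      filter_upwards [coeFn_shellFourier R f] with x hx
      simp [hx]
    | succ j ih =>
      rw [Function.iterate_succ_apply']
      filter_upwards [ih, coeFn_multiplier (memLp_top_shellSymb hR)
        ((shellDeriv hR)^[j] (shellFourier R f))] with x h3 h4
      change (multiplier _ (memLp_top_shellSymb hR) _ : L2) x = _
      rw [h4, h3]
      by_cases hx : x ∈ shell R
      · rw [shellSymb_of_mem hx]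
        ring
      · simp [hx]
  refine Lp.ext ?_
  filter_upwards [h2 j, coeFn_multiplier (memLp_top_undamp R)
    (multiplier _ (memLp_top_symb_pow_mul_damp hj) (𝓕 f : L2)),
    coeFn_multiplier (memLp_top_symb_pow_mul_damp hj) (𝓕 f : L2)] with x e1 e2 e3
  rw [e1, e2, e3]
  by_cases hx : x ∈ shell R
  · rw [indicator_of_mem hx, indicator_of_mem hx]
    have := damp_ne_zero x
    field_simp
  · simp [hx]

/-- A weak evolution equation with at most two derivatives is a differential equation in `L²` on a
frequency shell. -/
lemma hasDerivAt_shellFourier {R : ℝ} (hR : 0 < R) {X A₀ A₁ A₂ : ℝ → L2}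
    (hX : ContinuousOn X (Ici 0)) (h₀ : ContinuousOn A₀ (Ici 0)) (h₁ : ContinuousOn A₁ (Ici 0))
    (h₂ : ContinuousOn A₂ (Ici 0))
    (h : ∀ (φ : 𝓢(ℝ, ℂ)) (t : ℝ), 0 ≤ t → HasTimeDeriv (fun r => distr (X r) φ)
      (distr (A₀ t) φ + dx (distr (A₁ t)) φ + dx (dx (distr (A₂ t))) φ) t) {t : ℝ} (ht : 0 < t) :
    HasDerivAt (fun r => shellFourier R (X r)) (shellFourier R (A₀ t)
      + shellDeriv hR (shellFourier R (A₁ t))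
      + shellDeriv hR (shellDeriv hR (shellFourier R (A₂ t)))) t := by
  set D : ∀ j : ℕ, j ≤ 2 → L2 →L[ℂ] L2 := fun j hj =>
    (multiplier _ (memLp_top_symb_pow_mul_damp hj)).comp (FourierTransform.fourierCLM ℂ L2) with hD
  have hDapp : ∀ j (hj : j ≤ 2) (f : L2), D j hj f
      = multiplier _ (memLp_top_symb_pow_mul_damp hj) (𝓕 f : L2) := fun _ _ _ => rfl
  have main : HasDerivAt (fun r => D 0 zero_le_two (X r)) (D 0 zero_le_two (A₀ t)
      + D 1 one_le_two (A₁ t) + D 2 le_rfl (A₂ t)) t := by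
    refine hasDerivAt_of_weak (Z := fun t => D 0 zero_le_two (A₀ t)
      + D 1 one_le_two (A₁ t) + D 2 le_rfl (A₂ t)) ?_ ?_ (fun ψ t ht => ?_) ht
    · exact (D 0 zero_le_two).continuous.comp_continuousOn hX
    · exact (((D 0 zero_le_two).continuous.comp_continuousOn h₀).add
        ((D 1 one_le_two).continuous.comp_continuousOn h₁)).add
        ((D 2 le_rfl).continuous.comp_continuousOn h₂)
    · have := h (𝓕 (SchwartzMap.smulLeftCLM ℂ damp ψ)) t ht
      have e0 := fun f : L2 => iterate_dx_distr_damp zero_le_two f ψ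
      have e1 : ∀ f : L2, dx (distr f) (𝓕 (SchwartzMap.smulLeftCLM ℂ damp ψ))
          = pairing ψ (multiplier _ (memLp_top_symb_pow_mul_damp one_le_two) (𝓕 f : L2)) :=
        fun f => iterate_dx_distr_damp one_le_two f ψ
      have e2 := fun f : L2 => iterate_dx_distr_damp (le_refl 2) f ψ
      simp only [Function.iterate_zero_apply, Function.iterate_succ_apply] at e0 e2
      simp only [e0, e1, e2] at this
      simpa only [map_add, hDapp] using this
  have u0 := fun f : L2 => undamp_multiplier hR zero_le_two f
  have u1 := fun f : L2 => undamp_multiplier hR one_le_two f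
  have u2 := fun f : L2 => undamp_multiplier hR (le_refl 2) f
  have hfin := ((multiplier _ (memLp_top_undamp R)).restrictScalars ℝ).hasFDerivAt.comp_hasDerivAt
    t main
  simp only [Function.comp_def, ContinuousLinearMap.coe_restrictScalars', map_add, hDapp] at hfin
  rw [u0, u1, u2] at hfin
  refine (hfin.congr_of_eventuallyEq (Eventually.of_forall fun r => ?_))
  exact (u0 (X r)).symm

end Shell

end TimoshenkoCattaneo

namespace TimoshenkoCattaneo

/-! ### The weighted measure of the history space -/

section HistMeasure

variable {P : Params} {g : ℝ → ℝ}

lemma IsKernel.aemeasurable (hg : IsKernel P g) : AEMeasurable g (volume.restrict (Ioi 0)) :=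
  hg.continuousOn.aemeasurable measurableSet_Ioi

lemma IsKernel.ae_nonneg (hg : IsKernel P g) : ∀ᵐ s ∂(volume.restrict (Ioi (0 : ℝ))), 0 ≤ g s :=
  (ae_restrict_iff' measurableSet_Ioi).2 (ae_of_all _ fun s hs => hg.nonneg s hs)

lemma IsKernel.isFiniteMeasure (hg : IsKernel P g) : IsFiniteMeasure (histMeasure g) :=
  isFiniteMeasure_withDensity_ofReal hg.integrableOn.2

lemma IsKernel.integral_histMeasure (hg : IsKernel P g) {E : Type*} [NormedAddCommGroup E]
    [NormedSpace ℝ E] (f : ℝ → E) :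
    ∫ s, f s ∂histMeasure g = ∫ s in Ioi 0, g s • f s := by
  rw [histMeasure, integral_withDensity_eq_integral_toReal_smul₀ hg.aemeasurable.ennreal_ofReal
    (ae_of_all _ fun s => ENNReal.ofReal_lt_top)]
  refine integral_congr_ae ?_
  filter_upwards [hg.ae_nonneg] with s hs
  rw [ENNReal.toReal_ofReal hs]

lemma IsKernel.integrable_histMeasure_iff (hg : IsKernel P g) {E : Type*} [NormedAddCommGroup E]
    [NormedSpace ℝ E] {f : ℝ → E} :
    Integrable f (histMeasure g) ↔ IntegrableOn (fun s => g s • f s) (Ioi 0) := by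
  rw [histMeasure, integrable_withDensity_iff_integrable_smul₀' hg.aemeasurable.ennreal_ofReal
    (ae_of_all _ fun s => ENNReal.ofReal_lt_top)]
  refine integrable_congr ?_
  filter_upwards [hg.ae_nonneg] with s hs
  rw [ENNReal.toReal_ofReal hs]

lemma histMeasure_eq_zero (h : ∀ s, 0 < s → g s = 0) : histMeasure g = 0 := by
  rw [histMeasure, withDensity_eq_zero_iff]
  · refine (ae_restrict_iff' measurableSet_Ioi).2 (ae_of_all _ fun s hs => ?_)
    simp [h s hs]
  · refine (aemeasurable_congr (g := fun _ => 0) ?_).2 aemeasurable_const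
    refine (ae_restrict_iff' measurableSet_Ioi).2 (ae_of_all _ fun s hs => ?_)
    simp [h s hs]

lemma histMeasure_absolutelyContinuous : histMeasure g ≪ volume.restrict (Ioi (0 : ℝ)) :=
  withDensity_absolutelyContinuous _ _

/-- Integration against a bounded function with bounded support is continuous on the history
space, since a positive kernel is bounded below on bounded sets. -/
lemma IsKernel.integrableOn_smul (hg : IsKernel P g) (hpos : ∀ s, 0 < s → 0 < g s) {E : Type*}
    [NormedAddCommGroup E] [NormedSpace ℝ E] {w : ℝ → ℝ} {S R : ℝ} (hR : 0 < R) (hw : Measurable w)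
    (hS : ∀ s, |w s| ≤ S) (hsupp : ∀ s, R < s → w s = 0) {f : ℝ → E}
    (hf : Integrable f (histMeasure g)) :
    IntegrableOn (fun s => w s • f s) (Ioi 0) ∧
      ‖∫ s in Ioi 0, w s • f s‖ ≤ S / g R * ∫ s, ‖f s‖ ∂histMeasure g := by
  have hS0 : 0 ≤ S := (abs_nonneg _).trans (hS 0)
  have hgR := hpos R hR
  have hbd : ∀ s, 0 < s → |(g s)⁻¹ * w s| ≤ S / g R := fun s hs => by
    by_cases hsR : R < s
    · rw [hsupp s hsR, mul_zero, abs_zero]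
      positivity
    · have h1 : g R ≤ g s := hg.antitoneOn (mem_Ioi.2 hs) (mem_Ioi.2 hR) (not_lt.1 hsR)
      rw [abs_mul, abs_inv, abs_of_pos (hpos s hs), inv_mul_eq_div]
      exact div_le_div₀ hS0 (hS s) hgR h1
  have hae : ∀ᵐ s ∂histMeasure g, ‖(g s)⁻¹ * w s‖ ≤ S / g R :=
    histMeasure_absolutelyContinuous.ae_le
      ((ae_restrict_iff' measurableSet_Ioi).2 (ae_of_all _ fun s hs => hbd s hs))
  have hmeas : AEStronglyMeasurable (fun s => (g s)⁻¹ * w s) (histMeasure g) :=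
    ((hg.aemeasurable.inv.mul hw.aemeasurable).mono_ac
      histMeasure_absolutelyContinuous).aestronglyMeasurable
  have hint : Integrable (fun s => ((g s)⁻¹ * w s) • f s) (histMeasure g) :=
    hf.bdd_smul (S / g R) hmeas hae
  have hcongr : ∀ s ∈ Ioi (0 : ℝ), g s • (((g s)⁻¹ * w s) • f s) = w s • f s := fun s hs => by
    rw [smul_smul, ← mul_assoc, mul_inv_cancel₀ (hpos s hs).ne', one_mul]
  refine ⟨(hg.integrable_histMeasure_iff.1 hint).congr_fun hcongr measurableSet_Ioi, ?_⟩
  rw [← setIntegral_congr_fun measurableSet_Ioi hcongr, ← hg.integral_histMeasure,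
    ← integral_const_mul]
  refine norm_integral_le_of_norm_le (hf.norm.const_mul _) ?_
  filter_upwards [hae] with s hs
  rw [norm_smul]
  exact mul_le_mul_of_nonneg_right hs (norm_nonneg _)

lemma IsKernel.integrableOn_Ioc (hg : IsKernel P g) (hpos : ∀ s, 0 < s → 0 < g s) {E : Type*}
    [NormedAddCommGroup E] [NormedSpace ℝ E] {f : ℝ → E} (hf : Integrable f (histMeasure g))
    (R : ℝ) : IntegrableOn f (Ioc 0 R) := by
  rcases le_or_gt R 0 with hR | hR
  · simp [Ioc_eq_empty_of_le hR]
  · have h := (hg.integrableOn_smul hpos (w := (Ioc 0 R).indicator fun _ => 1) (S := 1) hR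
      (measurable_const.indicator measurableSet_Ioc) (fun s => ?_) (fun s hs => ?_) hf).1
    · have h2 := h.mono_set (Ioc_subset_Ioi_self (a := R) (b := (0 : ℝ)))
      refine h2.congr_fun (fun s hs => ?_) measurableSet_Ioc
      simp [indicator_of_mem hs]
    · by_cases hs : s ∈ Ioc 0 R
      · simp [indicator_of_mem hs]
      · simp [indicator_of_notMem hs]
    · exact indicator_of_notMem (fun h => absurd h.2 (not_le.2 hs)) _

end HistMeasure

end TimoshenkoCattaneo

namespace TimoshenkoCattaneo

/-! ### The transport equation of the history -/

section Transport

variable {P : Params} {g : ℝ → ℝ} {E : Type*} [NormedAddCommGroup E] [NormedSpace ℝ E]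

/-- A test function is, together with its derivative, bounded and globally Lipschitz; hence its
first order Taylor remainder is quadratic, uniformly. -/
lemma exists_testFunction_bounds {w : ℝ → ℝ} (hw : ContDiff ℝ (⊤ : ℕ∞) w)
    (hc : HasCompactSupport w) :
    ∃ S ≥ 0, ∃ M > 0, (∀ s, M < s → w s = 0) ∧ (∀ s, |w s| ≤ S) ∧ (∀ s, |deriv w s| ≤ S) ∧
      (∀ x y, |w y - w x| ≤ S * |y - x|) ∧
      ∀ x y, |w y - w x - deriv w x * (y - x)| ≤ S * |y - x| ^ 2 := by
  have hw' : ContDiff ℝ (⊤ : ℕ∞) (deriv w) := (contDiff_infty_iff_deriv.1 hw).2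
  have hw'' : ContDiff ℝ (⊤ : ℕ∞) (deriv (deriv w)) := (contDiff_infty_iff_deriv.1 hw').2
  obtain ⟨S₀, h₀⟩ := hw.continuous.bounded_above_of_compact_support hc
  obtain ⟨S₁, h₁⟩ := hw'.continuous.bounded_above_of_compact_support hc.deriv
  obtain ⟨S₂, h₂⟩ := hw''.continuous.bounded_above_of_compact_support hc.deriv.deriv
  obtain ⟨M, hM⟩ := hc.isCompact.isBounded.subset_closedBall 0
  have hd : Differentiable ℝ w := hw.differentiable (by simp)
  have hd' : Differentiable ℝ (deriv w) := hw'.differentiable (by simp)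
  have L0 : ∀ x y, |w y - w x| ≤ S₁ * |y - x| := fun x y =>
    convex_univ.norm_image_sub_le_of_norm_deriv_le (fun z _ => hd z) (fun z _ => h₁ z)
      (mem_univ x) (mem_univ y)
  have L1 : ∀ x y, |deriv w y - deriv w x| ≤ S₂ * |y - x| := fun x y =>
    convex_univ.norm_image_sub_le_of_norm_deriv_le (fun z _ => hd' z) (fun z _ => h₂ z)
      (mem_univ x) (mem_univ y)
  have S2 : 0 ≤ S₂ := (norm_nonneg _).trans (h₂ 0)
  have S1 : 0 ≤ S₁ := (norm_nonneg _).trans (h₁ 0)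
  have S0 : 0 ≤ S₀ := (norm_nonneg _).trans (h₀ 0)
  refine ⟨S₀ + S₁ + S₂, by positivity, |M| + 1, by positivity, fun s hs => ?_,
    fun s => (h₀ s).trans (by linarith), fun s => (h₁ s).trans (by linarith),
    fun x y => (L0 x y).trans (mul_le_mul_of_nonneg_right (by linarith) (abs_nonneg _)),
    fun x y => ?_⟩
  · by_contra h
    have h3 := hM (subset_tsupport w h)
    rw [mem_closedBall_zero_iff, Real.norm_eq_abs] at h3
    linarith [le_abs_self s, le_abs_self M]
  · have hdz : ∀ z ∈ uIcc x y, HasDerivWithinAt (fun z => w z - deriv w x * z)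
        (deriv w z - deriv w x) (uIcc x y) z := fun z _ => by
      have := (hd z).hasDerivAt.fun_sub ((hasDerivAt_id z).const_mul (deriv w x))
      simpa using this.hasDerivWithinAt
    have h3 := (convex_uIcc x y).norm_image_sub_le_of_norm_hasDerivWithin_le
      (C := S₂ * |y - x|) hdz (fun z hz => (L1 x z).trans
        (mul_le_mul_of_nonneg_left (abs_sub_left_of_mem_uIcc hz) S2)) left_mem_uIcc right_mem_uIcc
    rw [Real.norm_eq_abs, Real.norm_eq_abs] at h3
    calc |w y - w x - deriv w x * (y - x)|
        = |w y - deriv w x * y - (w x - deriv w x * x)| := by congr 1; ring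
      _ ≤ S₂ * |y - x| * |y - x| := h3
      _ = S₂ * |y - x| ^ 2 := by ring
      _ ≤ (S₀ + S₁ + S₂) * |y - x| ^ 2 := mul_le_mul_of_nonneg_right (by linarith) (by positivity)

/-- The weak form of the transport equation `F_t + F_s = y`, `F(·, 0) = 0`, for a continuous curve
`F` in the weighted space `L¹((0, ∞), g(s) ds)`. -/
structure IsTransportSolution (g : ℝ → ℝ) (F : ℝ → ℝ → E) (y : ℝ → E) : Prop where
  integrable : ∀ t, 0 ≤ t → Integrable (F t) (histMeasure g)
  continuous : ∀ t, 0 ≤ t →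
    Tendsto (fun r => ∫ s, ‖F r s - F t s‖ ∂histMeasure g) (𝓝[Ici 0] t) (𝓝 0)
  continuous_source : ContinuousOn y (Ici 0)
  hasDerivWithinAt : ∀ w : ℝ → ℝ, ContDiff ℝ (⊤ : ℕ∞) w → HasCompactSupport w → ∀ t, 0 ≤ t →
    HasDerivWithinAt (fun r => ∫ s in Ioi (0 : ℝ), w s • F r s)
      ((∫ s in Ioi (0 : ℝ), deriv w s • F t s) + (∫ s in Ioi (0 : ℝ), w s) • y t) (Ici 0) t

variable {F : ℝ → ℝ → E} {y : ℝ → E}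

/-- Testing with a function that moves along the characteristics removes the transport term. -/
lemma IsTransportSolution.hasDerivWithinAt_shift (hF : IsTransportSolution g F y)
    (hg : IsKernel P g) (hpos : ∀ s, 0 < s → 0 < g s) {w : ℝ → ℝ}
    (hw : ContDiff ℝ (⊤ : ℕ∞) w) (hc : HasCompactSupport w) {T t : ℝ} (ht : 0 ≤ t) (htT : t ≤ T) :
    HasDerivWithinAt (fun r => ∫ s in Ioi (0 : ℝ), w (s + (T - r)) • F r s)
      ((∫ s in Ioi (0 : ℝ), w (s + (T - t))) • y t) (Ici 0) t := by
  obtain ⟨S, hS, M, hM, hsupp, -, hSd, hlip, htay⟩ := exists_testFunction_bounds hw hc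
  set R := M + 1 with hR
  have hR0 : 0 < R := by linarith
  have hgR := hpos R hR0
  have hsupp' : ∀ r < T + 1, ∀ s, R < s → w (s + (T - r)) = 0 := fun r hr s hs =>
    hsupp _ (by linarith)
  have hsuppd : ∀ s, R < s → deriv w (s + (T - t)) = 0 := fun s hs => by
    have : w =ᶠ[𝓝 (s + (T - t))] fun _ => 0 := by
      filter_upwards [lt_mem_nhds (show M < s + (T - t) by linarith)] with x hx
      exact hsupp x hx
    rw [this.deriv_eq, deriv_const]
  have hwm : ∀ r, Measurable fun s => w (s + (T - r)) := fun r => by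
    have := hw.continuous
    exact (by fun_prop : Continuous fun s => w (s + (T - r))).measurable
  have hwd : Measurable fun s => deriv w (s + (T - t)) := by
    have := (hw.continuous_deriv (by simp))
    exact (by fun_prop : Continuous fun s => deriv w (s + (T - t))).measurable
  -- the derivative at a fixed position of the test function
  have h1 : HasDerivWithinAt (fun r => ∫ s in Ioi (0 : ℝ), w (s + (T - t)) • F r s)
      ((∫ s in Ioi (0 : ℝ), deriv w (s + (T - t)) • F t s)
        + (∫ s in Ioi (0 : ℝ), w (s + (T - t))) • y t) (Ici 0) t := by
    have := hF.hasDerivWithinAt (fun s => w (s + (T - t))) (hw.comp (contDiff_id.add contDiff_const))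
      (hc.comp_homeomorph (Homeomorph.addRight (T - t))) t ht
    simpa only [deriv_comp_add_const] using this
  -- the contribution of the motion of the test function
  have h2 : HasDerivWithinAt
      (fun r => ∫ s in Ioi (0 : ℝ), (w (s + (T - r)) - w (s + (T - t))) • F r s)
      (-∫ s in Ioi (0 : ℝ), deriv w (s + (T - t)) • F t s) (Ici 0) t := by
    rw [hasDerivWithinAt_iff_isLittleO]
    set N := ∫ s, ‖F t s‖ ∂histMeasure g with hN
    set ε : ℝ → ℝ := fun r => S / g R * (∫ s, ‖F r s - F t s‖ ∂histMeasure g)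
      + S / g R * (|r - t| * N) with hε
    have hε0 : Tendsto ε (𝓝[Ici 0] t) (𝓝 0) := by
      have e1 : Tendsto (fun r => |r - t|) (𝓝[Ici 0] t) (𝓝 0) := by
        have : Continuous fun r : ℝ => |r - t| := by fun_prop
        simpa using (this.tendsto t).mono_left nhdsWithin_le_nhds
      simpa using ((hF.continuous t ht).const_mul (S / g R)).add
        ((e1.mul_const N).const_mul (S / g R))
    have hbound : ∀ᶠ r in 𝓝[Ici 0] t,
        ‖(∫ s in Ioi (0 : ℝ), (w (s + (T - r)) - w (s + (T - t))) • F r s)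
          - (∫ s in Ioi (0 : ℝ), (w (s + (T - t)) - w (s + (T - t))) • F t s)
          - (r - t) • (-∫ s in Ioi (0 : ℝ), deriv w (s + (T - t)) • F t s)‖
          ≤ ‖ε r * (r - t)‖ := by
      filter_upwards [self_mem_nhdsWithin,
        mem_nhdsWithin_of_mem_nhds (gt_mem_nhds (show t < T + 1 by linarith))] with r hr0 hrT
      have hint := (hF.integrable r hr0).sub (hF.integrable t ht)
      have b1 := hg.integrableOn_smul hpos (w := fun s => w (s + (T - r)) - w (s + (T - t)))
        (S := S * |r - t|) hR0 ((hwm r).sub (hwm t)) (fun s => by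
          refine (hlip _ _).trans (le_of_eq ?_)
          rw [← abs_neg (r - t)]
          congr 2
          ring) (fun s hs => by rw [hsupp' r hrT s hs, hsupp' t (by linarith) s hs, sub_zero]) hint
      have b2 := hg.integrableOn_smul hpos
        (w := fun s => w (s + (T - r)) - w (s + (T - t)) + (r - t) * deriv w (s + (T - t)))
        (S := S * |r - t| ^ 2) hR0 (((hwm r).sub (hwm t)).add (hwd.const_mul _)) (fun s => by
          have := htay (s + (T - t)) (s + (T - r))
          rw [show s + (T - r) - (s + (T - t)) = -(r - t) by ring, abs_neg] at this
          refine le_trans (le_of_eq ?_) this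
          congr 1
          ring) (fun s hs => by
            rw [hsupp' r hrT s hs, hsupp' t (by linarith) s hs, hsuppd s hs]; ring)
        (hF.integrable t ht)
      have b3 := (hg.integrableOn_smul hpos (S := S) hR0 hwd (fun s => hSd _) hsuppd
        (hF.integrable t ht)).1
      have hsum : (∫ s in Ioi (0 : ℝ), (w (s + (T - r)) - w (s + (T - t))) • F r s)
          - (∫ s in Ioi (0 : ℝ), (w (s + (T - t)) - w (s + (T - t))) • F t s)
          - (r - t) • (-∫ s in Ioi (0 : ℝ), deriv w (s + (T - t)) • F t s)
          = (∫ s in Ioi (0 : ℝ), (w (s + (T - r)) - w (s + (T - t))) • (F r - F t) s)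
            + ∫ s in Ioi (0 : ℝ), (w (s + (T - r)) - w (s + (T - t))
              + (r - t) * deriv w (s + (T - t))) • F t s := by
        rw [← integral_add b1.1 b2.1]
        simp only [sub_self, zero_smul, integral_zero, sub_zero, smul_neg, sub_neg_eq_add]
        have b4 : IntegrableOn (fun s => (w (s + (T - r)) - w (s + (T - t))) • F r s) (Ioi 0) := by
          refine ((b1.1.add b2.1).sub (b3.smul (r - t))).congr_fun (fun s _ => ?_) measurableSet_Ioi
          simp only [Pi.add_apply, Pi.sub_apply, Pi.smul_apply]
          module
        have b5 : IntegrableOn (fun s => (r - t) • deriv w (s + (T - t)) • F t s) (Ioi 0) :=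
          b3.smul (r - t)
        rw [← integral_smul, ← integral_add b4 b5]
        refine integral_congr_ae (ae_of_all _ fun s => ?_)
        simp only [Pi.sub_apply]
        module
      rw [hsum]
      have hεn : 0 ≤ ε r := by
        have : 0 ≤ ∫ s, ‖F r s - F t s‖ ∂histMeasure g := integral_nonneg fun _ => norm_nonneg _
        have : 0 ≤ N := integral_nonneg fun _ => norm_nonneg _
        positivity
      rw [norm_mul, Real.norm_of_nonneg hεn, Real.norm_eq_abs]
      refine (norm_add_le_of_le b1.2 b2.2).trans (le_of_eq ?_)
      simp only [hε, Pi.sub_apply]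
      ring
    refine (Asymptotics.IsBigO.of_bound 1 ?_).trans_isLittleO
      ((Asymptotics.isLittleO_one_iff ℝ).2 hε0 |>.mul_isBigO
        (Asymptotics.isBigO_refl (fun r => r - t) _) |>.congr_right fun r => one_mul _)
    filter_upwards [hbound] with r hr
    rw [one_mul]
    exact hr
  have h3 := h1.add h2
  refine (h3.congr_deriv (by abel)).congr_of_eventuallyEq ?_ ?_
  · filter_upwards [self_mem_nhdsWithin,
      mem_nhdsWithin_of_mem_nhds (gt_mem_nhds (show t < T + 1 by linarith))] with r hr0 hrT
    have hwb : ∃ S₀, ∀ s, ‖w s‖ ≤ S₀ := hw.continuous.bounded_above_of_compact_support hc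
    obtain ⟨S₀, h₀⟩ := hwb
    have i1 := (hg.integrableOn_smul hpos hR0 (hwm t) (fun s => h₀ _) (hsupp' t (by linarith))
      (hF.integrable r hr0)).1
    have i2 := (hg.integrableOn_smul hpos hR0 (hwm r) (fun s => h₀ _) (hsupp' r hrT)
      (hF.integrable r hr0)).1
    simp only [Pi.add_apply]
    rw [← integral_add i1 ((i2.sub i1).congr_fun (fun s _ => by
      simp only [Pi.sub_apply, sub_smul]) measurableSet_Ioi)]
    refine integral_congr_ae (ae_of_all _ fun s => ?_)
    simp only
    module
  · simp

end Transport

end TimoshenkoCattaneo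

namespace TimoshenkoCattaneo

section TransportSolution

variable {P : Params} {g : ℝ → ℝ} {E : Type*} [NormedAddCommGroup E] [NormedSpace ℝ E]
  [CompleteSpace E] {F : ℝ → ℝ → E} {y : ℝ → E}

/-- Integration along the characteristics: the solution at time `T`, tested with `w`, in terms of a
primitive `Y` of the source and of the initial history. -/
lemma IsTransportSolution.integral_eq (hF : IsTransportSolution g F y) (hg : IsKernel P g)
    (hpos : ∀ s, 0 < s → 0 < g s) {Y : ℝ → E} (hY0 : Y 0 = 0)
    (hY : ∀ t, HasDerivAt Y (y (max t 0)) t) {w : ℝ → ℝ}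
    (hw : ContDiff ℝ (⊤ : ℕ∞) w) (hc : HasCompactSupport w) {T : ℝ} (hT : 0 ≤ T) :
    ∫ s in Ioi (0 : ℝ), w s • F T s
      = (∫ s in Ioi (0 : ℝ), w s) • Y T - (∫ s in (0 : ℝ)..T, w s • Y (T - s))
        + ∫ s in Ioi (0 : ℝ), w (s + T) • F 0 s := by
  have hwc := hw.continuous
  have hYc : Continuous Y := continuous_iff_continuousAt.2 fun t => (hY t).continuousAt
  have hwi : Integrable w := hwc.integrable_of_hasCompactSupport hc
  set A : ℝ → ℝ := fun t => ∫ s in Ioi (0 : ℝ), w (s + (T - t)) with hA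
  have hAeq : ∀ t, A t = A T - ∫ s in (0 : ℝ)..(T - t), w s := fun t => by
    have e : ∀ c, ∫ s in Ioi (0 : ℝ), w (s + c) = ∫ s in Ioi c, w s := fun c => by
      have := (measurePreserving_add_right volume c).setIntegral_preimage_emb
        (measurableEmbedding_addRight c) w (Ioi c)
      rw [← this]
      congr 2
      ext s
      simp
    simp only [hA, e, sub_self]
    have := intervalIntegral.integral_Ioi_sub_Ioi' (a := 0) (b := T - t) hwi.integrableOn
      hwi.integrableOn
    rw [← this]
    ring
  have hAd : ∀ t, HasDerivAt A (w (T - t)) t := fun t => by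
    have h1 : HasDerivAt (fun c => ∫ s in (0 : ℝ)..c, w s) (w (T - t)) (T - t) :=
      intervalIntegral.integral_hasDerivAt_right (hwc.intervalIntegrable _ _)
        (hwc.stronglyMeasurableAtFilter _ _) hwc.continuousAt
    have h2 : HasDerivAt (fun t => T - t) (-1) t := by
      simpa using (hasDerivAt_id t).const_sub T
    have h3 := (h1.scomp t h2).const_sub (A T)
    rw [neg_smul, one_smul, neg_neg] at h3
    rw [funext hAeq]
    exact h3
  set B : ℝ → E := fun t => ∫ r in (0 : ℝ)..t, w (T - r) • Y r with hB
  have hBd : ∀ t, HasDerivAt B (w (T - t) • Y t) t := fun t => by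
    have hcont : Continuous fun r => w (T - r) • Y r := by fun_prop
    exact intervalIntegral.integral_hasDerivAt_right (hcont.intervalIntegrable _ _)
      (hcont.stronglyMeasurableAtFilter _ _) hcont.continuousAt
  set Φ : ℝ → E := fun r => ∫ s in Ioi (0 : ℝ), w (s + (T - r)) • F r s with hΦ
  have hΦd : ∀ t, 0 ≤ t → t ≤ T → HasDerivWithinAt Φ (A t • y t) (Ici 0) t := fun t h0 hT' =>
    hF.hasDerivWithinAt_shift hg hpos hw hc h0 hT'
  have hd : ∀ t, 0 ≤ t → t ≤ T →
      HasDerivWithinAt (fun t => Φ t - (A t • Y t - B t)) 0 (Ici 0) t := fun t h0 hT' => by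
    have h1 := (hΦd t h0 hT').fun_sub
      (((hAd t).fun_smul (hY t)).fun_sub (hBd t)).hasDerivWithinAt
    rw [max_eq_left h0] at h1
    refine h1.congr_deriv ?_
    abel
  have h4 := constant_of_has_deriv_right_zero (a := 0) (b := T)
    (fun t ht => ((hd t ht.1 ht.2).mono Icc_subset_Ici_self).continuousWithinAt)
    (fun t ht => (hd t ht.1 ht.2.le).mono (Ici_subset_Ici.2 ht.1)) T ⟨hT, le_rfl⟩
  have h5 : B T = ∫ s in (0 : ℝ)..T, w s • Y (T - s) := by
    have := intervalIntegral.integral_comp_sub_left (a := 0) (b := T)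
      (fun s => w s • Y (T - s)) T
    simp only [sub_sub_cancel, sub_self, sub_zero] at this
    exact this
  have h6 : B 0 = 0 := by simp [hB]
  have h7 : Φ T = ∫ s in Ioi (0 : ℝ), w s • F T s := by simp [hΦ]
  have h8 : A T = ∫ s in Ioi (0 : ℝ), w s := by simp [hA]
  have h9 : Φ 0 = ∫ s in Ioi (0 : ℝ), w (s + T) • F 0 s := by simp [hΦ]
  rw [← h7, ← h8, ← h9, ← h5]
  simp only [hY0, h6, smul_zero, sub_zero] at h4
  rw [← h4]
  abel

/-- A solution of the transport equation with source `y` is a difference of values of a primitive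
of `y`, extended to negative times by the initial history. -/
lemma IsTransportSolution.exists_eq_sub (hF : IsTransportSolution g F y) (hg : IsKernel P g)
    (hpos : ∀ s, 0 < s → 0 < g s) :
    ∃ Y : ℝ → E, ContinuousOn Y (Ici 0) ∧ (∀ t, 0 < t → HasDerivAt Y (y t) t) ∧
      ∀ t, 0 ≤ t → ∀ᵐ s ∂histMeasure g, F t s = Y t - Y (t - s) := by
  obtain ⟨I, hI0, hId⟩ := exists_primitive hF.continuous_source
  have hIc : Continuous I := continuous_iff_continuousAt.2 fun t => (hId t).continuousAt
  set Y : ℝ → E := fun r => if 0 ≤ r then I r else -F 0 (-r) with hY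
  have hYI : ∀ r, 0 ≤ r → Y r = I r := fun r hr => if_pos hr
  have hYF : ∀ r, r < 0 → Y r = -F 0 (-r) := fun r hr => if_neg (not_le.2 hr)
  refine ⟨Y, hIc.continuousOn.congr hYI, fun t ht => ?_, fun T hT => ?_⟩
  · have := hId t
    rw [max_eq_left ht.le] at this
    refine this.congr_of_eventuallyEq ?_
    filter_upwards [lt_mem_nhds ht] with r hr using hYI r hr.le
  refine histMeasure_absolutelyContinuous.ae_le ((ae_restrict_iff' measurableSet_Ioi).2 ?_)
  -- integrability of the two pieces of the history
  have hshift : ∀ R, IntegrableOn (fun s => F 0 (s - T)) (Ioc T R) := fun R => by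
    have h1 := hg.integrableOn_Ioc hpos (hF.integrable 0 le_rfl) (R - T)
    rw [← (measurePreserving_sub_right volume T).integrableOn_comp_preimage
      (measurableEmbedding_subRight T)] at h1
    convert! h1 using 1
    ext s
    simp
  have hYloc : ∀ R, IntegrableOn (fun s => Y (T - s)) (Ioc 0 R) := fun R => by
    have hsub : Ioc 0 R ⊆ Icc 0 T ∪ Ioc T R := fun s hs => by
      rcases le_or_gt s T with h | h
      · exact Or.inl ⟨hs.1.le, h⟩
      · exact Or.inr ⟨h, hs.2⟩
    refine IntegrableOn.mono_set (IntegrableOn.union ?_ ?_) hsub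
    · have : Continuous fun s => I (T - s) := by fun_prop
      exact (this.integrableOn_Icc).congr_fun (fun s hs => (hYI _ (sub_nonneg.2 hs.2)).symm)
        measurableSet_Icc
    · refine (hshift R).neg.congr_fun (fun s hs => ?_) measurableSet_Ioc
      rw [hYF _ (sub_neg.2 hs.1), neg_sub]
      rfl
  have hloc : LocallyIntegrableOn (fun s => F T s - (Y T - Y (T - s))) (Ioi 0) := fun s hs => by
    refine ⟨Ioc 0 (s + 1), mem_nhdsWithin_of_mem_nhds
      (Ioc_mem_nhds (mem_Ioi.1 hs) (by linarith)), ?_⟩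
    exact (hg.integrableOn_Ioc hpos (hF.integrable T hT) _).sub
      ((integrableOn_const (by simp)).sub (hYloc _))
  have hzero := isOpen_Ioi.ae_eq_zero_of_integral_contDiff_smul_eq_zero hloc fun w hw hc hsupp => by
    obtain ⟨S, hS, M, hM, hwM, hwS, -⟩ := exists_testFunction_bounds hw hc
    have hwc := hw.continuous
    have hw0 : ∀ s, s ∉ Ioi (0 : ℝ) → w s = 0 := fun s hs => by
      by_contra h
      exact hs (hsupp (subset_tsupport w h))
    rw [← setIntegral_eq_integral_of_forall_compl_eq_zero (s := Ioi 0) fun s hs => by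
      rw [hw0 s hs, zero_smul]]
    have hkey := hF.integral_eq hg hpos hI0 hId hw hc hT
    have i1 := (hg.integrableOn_smul hpos hM hwc.measurable hwS hwM (hF.integrable T hT)).1
    have i2 : IntegrableOn (fun s => w s • Y T) (Ioi 0) :=
      ((hwc.integrable_of_hasCompactSupport hc).smul_const (Y T)).integrableOn
    have i3 : IntegrableOn (fun s => w s • Y (T - s)) (Ioc 0 T) := by
      have : Continuous fun s => w s • I (T - s) := by fun_prop
      refine ((this.integrableOn_Icc (a := 0) (b := T)).mono_set Ioc_subset_Icc_self).congr_fun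
        (fun s hs => ?_) measurableSet_Ioc
      simp only [hYI _ (sub_nonneg.2 hs.2)]
    have i4' : IntegrableOn (fun s => w (s + T) • F 0 s) (Ioi 0) :=
      (hg.integrableOn_smul hpos (w := fun s => w (s + T)) hM
        (by fun_prop : Continuous fun s => w (s + T)).measurable (fun s => hwS _)
        (fun s hs => hwM _ (by linarith)) (hF.integrable 0 le_rfl)).1
    have hpre : (fun s : ℝ => s - T) ⁻¹' Ioi 0 = Ioi T := by ext s; simp
    have i4 : IntegrableOn (fun s => w s • Y (T - s)) (Ioi T) := by
      rw [← (measurePreserving_sub_right volume T).integrableOn_comp_preimage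
        (measurableEmbedding_subRight T), hpre] at i4'
      refine i4'.neg.congr_fun (fun s hs => ?_) measurableSet_Ioi
      simp only [Pi.neg_apply, Function.comp_apply, sub_add_cancel]
      rw [hYF _ (sub_neg.2 hs), neg_sub, smul_neg]
    have e3 : ∫ s in Ioc 0 T, w s • Y (T - s) = ∫ s in (0 : ℝ)..T, w s • I (T - s) := by
      rw [intervalIntegral.integral_of_le hT]
      refine setIntegral_congr_fun measurableSet_Ioc fun s hs => ?_
      simp only [hYI _ (sub_nonneg.2 hs.2)]
    have e4 : ∫ s in Ioi T, w s • Y (T - s) = -∫ s in Ioi (0 : ℝ), w (s + T) • F 0 s := by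
      have := (measurePreserving_sub_right volume T).setIntegral_preimage_emb
        (measurableEmbedding_subRight T) (fun s => w (s + T) • F 0 s) (Ioi 0)
      rw [← this, hpre, ← integral_neg]
      refine setIntegral_congr_fun measurableSet_Ioi fun s hs => ?_
      simp only [sub_add_cancel]
      rw [hYF _ (sub_neg.2 hs), neg_sub, smul_neg]
    have i5 : IntegrableOn (fun s => w s • Y (T - s)) (Ioi 0) := by
      rw [← Ioc_union_Ioi_eq_Ioi hT]
      exact i3.union i4
    have e5 : ∫ s in Ioi (0 : ℝ), w s • Y (T - s) = (∫ s in (0 : ℝ)..T, w s • I (T - s))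
        - ∫ s in Ioi (0 : ℝ), w (s + T) • F 0 s := by
      rw [← Ioc_union_Ioi_eq_Ioi hT, setIntegral_union (Ioc_disjoint_Ioi le_rfl) measurableSet_Ioi
        i3 i4, e3, e4, Ioc_union_Ioi_eq_Ioi hT, sub_eq_add_neg]
    have e6 : ∫ s in Ioi (0 : ℝ), w s • (F T s - (Y T - Y (T - s)))
        = (∫ s in Ioi (0 : ℝ), w s • F T s) - ((∫ s in Ioi (0 : ℝ), w s • Y T)
          - ∫ s in Ioi (0 : ℝ), w s • Y (T - s)) := by
      have i6 : IntegrableOn (fun s => w s • Y T - w s • Y (T - s)) (Ioi 0) := i2.sub i5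
      rw [← integral_sub i2 i5, ← integral_sub i1 i6]
      refine integral_congr_ae (ae_of_all _ fun s => ?_)
      simp only [smul_sub]
    rw [e6, e5, integral_smul_const, hkey, hYI T hT]
    abel
  filter_upwards [hzero] with s hs hs0
  exact sub_eq_zero.1 (hs hs0)

end TransportSolution

end TimoshenkoCattaneo

namespace TimoshenkoCattaneo

/-! ### Solutions on a frequency shell -/

section Solution

open scoped RealInnerProductSpace

variable {P : Params} {g : ℝ → ℝ} {U : ℝ → State}

lemma eLpNorm_le_histDerivNorm (g : ℝ → ℝ) (η : ℝ → L2) :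
    eLpNorm η 2 (histMeasure g) ≤ histDerivNorm g 0 η := by
  refine le_iInf₂ fun ζ hζ => (eLpNorm_congr_ae ?_).le
  filter_upwards [hζ.2] with s hs
  exact eq_of_pairing_eq fun ψ => DFunLike.congr_fun hs ψ

/-- The Cauchy–Schwarz inequality. -/
lemma lintegral_enorm_sq_le {α E : Type*} [MeasurableSpace α] [NormedAddCommGroup E]
    [NormedSpace ℝ E] {μ : Measure α} {f : α → E} (hf : AEStronglyMeasurable f μ) :
    (∫⁻ a, ‖f a‖ₑ ∂μ) ^ 2 ≤ μ univ * eLpNorm f 2 μ ^ 2 := by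
  have h := eLpNorm_le_eLpNorm_mul_rpow_measure_univ (μ := μ) (p := 1) (q := 2) (by norm_num) hf
  rw [eLpNorm_one_eq_lintegral_enorm] at h
  calc (∫⁻ a, ‖f a‖ₑ ∂μ) ^ 2 ≤ (eLpNorm f 2 μ
        * μ univ ^ (1 / (1 : ℝ≥0∞).toReal - 1 / (2 : ℝ≥0∞).toReal)) ^ 2 := by gcongr
    _ = μ univ * eLpNorm f 2 μ ^ 2 := by
      rw [mul_pow, ← ENNReal.rpow_natCast (μ univ ^ _), ← ENNReal.rpow_mul, mul_comm]
      norm_num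

lemma integral_norm_sq_eq {α E : Type*} [MeasurableSpace α] [NormedAddCommGroup E]
    {μ : Measure α} {f : α → E} (hf : AEStronglyMeasurable f μ) :
    ∫ a, ‖f a‖ ^ 2 ∂μ = (eLpNorm f 2 μ ^ 2).toReal := by
  rw [eLpNorm_two_sq, integral_eq_lintegral_of_nonneg_ae (ae_of_all _ fun _ => sq_nonneg _)
    (hf.norm.pow 2)]
  congr 1
  refine lintegral_congr fun a => ?_
  rw [ENNReal.ofReal_pow (norm_nonneg _), ofReal_norm]

lemma toReal_histMeasure_univ (hg : IsKernel P g) :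
    (histMeasure g univ).toReal = ∫ s in Ioi 0, g s := by
  have := hg.integral_histMeasure (fun _ => (1 : ℝ))
  simpa [measureReal_def] using this

lemma IsSolution.memLp (hU : IsSolution P g U) {t : ℝ} (ht : 0 ≤ t) :
    MemLp (U t).η 2 (histMeasure g) := (hU.mem_η t ht).1

lemma IsSolution.tendsto_eLpNorm (hU : IsSolution P g U) {t : ℝ} (ht : 0 ≤ t) :
    Tendsto (fun r => eLpNorm ((U r).η - (U t).η) 2 (histMeasure g)) (𝓝[Ici 0] t) (𝓝 0) :=
  tendsto_of_tendsto_of_tendsto_of_le_of_le tendsto_const_nhds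
    (hU.continuous_η t ht 0 zero_le_one) (fun _ => zero_le) fun _ => eLpNorm_le_histDerivNorm _ _

lemma IsSolution.integrable (hU : IsSolution P g U) (hg : IsKernel P g) {t : ℝ} (ht : 0 ≤ t) :
    Integrable (U t).η (histMeasure g) :=
  have := hg.isFiniteMeasure
  (hU.memLp ht).integrable one_le_two

lemma IsSolution.tendsto_integral_norm (hU : IsSolution P g U) (hg : IsKernel P g) {t : ℝ}
    (ht : 0 ≤ t) :
    Tendsto (fun r => ∫ s, ‖(U r).η s - (U t).η s‖ ∂histMeasure g) (𝓝[Ici 0] t) (𝓝 0) := by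
  have := hg.isFiniteMeasure
  set M := histMeasure g univ
  have h1 : Tendsto (fun r =>
      Real.sqrt (M * eLpNorm ((U r).η - (U t).η) 2 (histMeasure g) ^ 2).toReal)
      (𝓝[Ici 0] t) (𝓝 0) := by
    have h2 : Tendsto (fun r => M * eLpNorm ((U r).η - (U t).η) 2 (histMeasure g) ^ 2)
        (𝓝[Ici 0] t) (𝓝 (M * 0 ^ 2)) :=
      ENNReal.Tendsto.const_mul ((ENNReal.continuous_pow 2).tendsto 0 |>.comp
        (hU.tendsto_eLpNorm ht)) (Or.inr (measure_ne_top _ _))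
    have h3 := (ENNReal.tendsto_toReal (by simp)).comp h2
    have h4 := (Real.continuous_sqrt.tendsto _).comp h3
    rwa [zero_pow two_ne_zero, mul_zero, ENNReal.toReal_zero, Real.sqrt_zero] at h4
  refine squeeze_zero' (Eventually.of_forall fun r => integral_nonneg fun _ => norm_nonneg _) ?_ h1
  filter_upwards [self_mem_nhdsWithin] with r hr
  have hd := (hU.memLp hr).sub (hU.memLp ht)
  refine Real.le_sqrt_of_sq_le ?_
  have h4 := lintegral_enorm_sq_le hd.1
  have h5 : ∫ s, ‖(U r).η s - (U t).η s‖ ∂histMeasure g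
      = (∫⁻ s, ‖((U r).η - (U t).η) s‖ₑ ∂histMeasure g).toReal :=
    integral_norm_eq_lintegral_enorm hd.1
  rw [h5, ← ENNReal.toReal_pow]
  exact ENNReal.toReal_mono (ENNReal.mul_ne_top (measure_ne_top _ _)
    (ENNReal.pow_ne_top hd.2.ne)) h4

/-- The equation for `η`, tested with Schwartz functions of `x`, holds for the `L²`-valued integrals
of `η` against test functions of `s`. -/
lemma IsSolution.isTransportSolution (hU : IsSolution P g U) (hg : IsKernel P g)
    (hpos : ∀ s, 0 < s → 0 < g s) :
    IsTransportSolution g (fun t => (U t).η) (fun t => (U t).y) where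
  integrable _ ht := hU.integrable hg ht
  continuous _ ht := hU.tendsto_integral_norm hg ht
  continuous_source := hU.continuous_y
  hasDerivWithinAt w hw hc t ht := by
    -- integrals against a test function are continuous in time
    have hcont : ∀ w : ℝ → ℝ, ContDiff ℝ (⊤ : ℕ∞) w → HasCompactSupport w →
        (∀ t, 0 ≤ t → IntegrableOn (fun s => w s • (U t).η s) (Ioi 0)) ∧
        ContinuousOn (fun t => ∫ s in Ioi (0 : ℝ), w s • (U t).η s) (Ici 0) := by
      intro w hw hc
      obtain ⟨S, hS, M, hM, hwM, hwS, -⟩ := exists_testFunction_bounds hw hc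
      have hi := fun t (ht : 0 ≤ t) => hg.integrableOn_smul hpos hM hw.continuous.measurable hwS
        hwM (hU.integrable hg ht)
      refine ⟨fun t ht => (hi t ht).1, fun t ht => ?_⟩
      rw [ContinuousWithinAt, tendsto_iff_norm_sub_tendsto_zero]
      have h0 := (hU.tendsto_integral_norm hg ht).const_mul (S / g M)
      rw [mul_zero] at h0
      refine squeeze_zero' (Eventually.of_forall fun _ => norm_nonneg _) ?_ h0
      filter_upwards [self_mem_nhdsWithin] with r hr
      rw [← integral_sub (hi r hr).1 (hi t ht).1]
      simp only [← smul_sub]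
      exact (hg.integrableOn_smul hpos hM hw.continuous.measurable hwS hwM
        ((hU.integrable hg hr).sub (hU.integrable hg ht))).2
    have hw' := (contDiff_infty_iff_deriv.1 hw).2
    have hpair : ∀ (ψ : 𝓢(ℝ, ℂ)) (f : ℝ → L2) (w : ℝ → ℝ),
        IntegrableOn (fun s => w s • f s) (Ioi 0) →
        ∫ s in Ioi (0 : ℝ), ((w s : ℝ) : ℂ) * distr (f s) ψ
          = pairing ψ (∫ s in Ioi (0 : ℝ), w s • f s) := fun ψ f w hi => by
      rw [← (pairing ψ).integral_comp_comm hi]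
      refine integral_congr_ae (ae_of_all _ fun s => ?_)
      have := ((pairing ψ).restrictScalars ℝ).map_smul (w s) (f s)
      simp only [ContinuousLinearMap.coe_restrictScalars'] at this
      simp only [this, Complex.real_smul, pairing_apply]
    refine hasDerivWithinAt_of_weak (Z := fun t => (∫ s in Ioi (0 : ℝ), deriv w s • (U t).η s)
      + (∫ s in Ioi (0 : ℝ), w s) • (U t).y) (hcont w hw hc).2
      ((hcont _ hw' hc.deriv).2.add (hU.continuous_y.const_smul
        (∫ s in Ioi (0 : ℝ), w s))) (fun ψ t ht => ?_) ht
    have h := hU.eq_η w hw hc ψ t ht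
    have e1 := hpair ψ (U t).η (deriv w) ((hcont _ hw' hc.deriv).1 t ht)
    have e2 := ((pairing ψ).restrictScalars ℝ).map_smul (∫ s in Ioi (0 : ℝ), w s) (U t).y
    simp only [ContinuousLinearMap.coe_restrictScalars'] at e2
    rw [e1, integral_complex_ofReal] at h
    rw [map_add, e2, Complex.real_smul]
    refine HasDerivWithinAt.congr_of_mem h (fun r hr => ?_) ht
    exact (hpair ψ (U r).η w ((hcont w hw hc).1 r hr)).symm

/-- The history of a solution in terms of a primitive of `y`. -/
lemma IsSolution.exists_history_eq (hU : IsSolution P g U) (hg : IsKernel P g) :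
    ∃ Y : ℝ → L2, ContinuousOn Y (Ici 0) ∧ (∀ t, 0 < t → HasDerivAt Y (U t).y t) ∧
      ∀ t, 0 ≤ t → ∀ᵐ s ∂histMeasure g, (U t).η s = Y t - Y (t - s) := by
  rcases hg.eq_zero_or_pos with h0 | hpos
  · obtain ⟨Y, -, hY⟩ := exists_primitive hU.continuous_y
    refine ⟨Y, fun t _ => (hY t).continuousAt.continuousWithinAt, fun t ht => ?_, fun t _ => ?_⟩
    · simpa [max_eq_left ht.le] using hY t
    · rw [histMeasure_eq_zero h0]
      simp
  · exact (hU.isTransportSolution hg hpos).exists_eq_sub hg hpos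

lemma IsSolution.continuousOn_integral (hU : IsSolution P g U) (hg : IsKernel P g) :
    ContinuousOn (fun t => ∫ s, (U t).η s ∂histMeasure g) (Ici 0) := fun t ht => by
  rw [ContinuousWithinAt, tendsto_iff_norm_sub_tendsto_zero]
  refine squeeze_zero' (Eventually.of_forall fun _ => norm_nonneg _) ?_
    (hU.tendsto_integral_norm hg ht)
  filter_upwards [self_mem_nhdsWithin] with r hr
  rw [← integral_sub (hU.integrable hg hr) (hU.integrable hg ht)]
  exact norm_integral_le_integral_norm _

/-- The history norm of the image of `η` under a bounded operator is continuous in time. -/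
lemma IsSolution.continuousOn_eLpNorm_comp (hU : IsSolution P g U) (L : L2 →L[ℝ] L2) :
    ContinuousOn (fun t => (eLpNorm (fun s => L ((U t).η s)) 2 (histMeasure g) ^ 2).toReal)
      (Ici 0) := fun t ht => by
  set μ := histMeasure g
  have hm : ∀ t, 0 ≤ t → MemLp (fun s => L ((U t).η s)) 2 μ := fun t ht =>
    L.comp_memLp' (hU.memLp ht)
  set d : ℝ → ℝ≥0∞ := fun r => eLpNorm (fun s => L (((U r).η - (U t).η) s)) 2 μ with hd
  have hd0 : Tendsto d (𝓝[Ici 0] t) (𝓝 0) := by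
    have h1 := ENNReal.Tendsto.const_mul (hU.tendsto_eLpNorm ht)
      (Or.inr (ENNReal.ofReal_ne_top (r := ‖L‖)))
    rw [mul_zero] at h1
    refine tendsto_of_tendsto_of_tendsto_of_le_of_le tendsto_const_nhds h1 (fun _ => zero_le)
      fun r => ?_
    exact eLpNorm_le_mul_eLpNorm_of_ae_le_mul (ae_of_all _ fun s => L.le_opNorm _) 2
  have hsub : ∀ r s, L (((U r).η - (U t).η) s) = L ((U r).η s) - L ((U t).η s) := fun r s => by
    rw [Pi.sub_apply, map_sub]
  have key : Tendsto (fun r => eLpNorm (fun s => L ((U r).η s)) 2 μ) (𝓝[Ici 0] t)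
      (𝓝 (eLpNorm (fun s => L ((U t).η s)) 2 μ)) := by
    have l1 : Tendsto (fun r => eLpNorm (fun s => L ((U t).η s)) 2 μ - d r) (𝓝[Ici 0] t)
        (𝓝 (eLpNorm (fun s => L ((U t).η s)) 2 μ - 0)) :=
      ENNReal.Tendsto.sub tendsto_const_nhds hd0 (Or.inl (hm t ht).2.ne)
    have l2 : Tendsto (fun r => eLpNorm (fun s => L ((U t).η s)) 2 μ + d r) (𝓝[Ici 0] t)
        (𝓝 (eLpNorm (fun s => L ((U t).η s)) 2 μ + 0)) := tendsto_const_nhds.add hd0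
    rw [tsub_zero] at l1
    rw [add_zero] at l2
    refine tendsto_of_tendsto_of_tendsto_of_le_of_le' l1 l2 ?_ ?_
    · filter_upwards [self_mem_nhdsWithin] with r hr
      rw [tsub_le_iff_right]
      have := eLpNorm_sub_le (hm r hr).1 ((hm r hr).sub (hm t ht)).1 one_le_two
      refine le_trans (le_of_eq ?_) (this.trans (le_of_eq ?_))
      · congr 1
        ext1 s
        simp
      · simp only [hd, hsub]
        rfl
    · filter_upwards [self_mem_nhdsWithin] with r hr
      have := eLpNorm_add_le (hm t ht).1 ((hm r hr).sub (hm t ht)).1 one_le_two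
      refine le_trans (le_of_eq ?_) (this.trans (le_of_eq ?_))
      · congr 1
        ext1 s
        simp
      · simp only [hd, hsub]
        rfl
  exact (ENNReal.tendsto_toReal (ENNReal.pow_ne_top (hm t ht).2.ne)).comp
    (((ENNReal.continuous_pow 2).tendsto _).comp key)

end Solution

end TimoshenkoCattaneo

namespace TimoshenkoCattaneo

section Flow

open scoped RealInnerProductSpace

variable {P : Params} {g : ℝ → ℝ} {U : ℝ → State}

/-- Distributional derivatives are tested by testing the function itself with another Schwartz
function. -/
lemma exists_pairing_eq (φ : 𝓢(ℝ, ℂ)) : ∃ ψ₁ ψ₂ : 𝓢(ℝ, ℂ),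
    (∀ f : L2, dx (distr f) φ = pairing ψ₁ f) ∧ ∀ f : L2, dx (dx (distr f)) φ = pairing ψ₂ f :=
  ⟨_, _, fun f => by rw [derivCLM_apply_apply]; rfl,
    fun f => by rw [derivCLM_apply_apply, derivCLM_apply_apply]; rfl⟩

/-- The memory term is the second derivative of the weighted integral of the history. -/
lemma integral_dx_dx_distr (hg : IsKernel P g) {η : ℝ → L2} (hη : Integrable η (histMeasure g))
    (φ : 𝓢(ℝ, ℂ)) :
    ∫ s in Ioi (0 : ℝ), ((g s : ℝ) : ℂ) * dx (dx (distr (η s))) φ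
      = dx (dx (distr (∫ s, η s ∂histMeasure g))) φ := by
  obtain ⟨-, ψ, -, hψ⟩ := exists_pairing_eq φ
  simp only [hψ]
  rw [← (pairing ψ).integral_comp_comm hη, hg.integral_histMeasure]
  rfl

/-- `hasDerivAt_shellFourier` for an equation with a nonzero coefficient in front of the time
derivative. -/
lemma hasDerivAt_shellFourier_of_mul {R : ℝ} (hR : 0 < R) {ρ : ℝ} (hρ : ρ ≠ 0)
    {X A₀ A₁ A₂ : ℝ → L2}
    (hX : ContinuousOn X (Ici 0)) (h₀ : ContinuousOn A₀ (Ici 0)) (h₁ : ContinuousOn A₁ (Ici 0))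
    (h₂ : ContinuousOn A₂ (Ici 0))
    (h : ∀ (φ : 𝓢(ℝ, ℂ)) (t : ℝ), 0 ≤ t → HasTimeDeriv (fun r => ρ * distr (X r) φ)
      (distr (A₀ t) φ + dx (distr (A₁ t)) φ + dx (dx (distr (A₂ t))) φ) t) {t : ℝ} (ht : 0 < t) :
    HasDerivAt (fun r => shellFourier R (X r)) (ρ⁻¹ • (shellFourier R (A₀ t)
      + shellDeriv hR (shellFourier R (A₁ t))
      + shellDeriv hR (shellDeriv hR (shellFourier R (A₂ t))))) t := by
  have := hasDerivAt_shellFourier hR (X := fun t => (ρ : ℂ) • X t) (hX.const_smul (ρ : ℂ)) h₀ h₁ h₂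
    (fun φ t ht => by
      simp only [← pairing_apply, map_smul, smul_eq_mul] at h ⊢
      exact h φ t ht) ht
  have h3 := this.const_smul (ρ⁻¹ : ℝ)
  refine h3.congr_of_eventuallyEq (Eventually.of_forall fun r => ?_)
  simp only [Pi.smul_apply, map_smul]
  exact (inv_smul_smul₀ hρ (shellFourier R (X r))).symm

/-- The operator that carries the history of `η` to the history of `∂ₓ η` on a frequency shell,
seen on the Fourier side. -/
noncomputable def shellHist {R : ℝ} (hR : 0 < R) : L2 →L[ℝ] L2 :=
  ((shellDeriv hR).comp (shellFourier R)).restrictScalars ℝ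

lemma shellHist_apply {R : ℝ} (hR : 0 < R) (f : L2) :
    shellHist hR f = shellDeriv hR (shellFourier R f) := rfl

/-- The restriction of a solution to a frequency shell, on the Fourier side, satisfies the equations
of motion there, with `n = ∫ g(s) ∂ₓη(s) ds` and `h = ∫ g(s) ‖∂ₓη(s)‖² ds`. -/
lemma IsSolution.isShellFlow (hU : IsSolution P g U) (hg : IsKernel P g) {k₂ : ℝ}
    (hk₂ : ∀ s, 0 < s → deriv g s ≤ -k₂ * g s) {R : ℝ} (hR : 0 < R) :
    IsShellFlow P (P.a g) k₂ (∫ s in Ioi 0, g s) ((shellDeriv hR).restrictScalars ℝ)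
      (fun t => shellFourier R (U t).v) (fun t => shellFourier R (U t).u)
      (fun t => shellFourier R (U t).z) (fun t => shellFourier R (U t).y)
      (fun t => shellFourier R (U t).θ) (fun t => shellFourier R (U t).q)
      (fun t => shellHist hR (∫ s, (U t).η s ∂histMeasure g))
      (fun t => (eLpNorm (fun s => shellHist hR ((U t).η s)) 2 (histMeasure g) ^ 2).toReal) := by
  have hfin := hg.isFiniteMeasure
  have cJ := (shellFourier R).continuous
  have c0 : ContinuousOn (fun _ : ℝ => (0 : L2)) (Ici 0) := continuousOn_const
  have hJs : ∀ (c : ℝ) (f : L2), shellFourier R ((c : ℂ) • f) = c • shellFourier R f :=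
    fun c f => by rw [map_smul]; rfl
  have hDs : ∀ (c : ℝ) (f : L2), shellDeriv hR (c • f) = c • shellDeriv hR f :=
    fun c f => ((shellDeriv hR).restrictScalars ℝ).map_smul c f
  have hN := hU.continuousOn_integral hg
  have hsm : ∀ (c : ℂ) {X : ℝ → L2}, ContinuousOn X (Ici 0) →
      ContinuousOn (fun t => c • X t) (Ici 0) := fun c X hX => hX.const_smul c
  have hmem : ∀ t, 0 ≤ t → MemLp (fun s => shellHist hR ((U t).η s)) 2 (histMeasure g) :=
    fun t ht => (shellHist hR).comp_memLp' (hU.memLp ht)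
  have hint : ∀ t, 0 ≤ t → ∫ s, shellHist hR ((U t).η s) ∂histMeasure g
      = shellHist hR (∫ s, (U t).η s ∂histMeasure g) := fun t ht =>
    (shellHist hR).integral_comp_comm (hU.integrable hg ht)
  constructor
  · exact cJ.comp_continuousOn hU.continuous_v
  · exact cJ.comp_continuousOn hU.continuous_u
  · exact cJ.comp_continuousOn hU.continuous_z
  · exact cJ.comp_continuousOn hU.continuous_y
  · exact cJ.comp_continuousOn hU.continuous_θ
  · exact cJ.comp_continuousOn hU.continuous_q
  · exact hU.continuousOn_eLpNorm_comp (shellHist hR)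
  · intro t ht
    have := hasDerivAt_shellFourier_of_mul hR one_ne_zero (A₀ := fun t => ((-1 : ℝ) : ℂ) • (U t).y)
      (A₁ := fun t => (U t).u) (A₂ := fun _ => 0) hU.continuous_v (hsm _ hU.continuous_y)
      hU.continuous_u c0 (fun φ t ht => by
        refine HasDerivWithinAt.congr_deriv
          (by simpa only [HasTimeDeriv, Complex.ofReal_one, one_mul] using hU.eq_v φ t ht) ?_
        obtain ⟨ψ₁, ψ₂, e1, e2⟩ := exists_pairing_eq φ
        simp only [e1, e2, ← pairing_apply, map_smul, map_zero, smul_eq_mul]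
        push_cast
        ring) ht
    refine this.congr_deriv ?_
    simp only [ContinuousLinearMap.coe_restrictScalars', hJs, map_zero]
    module
  · intro t ht
    have := hasDerivAt_shellFourier_of_mul hR P.ρ₁_pos.ne' (A₀ := fun _ => 0)
      (A₁ := fun t => (P.κ : ℂ) • (U t).v) (A₂ := fun _ => 0) hU.continuous_u c0
      (hsm _ hU.continuous_v) c0 (fun φ t ht => by
        refine HasDerivWithinAt.congr_deriv (hU.eq_u φ t ht) ?_
        obtain ⟨ψ₁, ψ₂, e1, e2⟩ := exists_pairing_eq φ
        simp only [e1, e2, ← pairing_apply, map_smul, map_zero, smul_eq_mul]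
        ring) ht
    refine this.congr_deriv ?_
    simp only [ContinuousLinearMap.coe_restrictScalars', hJs, hDs, map_zero]
    module
  · intro t ht
    have := hasDerivAt_shellFourier_of_mul hR one_ne_zero (A₀ := fun _ => 0)
      (A₁ := fun t => (U t).y) (A₂ := fun _ => 0) hU.continuous_z c0 hU.continuous_y
      c0 (fun φ t ht => by
        refine HasDerivWithinAt.congr_deriv
          (by simpa only [HasTimeDeriv, Complex.ofReal_one, one_mul] using hU.eq_z φ t ht) ?_
        obtain ⟨ψ₁, ψ₂, e1, e2⟩ := exists_pairing_eq φ
        simp only [e1, e2, ← pairing_apply, map_zero]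
        ring) ht
    refine this.congr_deriv ?_
    simp only [ContinuousLinearMap.coe_restrictScalars', map_zero]
    module
  · intro t ht
    have := hasDerivAt_shellFourier_of_mul hR P.ρ₂_pos.ne' (A₀ := fun t => (P.κ : ℂ) • (U t).v)
      (A₁ := fun t => (P.a g : ℂ) • (U t).z + ((-P.δ : ℝ) : ℂ) • (U t).θ)
      (A₂ := fun t => (P.m : ℂ) • ∫ s, (U t).η s ∂histMeasure g) hU.continuous_y
      (hsm _ hU.continuous_v) ((hsm _ hU.continuous_z).add (hsm _ hU.continuous_θ)) (hsm _ hN)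
      (fun φ t ht => by
        refine HasDerivWithinAt.congr_deriv (hU.eq_y φ t ht) ?_
        rw [integral_dx_dx_distr hg (hU.integrable hg ht)]
        obtain ⟨ψ₁, ψ₂, e1, e2⟩ := exists_pairing_eq φ
        simp only [e1, e2, ← pairing_apply, map_add, map_smul, smul_eq_mul]
        push_cast
        ring) ht
    refine this.congr_deriv ?_
    simp only [ContinuousLinearMap.coe_restrictScalars', shellHist_apply, map_add, hJs, hDs]
    module
  · intro t ht
    have := hasDerivAt_shellFourier_of_mul hR P.ρ₃_pos.ne' (A₀ := fun _ => 0)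
      (A₁ := fun t => ((-1 : ℝ) : ℂ) • (U t).q + ((-P.δ : ℝ) : ℂ) • (U t).y)
      (A₂ := fun _ => 0) hU.continuous_θ c0
      ((hsm _ hU.continuous_q).add (hsm _ hU.continuous_y)) c0
      (fun φ t ht => by
        refine HasDerivWithinAt.congr_deriv (hU.eq_θ φ t ht) ?_
        obtain ⟨ψ₁, ψ₂, e1, e2⟩ := exists_pairing_eq φ
        simp only [e1, e2, ← pairing_apply, map_add, map_smul, map_zero, smul_eq_mul]
        push_cast
        ring) ht
    refine this.congr_deriv ?_
    simp only [ContinuousLinearMap.coe_restrictScalars', map_add, hJs, hDs, map_zero]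
    module
  · intro t ht
    have := hasDerivAt_shellFourier_of_mul hR P.τ_pos.ne'
      (A₀ := fun t => ((-P.β : ℝ) : ℂ) • (U t).q) (A₁ := fun t => ((-1 : ℝ) : ℂ) • (U t).θ) (A₂ := fun _ => 0) hU.continuous_q
      (hsm _ hU.continuous_q) (hsm _ hU.continuous_θ) c0
      (fun φ t ht => by
        refine HasDerivWithinAt.congr_deriv (hU.eq_q φ t ht) ?_
        obtain ⟨ψ₁, ψ₂, e1, e2⟩ := exists_pairing_eq φ
        simp only [e1, e2, ← pairing_apply, map_smul, map_zero, smul_eq_mul]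
        push_cast
        ring) ht
    refine this.congr_deriv ?_
    simp only [ContinuousLinearMap.coe_restrictScalars', hJs, hDs, map_zero]
    module
  · exact fun t ht => ENNReal.toReal_nonneg
  · intro t ht
    have h1 := lintegral_enorm_sq_le (hmem t ht).1
    have h2 : ‖shellHist hR (∫ s, (U t).η s ∂histMeasure g)‖ₑ ^ 2 ≤ histMeasure g univ
        * eLpNorm (fun s => shellHist hR ((U t).η s)) 2 (histMeasure g) ^ 2 := by
      rw [← hint t ht]
      refine le_trans ?_ h1
      gcongr
      exact enorm_integral_le_lintegral_enorm _
    have h3 := ENNReal.toReal_mono (ENNReal.mul_ne_top (measure_ne_top _ _)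
      (ENNReal.pow_ne_top (hmem t ht).2.ne)) h2
    rwa [ENNReal.toReal_mul, toReal_histMeasure_univ hg, ENNReal.toReal_pow,
      toReal_enorm] at h3
  · obtain ⟨Y, hYc, hYd, hY⟩ := hU.exists_history_eq hg
    have hW : ∀ t, 0 ≤ t → ∀ᵐ s ∂histMeasure g, shellHist hR ((U t).η s)
        = shellHist hR (Y t) - shellHist hR (Y (t - s)) := fun t ht => by
      filter_upwards [hY t ht] with s hs
      rw [hs, map_sub]
    have hH : ∀ t, 0 ≤ t → (eLpNorm (fun s => shellHist hR ((U t).η s)) 2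
        (histMeasure g) ^ 2).toReal
        = ∫ s in Ioi 0, g s * ‖shellHist hR (Y t) - shellHist hR (Y (t - s))‖ ^ 2 := fun t ht => by
      rw [← integral_norm_sq_eq (hmem t ht).1]
      have := hg.integral_histMeasure
        (fun s => ‖shellHist hR (Y t) - shellHist hR (Y (t - s))‖ ^ 2)
      simp only [smul_eq_mul] at this
      rw [← this]
      refine integral_congr_ae ?_
      filter_upwards [hW t ht] with s hs
      rw [hs]
    have hNt : ∀ t, 0 ≤ t → shellHist hR (∫ s, (U t).η s ∂histMeasure g)
        = ∫ s in Ioi 0, g s • (shellHist hR (Y t) - shellHist hR (Y (t - s))) := fun t ht => by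
      rw [← hint t ht, ← hg.integral_histMeasure
        (fun s => shellHist hR (Y t) - shellHist hR (Y (t - s)))]
      exact integral_congr_ae (hW t ht)
    intro t ht
    obtain ⟨h', hd, hle⟩ := exists_deriv_history_energy hg hk₂ (W := fun t => shellHist hR (Y t))
      (w := fun t => shellHist hR (U t).y) ((shellHist hR).continuous.comp_continuousOn hYc)
      ((shellHist hR).continuous.comp_continuousOn hU.continuous_y)
      (fun t ht => (shellHist hR).hasFDerivAt.comp_hasDerivAt t (hYd t ht))
      (fun t ht => hg.integrable_histMeasure_iff.1
        (((hmem t ht.le).integrable one_le_two).congr (hW t ht.le)))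
      (fun t ht => by
        have h1 := (memLp_two_iff_integrable_sq_norm (hmem t ht.le).1).1 (hmem t ht.le)
        refine hg.integrable_histMeasure_iff.1 (h1.congr ?_)
        filter_upwards [hW t ht.le] with s hs
        rw [hs]) ht
    refine ⟨h', hd.congr_of_eventuallyEq ?_, ?_⟩
    · filter_upwards [lt_mem_nhds ht] with r hr using hH r hr.le
    · rw [hH t ht.le, hNt t ht.le]
      exact hle

end Flow

end TimoshenkoCattaneo

namespace TimoshenkoCattaneo

/-! ### Decomposition of the norms into dyadic frequency shells -/

section Dyadic

open scoped FourierTransform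

variable {P : Params} {g : ℝ → ℝ}

/-- The squared norm of `∂ₓ^j f` in a frequency shell. -/
noncomputable def shellNormSq (j : ℕ) (R : ℝ) (f : L2) : ℝ≥0∞ :=
  ∫⁻ x in shell R, ‖symb x ^ j‖ₑ ^ 2 * ‖(𝓕 f : L2) x‖ₑ ^ 2

lemma enorm_shellFourier_sq (R : ℝ) (f : L2) : ‖shellFourier R f‖ₑ ^ 2 = shellNormSq 0 R f := by
  rw [enorm_sq_eq_lintegral, shellNormSq, ← lintegral_indicator (measurableSet_shell R)]
  refine lintegral_congr_ae ?_
  filter_upwards [coeFn_shellFourier R f] with x hx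
  rw [hx]
  by_cases h : x ∈ shell R <;> simp [h]

lemma enorm_shellHist_sq {R : ℝ} (hR : 0 < R) (f : L2) :
    ‖shellHist hR f‖ₑ ^ 2 = shellNormSq 1 R f := by
  rw [enorm_sq_eq_lintegral, shellNormSq, ← lintegral_indicator (measurableSet_shell R)]
  refine lintegral_congr_ae ?_
  filter_upwards [coeFn_shellFourier R f,
    coeFn_multiplier (memLp_top_shellSymb hR) (shellFourier R f)] with x h1 h2
  rw [shellHist_apply, shellDeriv, h2, h1]
  by_cases h : x ∈ shell R
  · simp [h, shellSymb_of_mem h, enorm_mul, mul_pow]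
  · simp [h]

lemma mem_shell_zpow_iff {x : ℝ} {n : ℤ} :
    x ∈ shell ((2 : ℝ) ^ n) ↔ ‖symb x‖ ∈ Ico ((2 : ℝ) ^ n) (2 ^ (n + 1)) := by
  rw [zpow_add_one₀ two_ne_zero, mul_comm]
  rfl

lemma pairwise_disjoint_shell :
    Pairwise (Function.onFun Disjoint fun n : ℤ => shell ((2 : ℝ) ^ n)) := by
  intro m n hmn
  refine disjoint_left.2 fun x hm hn => hmn ?_
  rw [mem_shell_zpow_iff] at hm hn
  have h1 := (zpow_lt_zpow_iff_right₀ (one_lt_two (α := ℝ))).1 (hm.1.trans_lt hn.2)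
  have h2 := (zpow_lt_zpow_iff_right₀ (one_lt_two (α := ℝ))).1 (hn.1.trans_lt hm.2)
  omega

lemma iUnion_shell : ⋃ n : ℤ, shell ((2 : ℝ) ^ n) = {0}ᶜ := by
  ext x
  simp only [mem_iUnion, mem_compl_iff, mem_singleton_iff]
  have hx : 0 < ‖symb x‖ ↔ x ≠ 0 := by
    rw [norm_symb]
    have := Real.pi_pos
    constructor
    · rintro h rfl
      simp at h
    · intro h
      have := abs_pos.2 h
      positivity
  constructor
  · rintro ⟨n, hn⟩
    exact hx.1 ((zpow_pos two_pos n).trans_le hn.1)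
  · intro h
    obtain ⟨n, hn⟩ := exists_mem_Ico_zpow (hx.2 h) one_lt_two
    exact ⟨n, mem_shell_zpow_iff.2 hn⟩

lemma freqNormSq_eq_tsum (j : ℕ) (f : L2) :
    freqNormSq j f = ∑' n : ℤ, shellNormSq j ((2 : ℝ) ^ n) f := by
  simp only [shellNormSq]
  rw [← lintegral_iUnion (fun n => measurableSet_shell _) pairwise_disjoint_shell, iUnion_shell,
    freqNormSq, setLIntegral_congr (ae_eq_univ.2 (by simp)), Measure.restrict_univ]

lemma shellNormSq_add_le (R : ℝ) (k j : ℕ) (f : L2) :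
    shellNormSq (k + j) R f ≤ ENNReal.ofReal ((2 * R) ^ k) ^ 2 * shellNormSq j R f := by
  rw [shellNormSq, shellNormSq, ← lintegral_const_mul' _ _ (by simp)]
  refine setLIntegral_mono' (measurableSet_shell R) fun x hx => ?_
  rw [pow_add, enorm_mul, mul_pow, mul_assoc]
  gcongr
  rw [← ofReal_norm, norm_pow]
  exact ENNReal.ofReal_le_ofReal (pow_le_pow_left₀ (norm_nonneg _) hx.2.le k)

lemma le_shellNormSq_add {R : ℝ} (hR : 0 < R) (k j : ℕ) (f : L2) :
    ENNReal.ofReal (R ^ k) ^ 2 * shellNormSq j R f ≤ shellNormSq (k + j) R f := by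
  rw [shellNormSq, shellNormSq, ← lintegral_const_mul' _ _ (by simp)]
  refine setLIntegral_mono' (measurableSet_shell R) fun x hx => ?_
  rw [pow_add, enorm_mul, mul_pow, mul_assoc]
  gcongr
  rw [← ofReal_norm, norm_pow]
  exact ENNReal.ofReal_le_ofReal (pow_le_pow_left₀ hR.le hx.1 k)

lemma freqNormSq_add_le (k j : ℕ) (f : L2) : freqNormSq (k + j) f
    ≤ ∑' n : ℤ, ENNReal.ofReal ((2 * 2 ^ n) ^ k) ^ 2 * shellNormSq j ((2 : ℝ) ^ n) f := by
  rw [freqNormSq_eq_tsum]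
  exact ENNReal.tsum_le_tsum fun n => shellNormSq_add_le _ k j f

lemma le_freqNormSq_add (k j : ℕ) (f : L2) :
    ∑' n : ℤ, ENNReal.ofReal ((2 ^ n) ^ k) ^ 2 * shellNormSq j ((2 : ℝ) ^ n) f
      ≤ freqNormSq (k + j) f := by
  rw [freqNormSq_eq_tsum]
  exact ENNReal.tsum_le_tsum fun n => le_shellNormSq_add (zpow_pos two_pos n) k j f

/-- The energy of a state in a frequency shell. -/
noncomputable def State.shellEnergy (g : ℝ → ℝ) (R : ℝ) (U : State) : ℝ≥0∞ :=
  shellNormSq 0 R U.v + shellNormSq 0 R U.u + shellNormSq 0 R U.z + shellNormSq 0 R U.y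
    + shellNormSq 0 R U.θ + shellNormSq 0 R U.q + ∫⁻ s, shellNormSq 1 R (U.η s) ∂histMeasure g

lemma aemeasurable_shellNormSq {R : ℝ} (hR : 0 < R) {η : ℝ → L2}
    (hη : AEStronglyMeasurable η (histMeasure g)) :
    AEMeasurable (fun s => shellNormSq 1 R (η s)) (histMeasure g) := by
  simp only [← enorm_shellHist_sq hR]
  exact ((shellHist hR).continuous.comp_aestronglyMeasurable hη).enorm.pow_const 2

lemma histDerivNorm_sq_le_tsum {η : ℝ → L2} (hη : AEStronglyMeasurable η (histMeasure g)) (k : ℕ) :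
    histDerivNorm g (k + 1) η ^ 2 ≤ ∑' n : ℤ, ENNReal.ofReal ((2 * 2 ^ n) ^ k) ^ 2
      * ∫⁻ s, shellNormSq 1 ((2 : ℝ) ^ n) (η s) ∂histMeasure g := by
  have hm : ∀ n : ℤ, AEMeasurable (fun s => ENNReal.ofReal ((2 * 2 ^ n) ^ k) ^ 2
      * shellNormSq 1 ((2 : ℝ) ^ n) (η s)) (histMeasure g) := fun n =>
    (aemeasurable_shellNormSq (zpow_pos two_pos n) hη).const_mul _
  have heq : ∑' n : ℤ, ENNReal.ofReal ((2 * 2 ^ n) ^ k) ^ 2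
      * ∫⁻ s, shellNormSq 1 ((2 : ℝ) ^ n) (η s) ∂histMeasure g
      = ∫⁻ s, ∑' n : ℤ, ENNReal.ofReal ((2 * 2 ^ n) ^ k) ^ 2
        * shellNormSq 1 ((2 : ℝ) ^ n) (η s) ∂histMeasure g := by
    rw [lintegral_tsum hm]
    refine tsum_congr fun n => ?_
    rw [lintegral_const_mul' _ _ (by simp)]
  rw [heq]
  by_cases htop : ∫⁻ s, ∑' n : ℤ, ENNReal.ofReal ((2 * 2 ^ n) ^ k) ^ 2
        * shellNormSq 1 ((2 : ℝ) ^ n) (η s) ∂histMeasure g = ⊤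
  · rw [htop]
    exact le_top
  · refine (histDerivNorm_sq_le hη ?_).trans (lintegral_mono fun s => freqNormSq_add_le k 1 (η s))
    filter_upwards [ae_lt_top' (AEMeasurable.tsum hm) htop] with s hs
    exact ((freqNormSq_add_le k 1 (η s)).trans_lt hs).ne

lemma tsum_le_histDerivNorm_sq {η : ℝ → L2} (hη : AEStronglyMeasurable η (histMeasure g)) (k : ℕ) :
    ∑' n : ℤ, ENNReal.ofReal ((2 ^ n) ^ k) ^ 2
      * ∫⁻ s, shellNormSq 1 ((2 : ℝ) ^ n) (η s) ∂histMeasure g ≤ histDerivNorm g (k + 1) η ^ 2 := by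
  have hm : ∀ n : ℤ, AEMeasurable (fun s => ENNReal.ofReal ((2 ^ n) ^ k) ^ 2
      * shellNormSq 1 ((2 : ℝ) ^ n) (η s)) (histMeasure g) := fun n =>
    (aemeasurable_shellNormSq (zpow_pos two_pos n) hη).const_mul _
  refine le_trans (le_of_eq ?_) ((lintegral_mono fun s => le_freqNormSq_add k 1 (η s)).trans
    (le_histDerivNorm_sq g (k + 1) η))
  rw [lintegral_tsum hm]
  refine tsum_congr fun n => ?_
  rw [lintegral_const_mul' _ _ (by simp)]

lemma State.derivNorm2_sq (g : ℝ → ℝ) (k : ℕ) (U : State) :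
    U.derivNorm2 g k ^ 2 = derivNorm k U.v ^ 2 + derivNorm k U.u ^ 2 + derivNorm k U.z ^ 2
      + derivNorm k U.y ^ 2 + derivNorm k U.θ ^ 2 + derivNorm k U.q ^ 2
      + histDerivNorm g (k + 1) U.η ^ 2 := by
  rw [State.derivNorm2, ← ENNReal.rpow_natCast, ← ENNReal.rpow_mul]
  norm_num

/-- The derivatives of a state are controlled by the energies in the dyadic shells. -/
lemma State.derivNorm2_sq_le (k : ℕ) {U : State}
    (hη : AEStronglyMeasurable U.η (histMeasure g)) :
    U.derivNorm2 g k ^ 2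
      ≤ ∑' n : ℤ, ENNReal.ofReal ((2 * 2 ^ n) ^ k) ^ 2 * U.shellEnergy g (2 ^ n) := by
  simp only [State.derivNorm2_sq, State.shellEnergy, mul_add, derivNorm_sq, ENNReal.tsum_add]
  have h := freqNormSq_add_le k 0
  simp only [add_zero] at h
  gcongr
  iterate 6 apply h
  exact histDerivNorm_sq_le_tsum hη k

/-- The reverse of `State.derivNorm2_sq_le`, up to a constant. -/
lemma State.tsum_le_derivNorm2_sq (k : ℕ) {U : State}
    (hη : AEStronglyMeasurable U.η (histMeasure g)) :
    ∑' n : ℤ, ENNReal.ofReal ((2 ^ n) ^ k) ^ 2 * U.shellEnergy g (2 ^ n)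
      ≤ U.derivNorm2 g k ^ 2 := by
  simp only [State.derivNorm2_sq, State.shellEnergy, mul_add, derivNorm_sq, ENNReal.tsum_add]
  have h := le_freqNormSq_add k 0
  simp only [add_zero] at h
  gcongr
  iterate 6 apply h
  exact tsum_le_histDerivNorm_sq hη k

lemma volume_shell_le (R : ℝ) : volume (shell R) ≤ ENNReal.ofReal R := by
  have hpi := Real.pi_gt_three
  have hsub : shell R ⊆ Icc (-(R / 2)) (R / 2) := fun x hx => by
    have h := hx.2
    rw [norm_symb] at h
    refine abs_le.1 ?_
    nlinarith [abs_nonneg x]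
  refine (measure_mono hsub).trans ?_
  rw [Real.volume_Icc]
  exact ENNReal.ofReal_le_ofReal (by linarith)

/-- A shell of radius `R` has length at most `R`, and the Fourier transform is bounded by the `L¹`
norm. -/
lemma shellNormSq_zero_le (R : ℝ) (f : L2) :
    shellNormSq 0 R f ≤ ENNReal.ofReal R * eLpNorm f 1 volume ^ 2 := by
  rw [shellNormSq]
  calc ∫⁻ x in shell R, ‖symb x ^ 0‖ₑ ^ 2 * ‖(𝓕 f : L2) x‖ₑ ^ 2
      ≤ ∫⁻ _ in shell R, eLpNorm f 1 volume ^ 2 := by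
        refine lintegral_mono_ae (ae_restrict_of_ae ?_)
        filter_upwards [enorm_fourier_le_eLpNorm_one f] with x hx
        simpa using pow_le_pow_left' hx 2
    _ ≤ ENNReal.ofReal R * eLpNorm f 1 volume ^ 2 := by
        rw [setLIntegral_const, mul_comm]
        gcongr
        exact volume_shell_le R

lemma IsWeakDeriv.shellNormSq_eq {f h : L2} (hw : IsWeakDeriv 1 f h) (R : ℝ) :
    shellNormSq 1 R f = shellNormSq 0 R h := by
  rw [shellNormSq, shellNormSq]
  refine lintegral_congr_ae (ae_restrict_of_ae ?_)
  filter_upwards [isWeakDeriv_iff.1 hw] with x hx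
  rw [hx, enorm_mul]
  simp [mul_pow]

lemma lintegral_shellNormSq_le (g : ℝ → ℝ) {R : ℝ} (hR : 0 < R) (η : ℝ → L2) :
    ∫⁻ s, shellNormSq 1 R (η s) ∂histMeasure g ≤ ENNReal.ofReal R * histDerivL1 g η ^ 2 := by
  have hR0 : ENNReal.ofReal R ≠ 0 := by simpa using hR
  rw [← ENNReal.inv_mul_le_iff hR0 ENNReal.ofReal_ne_top]
  set X := ∫⁻ s, shellNormSq 1 R (η s) ∂histMeasure g with hX
  have key : ((ENNReal.ofReal R)⁻¹ * X) ^ (1 / 2 : ℝ) ≤ histDerivL1 g η := by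
    refine le_iInf₂ fun ζ hζ => ENNReal.rpow_le_rpow ?_ (by norm_num)
    rw [ENNReal.inv_mul_le_iff hR0 ENNReal.ofReal_ne_top, ← lintegral_const_mul' _ _ (by simp), hX]
    refine lintegral_mono_ae ?_
    filter_upwards [hζ.2] with s hs
    rw [hs.shellNormSq_eq]
    exact shellNormSq_zero_le R (ζ s)
  have h2 := pow_le_pow_left' key 2
  rwa [← ENNReal.rpow_natCast, ← ENNReal.rpow_mul, Nat.cast_ofNat, one_div_mul_cancel two_ne_zero,
    ENNReal.rpow_one] at h2

lemma sq_add_sq_le_add_sq (a b : ℝ≥0∞) : a ^ 2 + b ^ 2 ≤ (a + b) ^ 2 := by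
  rw [add_sq, add_right_comm]
  exact le_self_add

/-- Integrable data have little energy at low frequencies. -/
lemma State.shellEnergy_le_norm1 (g : ℝ → ℝ) {R : ℝ} (hR : 0 < R) (U : State) :
    U.shellEnergy g R ≤ ENNReal.ofReal R * U.norm1 g ^ 2 := by
  calc U.shellEnergy g R ≤ ENNReal.ofReal R * (eLpNorm U.v 1 volume ^ 2 + eLpNorm U.u 1 volume ^ 2
      + eLpNorm U.z 1 volume ^ 2 + eLpNorm U.y 1 volume ^ 2 + eLpNorm U.θ 1 volume ^ 2
      + eLpNorm U.q 1 volume ^ 2 + histDerivL1 g U.η ^ 2) := by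
        simp only [State.shellEnergy, mul_add]
        gcongr
        iterate 6 apply shellNormSq_zero_le
        exact lintegral_shellNormSq_le g hR U.η
    _ ≤ ENNReal.ofReal R * U.norm1 g ^ 2 := by
        gcongr
        rw [State.norm1]
        iterate 6 refine le_trans (add_le_add_left ?_ _) (sq_add_sq_le_add_sq _ _)
        exact le_rfl

/-- The energy of a solution in a frequency shell decays exponentially, at the rate
`R⁴ / (1 + R²)³`. -/
lemma exists_shellEnergy_le (hg : IsKernel P g) :
    ∃ C > 0, ∃ c > 0, ∀ U : ℝ → State, IsSolution P g U → ∀ R, 0 < R → ∀ t, 0 ≤ t →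
      (U t).shellEnergy g R ≤ ENNReal.ofReal (C * Real.exp (-(c * (R ^ 4 / (1 + R ^ 2) ^ 3) * t)))
        * (U 0).shellEnergy g R := by
  obtain ⟨k₁, hk₁, k₂, hk₂, hk⟩ := hg.deriv_bounds
  obtain ⟨C, hC, c, hc, h⟩ := exists_shell_decay (H := L2) P hg.a_pos hk₂
    (setIntegral_nonneg measurableSet_Ioi hg.nonneg)
  refine ⟨C, hC, c, hc, fun U hU R hR t ht => ?_⟩
  have h1 := h R ((shellDeriv hR).restrictScalars ℝ) hR (inner_shellDeriv hR)
    (fun f => (norm_shellDeriv hR f).1) (fun f => (norm_shellDeriv hR f).2) _ _ _ _ _ _ _ _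
    (hU.isShellFlow hg (fun s hs => (hk s hs).2) hR) t ht
  have hE : ∀ t, 0 ≤ t → (U t).shellEnergy g R = ENNReal.ofReal (‖shellFourier R (U t).v‖ ^ 2
      + ‖shellFourier R (U t).u‖ ^ 2 + ‖shellFourier R (U t).z‖ ^ 2 + ‖shellFourier R (U t).y‖ ^ 2
      + ‖shellFourier R (U t).θ‖ ^ 2 + ‖shellFourier R (U t).q‖ ^ 2
      + (eLpNorm (fun s => shellHist hR ((U t).η s)) 2 (histMeasure g) ^ 2).toReal) := by
    intro t ht
    have e1 : ∀ f : L2, shellNormSq 0 R f = ENNReal.ofReal (‖shellFourier R f‖ ^ 2) := fun f => by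
      rw [← enorm_shellFourier_sq, ENNReal.ofReal_pow (norm_nonneg _), ofReal_norm]
    have e2 : ∫⁻ s, shellNormSq 1 R ((U t).η s) ∂histMeasure g = ENNReal.ofReal
        (eLpNorm (fun s => shellHist hR ((U t).η s)) 2 (histMeasure g) ^ 2).toReal := by
      have hm : MemLp (fun s => shellHist hR ((U t).η s)) 2 (histMeasure g) :=
        (shellHist hR).comp_memLp' (hU.memLp ht)
      rw [ENNReal.ofReal_toReal (ENNReal.pow_ne_top hm.2.ne), eLpNorm_two_sq]
      simp only [enorm_shellHist_sq]
    rw [State.shellEnergy]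
    simp only [e1, e2]
    iterate 6 rw [ENNReal.ofReal_add (by positivity) (by positivity)]
  rw [hE t ht, hE 0 le_rfl, ← ENNReal.ofReal_mul (by positivity)]
  exact ENNReal.ofReal_le_ofReal h1

end Dyadic

end TimoshenkoCattaneo

namespace TimoshenkoCattaneo

/-! ### Summation over the frequency shells -/

section Summation

lemma exists_pow_mul_exp_le (q : ℕ) {c : ℝ} (hc : 0 < c) :
    ∃ K > 0, ∀ y, 0 ≤ y → y ^ q * Real.exp (-(c * y)) ≤ K := by
  refine ⟨q.factorial / c ^ q, by positivity, fun y hy => ?_⟩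
  have h := Real.pow_div_factorial_le_exp (c * y) (by positivity) q
  rw [div_le_iff₀ (by positivity), mul_pow] at h
  rw [Real.exp_neg, ← div_eq_mul_inv, div_le_div_iff₀ (Real.exp_pos _) (by positivity)]
  linarith

/-- The function `x ^ p * exp (-c x⁴)` decays at least like `min x x⁻¹`. -/
lemma exists_pow_mul_exp_pow_four_le {p : ℕ} (hp : 1 ≤ p) {c : ℝ} (hc : 0 < c) :
    ∃ K > 0, ∀ x, 0 < x → x ^ p * Real.exp (-(c * x ^ 4)) ≤ K * x ∧
      x ^ p * Real.exp (-(c * x ^ 4)) ≤ K * x⁻¹ := by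
  obtain ⟨K, hK, h⟩ := exists_pow_mul_exp_le (p + 1) hc
  refine ⟨K + 1, by positivity, fun x hx => ?_⟩
  rcases le_total x 1 with h1 | h1
  · have h2 : x ^ p * Real.exp (-(c * x ^ 4)) ≤ x :=
      (mul_le_of_le_one_right (by positivity) (Real.exp_le_one_iff.2 (by
        have : 0 ≤ c * x ^ 4 := by positivity
        linarith))).trans (by simpa using pow_le_pow_of_le_one hx.le h1 hp)
    have h3 : 1 ≤ x⁻¹ := (one_le_inv₀ hx).2 h1
    constructor
    · nlinarith
    · nlinarith
  · have h2 : x ^ p * Real.exp (-(c * x ^ 4)) ≤ K * x⁻¹ := by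
      rw [← div_eq_mul_inv, le_div_iff₀ hx]
      calc x ^ p * Real.exp (-(c * x ^ 4)) * x = x ^ (p + 1) * Real.exp (-(c * x ^ 4)) := by ring
        _ ≤ (x ^ 4) ^ (p + 1) * Real.exp (-(c * x ^ 4)) := by
          gcongr
          exact le_self_pow₀ h1 (by norm_num)
        _ ≤ K := h _ (by positivity)
    have h3 : 0 < x⁻¹ := by positivity
    have h4 : x⁻¹ ≤ 1 := inv_le_one_of_one_le₀ h1
    constructor <;> nlinarith

lemma tsum_half_pow_natAbs_ne_top :
    ∑' j : ℤ, ENNReal.ofReal ((1 / 2 : ℝ) ^ j.natAbs) ≠ ⊤ := by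
  have h : Summable fun n : ℕ => (1 / 2 : ℝ) ^ n := summable_geometric_two
  refine Summable.tsum_ofReal_ne_top (Summable.of_nat_of_neg ?_ ?_)
  · simpa using h
  · simpa using h

/-- The dyadic version of `∫ ξ ^ (p - 1) exp (-c ξ⁴ T) dξ ≤ K T ^ (-p / 4)`. -/
lemma exists_tsum_zpow_mul_exp_le {p : ℕ} (hp : 1 ≤ p) {c : ℝ} (hc : 0 < c) :
    ∃ K > 0, ∀ T : ℝ, 0 < T →
      ∑' n : ℤ, ENNReal.ofReal (((2 : ℝ) ^ n) ^ p * Real.exp (-(c * (((2 : ℝ) ^ n) ^ 4 * T))))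
        ≤ ENNReal.ofReal (K * T ^ (-(p / 4 : ℝ))) := by
  obtain ⟨K, hK, hmin⟩ := exists_pow_mul_exp_pow_four_le hp hc
  set S := (∑' j : ℤ, ENNReal.ofReal ((1 / 2 : ℝ) ^ j.natAbs)).toReal with hS
  refine ⟨2 * K * S + 1, by positivity, fun T hT => ?_⟩
  set L := T ^ (1 / 4 : ℝ) with hL
  have hL0 : 0 < L := Real.rpow_pos_of_pos hT _
  have hL4 : L ^ 4 = T := by
    rw [hL, ← Real.rpow_natCast, ← Real.rpow_mul hT.le]
    norm_num
  have hLp : T ^ (-(p / 4 : ℝ)) * L ^ p = 1 := by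
    rw [hL, ← Real.rpow_natCast, ← Real.rpow_mul hT.le, ← Real.rpow_add hT,
      show -(p / 4 : ℝ) + 1 / 4 * p = 0 by ring, Real.rpow_zero]
  obtain ⟨m, hm1, hm2⟩ := exists_mem_Ico_zpow hL0 (one_lt_two (α := ℝ))
  have hTp : 0 < T ^ (-(p / 4 : ℝ)) := Real.rpow_pos_of_pos hT _
  -- after rescaling by `T ^ (1 / 4)`, the sum only depends on `n + m`
  have hterm : ∀ n : ℤ, ((2 : ℝ) ^ n) ^ p * Real.exp (-(c * (((2 : ℝ) ^ n) ^ 4 * T)))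
      ≤ 2 * K * T ^ (-(p / 4 : ℝ)) * (1 / 2 : ℝ) ^ (n + m).natAbs := by
    intro n
    have hn : (0 : ℝ) < 2 ^ n := zpow_pos two_pos n
    set x := (2 : ℝ) ^ n * L with hx
    have hx0 : 0 < x := by positivity
    have e1 : ((2 : ℝ) ^ n) ^ p = T ^ (-(p / 4 : ℝ)) * x ^ p := by
      rw [hx, mul_pow]
      linear_combination (-((2 : ℝ) ^ n) ^ p) * hLp
    have e2 : ((2 : ℝ) ^ n) ^ 4 * T = x ^ 4 := by rw [hx, mul_pow, hL4]
    have hb : x ^ p * Real.exp (-(c * x ^ 4)) ≤ 2 * K * (1 / 2 : ℝ) ^ (n + m).natAbs := by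
      have hlow : (2 : ℝ) ^ (n + m) ≤ x := by
        rw [zpow_add₀ two_ne_zero, hx]
        gcongr
      have hup : x ≤ 2 * (2 : ℝ) ^ (n + m) := by
        rw [zpow_add₀ two_ne_zero, hx]
        rw [zpow_add_one₀ two_ne_zero] at hm2
        nlinarith
      rcases le_total 0 (n + m) with h | h
      · obtain ⟨j, hj⟩ := Int.eq_ofNat_of_zero_le h
        rw [hj] at hlow ⊢
        rw [zpow_natCast] at hlow
        rw [Int.natAbs_natCast, one_div, inv_pow]
        have h1 : x⁻¹ ≤ ((2 : ℝ) ^ j)⁻¹ := inv_anti₀ (by positivity) hlow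
        have h2 : 0 < ((2 : ℝ) ^ j)⁻¹ := by positivity
        have := (hmin x hx0).2
        nlinarith
      · obtain ⟨j, hj⟩ := Int.exists_eq_neg_ofNat h
        rw [hj] at hup ⊢
        rw [zpow_neg, zpow_natCast] at hup
        rw [Int.natAbs_neg, Int.natAbs_natCast, one_div, inv_pow]
        have := (hmin x hx0).1
        nlinarith
    rw [e1, e2, mul_assoc]
    calc T ^ (-(p / 4 : ℝ)) * (x ^ p * Real.exp (-(c * x ^ 4)))
        ≤ T ^ (-(p / 4 : ℝ)) * (2 * K * (1 / 2 : ℝ) ^ (n + m).natAbs) := by gcongr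
      _ = 2 * K * T ^ (-(p / 4 : ℝ)) * (1 / 2 : ℝ) ^ (n + m).natAbs := by ring
  calc ∑' n : ℤ, ENNReal.ofReal (((2 : ℝ) ^ n) ^ p * Real.exp (-(c * (((2 : ℝ) ^ n) ^ 4 * T))))
      ≤ ∑' n : ℤ, ENNReal.ofReal (2 * K * T ^ (-(p / 4 : ℝ)))
        * ENNReal.ofReal ((1 / 2 : ℝ) ^ (n + m).natAbs) := by
        refine ENNReal.tsum_le_tsum fun n => ?_
        rw [← ENNReal.ofReal_mul (by positivity)]
        exact ENNReal.ofReal_le_ofReal (hterm n)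
    _ = ENNReal.ofReal (2 * K * T ^ (-(p / 4 : ℝ))) * ENNReal.ofReal S := by
        rw [ENNReal.tsum_mul_left, hS, ENNReal.ofReal_toReal tsum_half_pow_natAbs_ne_top]
        congr 1
        exact (Equiv.addRight m).tsum_eq fun j : ℤ => ENNReal.ofReal ((1 / 2 : ℝ) ^ j.natAbs)
    _ ≤ ENNReal.ofReal ((2 * K * S + 1) * T ^ (-(p / 4 : ℝ))) := by
        rw [← ENNReal.ofReal_mul (by positivity)]
        refine ENNReal.ofReal_le_ofReal ?_
        nlinarith

/-- Regularity of order `l` compensates the loss of dissipation at high frequencies. -/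
lemma exists_exp_neg_div_sq_le (l : ℕ) {c : ℝ} (hc : 0 < c) :
    ∃ K > 0, ∀ t R : ℝ, 0 ≤ t → 1 ≤ R →
      Real.exp (-(c * (t / R ^ 2))) ≤ K * ((1 + t) ^ l)⁻¹ * (R ^ l) ^ 2 := by
  obtain ⟨K, hK, h⟩ := exists_pow_mul_exp_le l hc
  refine ⟨K * Real.exp c, by positivity, fun t R ht hR => ?_⟩
  have hR0 : 0 < R := by linarith
  have hR2 : 1 ≤ R ^ 2 := one_le_pow₀ hR
  have h1 := h (1 + t / R ^ 2) (by positivity)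
  have h2 : (1 + t) / R ^ 2 ≤ 1 + t / R ^ 2 := by
    rw [add_div]
    have : 1 / R ^ 2 ≤ 1 := (div_le_one (by positivity)).2 hR2
    linarith
  have h3 : ((1 + t) / R ^ 2) ^ l * Real.exp (-(c * (t / R ^ 2))) ≤ K * Real.exp c := by
    calc ((1 + t) / R ^ 2) ^ l * Real.exp (-(c * (t / R ^ 2)))
        ≤ (1 + t / R ^ 2) ^ l * Real.exp (-(c * (t / R ^ 2))) := by gcongr
      _ = (1 + t / R ^ 2) ^ l * Real.exp (-(c * (1 + t / R ^ 2))) * Real.exp c := by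
        rw [mul_assoc, ← Real.exp_add]
        congr 2
        ring
      _ ≤ K * Real.exp c := by gcongr
  have h4 : 0 < (1 + t) ^ l := by positivity
  rw [div_pow, div_mul_eq_mul_div, div_le_iff₀ (by positivity), ← pow_mul] at h3
  rw [← pow_mul, mul_comm l 2, mul_right_comm, ← div_eq_mul_inv, le_div_iff₀ h4]
  linarith

end Summation

end TimoshenkoCattaneo

namespace TimoshenkoCattaneo

/-! ### The decay estimate -/

section Decay

variable {P : Params} {g : ℝ → ℝ}

/-- The decay rate is comparable to `R⁴` at low frequencies. -/
lemma rate_ge_low {R : ℝ} (hR : 0 < R) (h1 : R ≤ 1) : R ^ 4 / 8 ≤ R ^ 4 / (1 + R ^ 2) ^ 3 := by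
  have h2 : R ^ 2 ≤ 1 := pow_le_one₀ hR.le h1
  refine div_le_div_of_nonneg_left (by positivity) (by positivity) ?_
  calc (1 + R ^ 2) ^ 3 ≤ (1 + 1) ^ 3 := by gcongr
    _ = 8 := by norm_num

/-- The decay rate is comparable to `R⁻²` at high frequencies. -/
lemma rate_ge_high {R : ℝ} (h1 : 1 ≤ R) : 1 / (8 * R ^ 2) ≤ R ^ 4 / (1 + R ^ 2) ^ 3 := by
  have h2 : 1 ≤ R ^ 2 := one_le_pow₀ h1
  rw [div_le_div_iff₀ (by positivity) (by positivity)]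
  calc 1 * (1 + R ^ 2) ^ 3 ≤ 1 * (R ^ 2 + R ^ 2) ^ 3 := by gcongr
    _ = R ^ 4 * (8 * R ^ 2) := by ring

/-- The decay estimate for fixed orders of differentiation, in squared form. -/
lemma exists_derivNorm2_sq_le (hg : IsKernel P g) (k l : ℕ) :
    ∃ C > 0, ∀ U : ℝ → State, IsSolution P g U → ∀ t, 0 ≤ t →
      (U t).derivNorm2 g k ^ 2 ≤
        ENNReal.ofReal (C * (1 + t) ^ (-((2 * k + 1 : ℕ) / 4 : ℝ))) * (U 0).norm1 g ^ 2
          + ENNReal.ofReal (C * ((1 + t) ^ l)⁻¹) * (U 0).derivNorm2 g (k + l) ^ 2 := by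
  obtain ⟨C, hC, c, hc, hdecay⟩ := exists_shellEnergy_le hg
  have hc8 : 0 < c / 8 := by positivity
  obtain ⟨K₁, hK₁, hlow⟩ := exists_tsum_zpow_mul_exp_le (p := 2 * k + 1) (by omega) hc8
  obtain ⟨K₂, hK₂, hhigh⟩ := exists_exp_neg_div_sq_le l hc8
  set M₁ := 4 ^ k * C * Real.exp (c / 8) with hM₁
  set M₂ := 4 ^ k * C * K₂ with hM₂
  have hM₁0 : 0 < M₁ := by positivity
  have hM₂0 : 0 < M₂ := by positivity
  refine ⟨M₁ * K₁ + M₂, by positivity, fun U hU t ht => ?_⟩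
  have ht1 : 0 < 1 + t := by linarith
  have hterm : ∀ n : ℤ, ENNReal.ofReal ((2 * 2 ^ n) ^ k) ^ 2 * (U t).shellEnergy g (2 ^ n)
      ≤ ENNReal.ofReal M₁ * ENNReal.ofReal (((2 : ℝ) ^ n) ^ (2 * k + 1)
          * Real.exp (-(c / 8 * (((2 : ℝ) ^ n) ^ 4 * (1 + t))))) * (U 0).norm1 g ^ 2
        + ENNReal.ofReal (M₂ * ((1 + t) ^ l)⁻¹)
          * (ENNReal.ofReal ((2 ^ n) ^ (k + l)) ^ 2 * (U 0).shellEnergy g (2 ^ n)) := by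
    intro n
    have hR : (0 : ℝ) < 2 ^ n := zpow_pos two_pos n
    set R := (2 : ℝ) ^ n with hRdef
    have h1 := hdecay U hU R hR t ht
    set E := Real.exp (-(c * (R ^ 4 / (1 + R ^ 2) ^ 3) * t)) with hE
    have h2 : ENNReal.ofReal ((2 * R) ^ k) ^ 2 * (U t).shellEnergy g R
        ≤ ENNReal.ofReal (4 ^ k * C * (R ^ k) ^ 2 * E) * (U 0).shellEnergy g R := by
      calc ENNReal.ofReal ((2 * R) ^ k) ^ 2 * (U t).shellEnergy g R
          ≤ ENNReal.ofReal ((2 * R) ^ k) ^ 2 * (ENNReal.ofReal (C * E)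
            * (U 0).shellEnergy g R) := by gcongr
        _ = ENNReal.ofReal (4 ^ k * C * (R ^ k) ^ 2 * E) * (U 0).shellEnergy g R := by
          rw [← mul_assoc, ← ENNReal.ofReal_pow (by positivity),
            ← ENNReal.ofReal_mul (by positivity)]
          congr 2
          rw [mul_pow, mul_pow, ← pow_mul, mul_comm k 2, pow_mul]
          norm_num
          ring
    refine h2.trans ?_
    -- low frequencies are estimated by the `L¹` norm, high frequencies by further derivatives
    rcases le_total R 1 with hR1 | hR1
    · refine le_add_right ?_
      have h3 : E ≤ Real.exp (c / 8) * Real.exp (-(c / 8 * (R ^ 4 * (1 + t)))) := by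
        rw [hE, ← Real.exp_add]
        refine Real.exp_le_exp.2 ?_
        have h4 := mul_le_mul_of_nonneg_left (rate_ge_low hR hR1) (mul_nonneg hc.le ht)
        have h5 : R ^ 4 ≤ 1 := pow_le_one₀ hR.le hR1
        nlinarith
      calc ENNReal.ofReal (4 ^ k * C * (R ^ k) ^ 2 * E) * (U 0).shellEnergy g R
          ≤ ENNReal.ofReal (4 ^ k * C * (R ^ k) ^ 2
            * (Real.exp (c / 8) * Real.exp (-(c / 8 * (R ^ 4 * (1 + t))))))
            * (ENNReal.ofReal R * (U 0).norm1 g ^ 2) := by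
            gcongr
            exact State.shellEnergy_le_norm1 g hR _
        _ = _ := by
            rw [← mul_assoc, ← ENNReal.ofReal_mul (by positivity),
              ← ENNReal.ofReal_mul hM₁0.le, hM₁]
            congr 2
            ring
    · refine le_add_left ?_
      have h3 : E ≤ K₂ * ((1 + t) ^ l)⁻¹ * (R ^ l) ^ 2 := by
        refine le_trans (Real.exp_le_exp.2 ?_) (hhigh t R ht hR1)
        have h4 := mul_le_mul_of_nonneg_left (rate_ge_high hR1) (mul_nonneg hc.le ht)
        have h5 : c / 8 * (t / R ^ 2) = c * t * (1 / (8 * R ^ 2)) := by field_simp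
        rw [h5]
        linarith
      calc ENNReal.ofReal (4 ^ k * C * (R ^ k) ^ 2 * E) * (U 0).shellEnergy g R
          ≤ ENNReal.ofReal (4 ^ k * C * (R ^ k) ^ 2 * (K₂ * ((1 + t) ^ l)⁻¹ * (R ^ l) ^ 2))
            * (U 0).shellEnergy g R := by gcongr
        _ = _ := by
            rw [← mul_assoc (ENNReal.ofReal (M₂ * _)), ← ENNReal.ofReal_pow (by positivity),
              ← ENNReal.ofReal_mul (by positivity), hM₂]
            congr 2
            ring
  calc (U t).derivNorm2 g k ^ 2
      ≤ ∑' n : ℤ, ENNReal.ofReal ((2 * 2 ^ n) ^ k) ^ 2 * (U t).shellEnergy g (2 ^ n) :=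
        State.derivNorm2_sq_le k (hU.memLp ht).1
    _ ≤ _ := ENNReal.tsum_le_tsum hterm
    _ = ENNReal.ofReal M₁ * (∑' n : ℤ, ENNReal.ofReal (((2 : ℝ) ^ n) ^ (2 * k + 1)
          * Real.exp (-(c / 8 * (((2 : ℝ) ^ n) ^ 4 * (1 + t)))))) * (U 0).norm1 g ^ 2
        + ENNReal.ofReal (M₂ * ((1 + t) ^ l)⁻¹)
          * ∑' n : ℤ, ENNReal.ofReal ((2 ^ n) ^ (k + l)) ^ 2 * (U 0).shellEnergy g (2 ^ n) := by
        rw [ENNReal.tsum_add, ENNReal.tsum_mul_left, ENNReal.tsum_mul_right, ENNReal.tsum_mul_left]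
    _ ≤ ENNReal.ofReal M₁ * ENNReal.ofReal (K₁ * (1 + t) ^ (-((2 * k + 1 : ℕ) / 4 : ℝ)))
          * (U 0).norm1 g ^ 2
        + ENNReal.ofReal (M₂ * ((1 + t) ^ l)⁻¹) * (U 0).derivNorm2 g (k + l) ^ 2 := by
        gcongr
        · exact hlow (1 + t) ht1
        · exact State.tsum_le_derivNorm2_sq (k + l) (hU.memLp le_rfl).1
    _ ≤ _ := by
        rw [← ENNReal.ofReal_mul hM₁0.le, ← mul_assoc]
        have hp : 0 < (1 + t) ^ (-((2 * k + 1 : ℕ) / 4 : ℝ)) := Real.rpow_pos_of_pos ht1 _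
        gcongr
        · linarith
        · have : 0 < M₁ * K₁ := by positivity
          linarith

/-- The decay estimate for fixed orders of differentiation. -/
lemma exists_derivNorm2_le (hg : IsKernel P g) (k l : ℕ) :
    ∃ C > 0, ∀ U : ℝ → State, IsSolution P g U → ∀ t, 0 ≤ t →
      (U t).derivNorm2 g k ≤
        ENNReal.ofReal (C * (1 + t) ^ (-(1 / 8 : ℝ) - (k : ℝ) / 4)) * (U 0).norm1 g
          + ENNReal.ofReal (C * (1 + t) ^ (-((l : ℝ) / 2))) * (U 0).derivNorm2 g (k + l) := by
  obtain ⟨C, hC, h⟩ := exists_derivNorm2_sq_le hg k l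
  refine ⟨Real.sqrt C, Real.sqrt_pos.2 hC, fun U hU t ht => ?_⟩
  have ht1 : 0 < 1 + t := by linarith
  refine (ENNReal.pow_le_pow_left_iff two_ne_zero).1 ((h U hU t ht).trans ?_)
  refine le_trans (le_of_eq ?_) (sq_add_sq_le_add_sq _ _)
  rw [mul_pow, mul_pow, ← ENNReal.ofReal_pow (by positivity), ← ENNReal.ofReal_pow (by positivity),
    mul_pow, mul_pow, Real.sq_sqrt hC.le, ← Real.rpow_natCast (_ ^ _) 2, ← Real.rpow_mul ht1.le,
    ← Real.rpow_natCast (_ ^ _) 2, ← Real.rpow_mul ht1.le, ← Real.rpow_natCast (1 + t) l,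
    ← Real.rpow_neg ht1.le]
  congr 5
  · push_cast
    ring
  · push_cast
    ring

end Decay

end TimoshenkoCattaneo

theorem theorem4p1 (P : TimoshenkoCattaneo.Params) (g : ℝ → ℝ)
    (hg : TimoshenkoCattaneo.IsKernel P g) (s : ℕ) :
    ∃ C : ℝ, 0 < C ∧
      ∀ U : ℝ → TimoshenkoCattaneo.State, TimoshenkoCattaneo.IsSolution P g U →
        (U 0).MemH g s → (U 0).MemL1 g →
        ∀ k l : ℕ, k + l ≤ s → ∀ t : ℝ, 0 ≤ t →
          (P.χ = 0 →
            (U t).derivNorm2 g k ≤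
              ENNReal.ofReal (C * (1 + t) ^ (-(1 / 8 : ℝ) - (k : ℝ) / 4)) * (U 0).norm1 g
                + ENNReal.ofReal (C * (1 + t) ^ (-((l : ℝ) / 2))) * (U 0).derivNorm2 g (k + l)) ∧
          (P.χ ≠ 0 →
            (U t).derivNorm2 g k ≤
              ENNReal.ofReal (C * (1 + t) ^ (-(1 / 8 : ℝ) - (k : ℝ) / 4)) * (U 0).norm1 g
                + ENNReal.ofReal (C * (1 + t) ^ (-((l : ℝ) / 4))) * (U 0).derivNorm2 g (k + l)) := by
  choose C hC h using fun p : ℕ × ℕ => TimoshenkoCattaneo.exists_derivNorm2_le hg p.1 p.2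
  -- only finitely many pairs `(k, l)` occur; the sum of their constants serves all of them
  set K := ∑ p ∈ Finset.range (s + 1) ×ˢ Finset.range (s + 1), C p with hK
  have hle : ∀ k l, k + l ≤ s → C (k, l) ≤ K := fun k l hkl =>
    Finset.single_le_sum (f := C) (fun p _ => (hC p).le)
      (Finset.mem_product.2 ⟨Finset.mem_range.2 (by simp only; omega),
        Finset.mem_range.2 (by simp only; omega)⟩)
  refine ⟨K, (hC (0, 0)).trans_le (hle 0 0 (Nat.zero_le s)), fun U hU _ _ k l hkl t ht => ?_⟩
  have ht1 : 0 < 1 + t := by linarith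
  have hKkl := hle k l hkl
  have hK0 := (hC (k, l)).trans_le hKkl
  have key : ∀ r : ℝ, -((l : ℝ) / 2) ≤ r → (U t).derivNorm2 g k ≤
      ENNReal.ofReal (K * (1 + t) ^ (-(1 / 8 : ℝ) - (k : ℝ) / 4)) * (U 0).norm1 g
        + ENNReal.ofReal (K * (1 + t) ^ r) * (U 0).derivNorm2 g (k + l) := fun r hr => by
    refine (h (k, l) U hU t ht).trans ?_
    have hpow := Real.rpow_le_rpow_of_exponent_le (by linarith : 1 ≤ 1 + t) hr
    gcongr
  -- the exponent `-l / 2` is available for every `χ`, and `-l / 2 ≤ -l / 4`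
  refine ⟨fun _ => key _ le_rfl, fun _ => key _ ?_⟩
  have : (0 : ℝ) ≤ l := Nat.cast_nonneg l
  linarith
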